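/- **Setting.** Let $M$ be Minkowski space with signature $(+,-,-,-)$, $x^2=x\cdot x$, and let $e\neq 0$ be a real number. Let $l$ range over future-pointing lightlike vectors, $H_+=\{v: v^2=1,\ v^0>0\}$, and let $d\nu$ be the invariant measure $2\delta(z^2+1)\,d^4z$ on the hyperboloid $z^2=-1$. Let $d^2l$ be the invariant measure on null directions, so that $\int f(l)\,d^2l=\int f(e_0+\vec n)\,d\Omega(\vec n)$ for $f$ homogeneous of degree $-2$. Put $L_{ab}=l_a\partial/\partial l^b-l_b\partial/\partial l^a$. *Electromagnetic test functions.* $\mathcal V$ is the set of smooth $V(s,l)\in M$ ($s\in\mathbb R$) such that for some $\varepsilon>0$: - $V(\mu s,\mu l)=\mu^{-1}V(s,l)$ for $\mu>0$, and $l\cdot V(s,l)=0$; - for every $k\ge 0$, $|L_{b_1c_1}\cdots L_{b_kc_k}\partial_sV_a(s,l)|\le \mathrm{const}(k)\,(t\cdot l)^{-2}(1+|s|/t\cdot l)^{-1-\varepsilon}$, where $t$ is a unit future timelike vector; - $V(+\infty,l)=-V(-\infty,l)=:\frac12\Delta V(l)$ and $L_{[ab}\Delta V_{c]}=0$. *Profiles.*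 A choice of profiles is a family $V_v\in\mathcal V$, $v\in H_+$, with $V_v(s,l)$ smooth in $(v,s,l)$ and even in $s$. *Phase operator.* For $V_1\in\mathcal V$ and a four-spinor Schwartz function $f\in\mathcal S(H_+)$ let $(S^\infty_{V_1,V_*}f)(v)=e^{i\varphi(v)}f(v)$ with $$\varphi(v)=-\frac{e}{4\pi}\int\frac{v\cdot\Delta V_1(l)}{v\cdot l}\,d^2l+\frac1{2\pi}\int V_v(0,l)\cdot\Delta V_1(l)\,d^2l .$$ *Cones and asymptotes.* A spacelike cone is a closed cone with apex $0$ and nonempty interior, all of whose nonzero vectors are spacelike. A symmetrical spacelike cone is the union $C\cup(-C)$ with $C$ a spacelike cone. An admissible asymptote supported in $D$ is $J(x)=x\rho_1(x)$, where $\rho_1$ is real, smooth outside $0$, homogeneous of degree $-4$, even, supported in $D$, and $\int\rho_1\,d\nu=0$. The element $V_1\in\mathcal V$ has asymptote $J$ if $\Delta V_1(l)=\int \frac{z\rho_1(z)}{z\cdot l}\,d\nu(z)$ (principal value) for all $l$. **Theorem.** Let $V_v$ be any choice of profiles. 1. For every symmetrical spacelike cone $D$ it is not true that $S^\infty_{V_1,V_*}f=f$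 for all $f\in\mathcal S(H_+)$ and all $V_1\in\mathcal V$ having an admissible asymptote $J_1(z)=z\rho_1(z)$ supported in $D$. That is, no choice of profiles makes $S^\infty_{V_1,V_*}$ trivial for all test functions and all asymptotes supported in a given symmetrical spacelike cone. 2. For every $v\in H_+$ the principal value $$F_v(x)=\frac1{2\pi}\int\frac{1}{x\cdot l}\;x\cdot\Big[V_v(0,l)-\frac{e\,v}{2\,v\cdot l}\Big]d^2l$$ exists for all $x$ with $x^2<0$. It defines there an even, twice continuously differentiable function, homogeneous of degree $0$, with $\Box F_v(x)=2e/x^2$. In particular, $F_v$ is not constant on the nonzero vectors of any symmetrical spacelike cone. -/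

import Mathlib

open MeasureTheory Filter Topology
open scoped ContDiff

noncomputable section

namespace AsympQED

/-! ### Minkowski space, its hypersurfaces and their invariant measures -/

/-- Minkowski vector space, in a fixed Minkowski basis; the index `0` is time. -/
abbrev Mink : Type := Fin 4 → ℝ

/-- Euclidean three-space. -/
abbrev Space : Type := EuclideanSpace ℝ (Fin 3)

/-- The basis vector `e_a`. -/
def basisVec (a : Fin 4) : Mink := Pi.single a 1

/-- The Minkowski product, signature `(+,-,-,-)`. -/
def dot (x y : Mink) : ℝ := x 0 * y 0 - ∑ i : Fin 3, x i.succ * y i.succ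

/-- The vector with time component `t` and space component `y`. -/
def mkVec (t : ℝ) (y : Space) : Mink := Fin.cons t (fun i => y i)

/-- The space component of a vector. -/
def spatial (x : Mink) : Space := WithLp.toLp 2 (fun i : Fin 3 => x i.succ)

/-- Spacelike vectors. -/
def spacelike : Set Mink := {x | dot x x < 0}

/-- The future light cone without its apex. -/
def lightCone : Set Mink := {l | dot l l = 0 ∧ 0 < l 0}

/-- The hyperboloid `H_+` of future-pointing unit timelike vectors. -/
def hypPlus : Set Mink := {v | dot v v = 1 ∧ 0 < v 0}

/-- Global chart of the future light cone, on `Space ∖ {0}`; its inverse is `spatial`. -/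
def coneChart (y : Space) : Mink := mkVec ‖y‖ y

/-- Global chart of `H_+`, on `Space`; its inverse is `spatial`. -/
def hypChart (p : Space) : Mink := mkVec (Real.sqrt (1 + ‖p‖ ^ 2)) p

/-- The measure `d²l` on null directions, realized on the section `l = e₀ + n` with `n` in the
unit sphere: `∫ f(l) d²l = ∫ f(e₀ + n) dΩ(n)` for `f` homogeneous of degree `-2`. -/
def lightMeasure : Measure Mink :=
  Measure.map (fun n : Metric.sphere (0 : Space) 1 => mkVec 1 (n : Space))
    (volume : Measure Space).toSphere

/-- The invariant measure `dν(z) = 2 δ(z² + 1) d⁴z` on the hyperboloid `z² = -1`. In the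
parametrization `z = (sinh θ, cosh θ n)`, `n` in the unit sphere, it is `cosh² θ dθ dΩ(n)`. -/
def nuMeasure : Measure Mink :=
  Measure.map
    (fun p : ℝ × Metric.sphere (0 : Space) 1 =>
      mkVec (Real.sinh p.1) (Real.cosh p.1 • (p.2 : Space)))
    (((volume : Measure ℝ).withDensity (fun θ => ENNReal.ofReal (Real.cosh θ ^ 2))).prod
      (volume : Measure Space).toSphere)

/-- `L_ab = l_a ∂/∂l^b - l_b ∂/∂l^a` on functions on the light cone. At `l` this is the tangent
vector `l_a e_b - l_b e_a` of the cone; the derivative is taken in the chart. -/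
def coneL {E : Type*} [NormedAddCommGroup E] [NormedSpace ℝ E] (a b : Fin 4) (f : Mink → E)
    (l : Mink) : E :=
  fderiv ℝ (fun y : Space => f (coneChart y)) (spatial l)
    (spatial (dot (basisVec a) l • basisVec b - dot (basisVec b) l • basisVec a))

/-- `L_{b₁c₁} ⋯ L_{b_kc_k} f`. -/
def coneLIter {E : Type*} [NormedAddCommGroup E] [NormedSpace ℝ E]
    (I : List (Fin 4 × Fin 4)) (f : Mink → E) : Mink → E :=
  I.foldr (fun bc g => coneL bc.1 bc.2 g) f

/-- `δ_b = v^a (v_a ∂/∂v^b - v_b ∂/∂v^a)` on functions on `H_+`. At `v` this is the tangent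
vector `e_b - v_b v` of `H_+`; the derivative is taken in the chart. -/
def hypDelta {E : Type*} [NormedAddCommGroup E] [NormedSpace ℝ E] (b : Fin 4) (f : Mink → E)
    (v : Mink) : E :=
  fderiv ℝ (fun p : Space => f (hypChart p)) (spatial v)
    (spatial (basisVec b - dot (basisVec b) v • v))

/-- `δ_{b₁} ⋯ δ_{b_k} f`. -/
def hypDeltaIter {E : Type*} [NormedAddCommGroup E] [NormedSpace ℝ E]
    (I : List (Fin 4)) (f : Mink → E) : Mink → E :=
  I.foldr (fun b g => hypDelta b g) f

/-- The wave operator `□ = ∂_0² - ∂_1² - ∂_2² - ∂_3²`. -/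
def box (F : Mink → ℝ) (x : Mink) : ℝ :=
  ∑ a : Fin 4, dot (basisVec a) (basisVec a) *
    fderiv ℝ (fun y => fderiv ℝ F y (basisVec a)) x (basisVec a)

/-! ### Spacelike cones -/

/-- Closed solid cones with apex at the origin all of whose nonzero vectors are spacelike. -/
structure IsSpacelikeCone (C : Set Mink) : Prop where
  isClosed : IsClosed C
  smul_mem : ∀ x ∈ C, ∀ μ : ℝ, 0 ≤ μ → μ • x ∈ C
  solid : (interior C).Nonempty
  spacelike : ∀ x ∈ C, x ≠ 0 → x ∈ spacelike

/-- The union of a spacelike cone with its reflection with respect to the apex. -/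
def IsSymmetricalSpacelikeCone (D : Set Mink) : Prop :=
  ∃ C : Set Mink, IsSpacelikeCone C ∧ D = C ∪ {x | -x ∈ C}

/-! ### Electromagnetic test functions -/

/-- The long-range tail `ΔV(l) = 2 V(+∞, l)`. -/
def tail (V : ℝ → Mink → Mink) (l : Mink) : Mink :=
  (2 : ℝ) • limUnder atTop (fun s : ℝ => V s l)

/-- The space `𝒱_ε`. Only the values `V s l` with `l` on the future light cone matter. The
fall-off is stated with the timelike unit vector `t = e₀`, so that `t·l = l 0`; it is then
true for every other `t`, with other constants. -/
structure MemVEps (ε : ℝ) (V : ℝ → Mink → Mink) : Prop where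
  smooth : ContDiffOn ℝ ∞ (fun p : ℝ × Space => V p.1 (coneChart p.2)) {p | p.2 ≠ 0}
  homogeneous : ∀ μ : ℝ, 0 < μ → ∀ s : ℝ, ∀ l ∈ lightCone, V (μ * s) (μ • l) = μ⁻¹ • V s l
  orthogonal : ∀ s : ℝ, ∀ l ∈ lightCone, dot l (V s l) = 0
  falloff : ∀ (I : List (Fin 4 × Fin 4)) (a : Fin 4), ∃ C : ℝ, ∀ s : ℝ, ∀ l ∈ lightCone,
    |coneLIter I (fun l' => deriv (fun s' => V s' l' a) s) l| ≤
      C / (l 0 ^ 2 * (1 + |s| / l 0) ^ (1 + ε))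
  tendsto_atTop : ∀ l ∈ lightCone,
    Tendsto (fun s => V s l) atTop (𝓝 ((1 / 2 : ℝ) • tail V l))
  tendsto_atBot : ∀ l ∈ lightCone,
    Tendsto (fun s => V s l) atBot (𝓝 (-((1 / 2 : ℝ) • tail V l)))
  tail_closed : ∀ a b c : Fin 4, ∀ l ∈ lightCone,
    coneL a b (fun l' => dot (basisVec c) (tail V l')) l
      + coneL b c (fun l' => dot (basisVec a) (tail V l')) l
      + coneL c a (fun l' => dot (basisVec b) (tail V l')) l = 0

/-- The space `𝒱 = ⋃_{ε > 0} 𝒱_ε`. -/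
def MemV (V : ℝ → Mink → Mink) : Prop := ∃ ε : ℝ, 0 < ε ∧ MemVEps ε V

/-- The functions `ρ` for which `J(x) = x ρ(x)` is an admissible asymptote of a test current
supported in `D`: smooth outside the origin, homogeneous of degree `-4`, even, with
`∫ ρ dν = 0`. -/
structure IsAsymptoteDensity (D : Set Mink) (ρ : Mink → ℝ) : Prop where
  smooth : ContDiffOn ℝ ∞ ρ {x | x ≠ 0}
  homogeneous : ∀ μ : ℝ, 0 < μ → ∀ x : Mink, x ≠ 0 → ρ (μ • x) = (μ ^ 4)⁻¹ * ρ x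
  even : ∀ x : Mink, ρ (-x) = ρ x
  integral_eq_zero : ∫ z, ρ z ∂nuMeasure = 0
  support : ∀ x : Mink, x ≠ 0 → x ∉ D → ρ x = 0

/-- `V` has the tail produced by currents with asymptote `J`:
`ΔV(l) = ∫ J(z)/(z·l) dν(z)`, principal value. -/
def HasAsymptote (V : ℝ → Mink → Mink) (J : Mink → Mink) : Prop :=
  ∀ l ∈ lightCone,
    Tendsto (fun η : ℝ => ∫ z in {z | η ≤ |dot z l|}, (dot z l)⁻¹ • J z ∂nuMeasure)
      (𝓝[>] 0) (𝓝 (tail V l))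

/-! ### Matter test functions, cloud profiles and the asymptotic phase -/

/-- The Schwartz space `𝒮(H_+)` of four-spinor functions on `H_+`. -/
structure IsTestSpinor (f : Mink → Fin 4 → ℂ) : Prop where
  smooth : ContDiff ℝ ∞ (fun p : Space => f (hypChart p))
  bounded : ∀ (α : Fin 4 → ℕ) (β : List (Fin 4)), ∃ C : ℝ, ∀ v ∈ hypPlus, ∀ j : Fin 4,
    (∏ a, |v a| ^ α a) * ‖hypDeltaIter β (fun w => f w j) v‖ ≤ C

/-- Families `V_v(s,l)` of cloud profiles, `v ∈ H_+`: in `𝒱` for each `v`, smooth in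
`(v,s,l)`, even in `s`. -/
structure IsProfileFamily (Vs : Mink → ℝ → Mink → Mink) : Prop where
  memV : ∀ v ∈ hypPlus, MemV (Vs v)
  smooth : ContDiffOn ℝ ∞
    (fun p : Space × ℝ × Space => Vs (hypChart p.1) p.2.1 (coneChart p.2.2)) {p | p.2.2 ≠ 0}
  even : ∀ v ∈ hypPlus, ∀ s : ℝ, ∀ l ∈ lightCone, Vs v (-s) l = Vs v s l

/-- The asymptotic phase `φ^∞_{V₁,V_*}(v)`. -/
def phase (e : ℝ) (V₁ : ℝ → Mink → Mink) (Vs : Mink → ℝ → Mink → Mink) (v : Mink) : ℝ :=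
  -(e / (4 * Real.pi)) * ∫ l, dot v (tail V₁ l) / dot v l ∂lightMeasure
    + 1 / (2 * Real.pi) * ∫ l, dot (Vs v 0 l) (tail V₁ l) ∂lightMeasure

/-- The asymptotic phase operator `S^∞_{V₁,V_*}`. -/
def phaseOp (e : ℝ) (V₁ : ℝ → Mink → Mink) (Vs : Mink → ℝ → Mink → Mink)
    (f : Mink → Fin 4 → ℂ) (v : Mink) : Fin 4 → ℂ :=
  Complex.exp (Complex.I * (phase e V₁ Vs v : ℂ)) • f v

/-- The truncation, to `|x·l| ≥ η`, of the principal value integral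
`F_v(x) = (1/2π) ∫ (x·l)⁻¹ x·[V_v(0,l) - e v / (2 v·l)] d²l`. -/
def truncF (e : ℝ) (Vs : Mink → ℝ → Mink → Mink) (v x : Mink) (η : ℝ) : ℝ :=
  1 / (2 * Real.pi) * ∫ l in {l | η ≤ |dot x l|},
    (dot x l)⁻¹ * dot x (Vs v 0 l - (e / (2 * dot v l)) • v) ∂lightMeasure

end AsympQED

end

/-! Null directions are represented by l = (1, n) with n on the unit sphere, and for spacelike x
everything rests on the principal value of ∫ H(n)/(x·l), whose kernel is singular where x·l = 0.
With a the spatial part of x, the tangential field a - ⟪a, n⟫ n differentiates x·l to x² - (x·l)(2x⁰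
- x·l). Since x² ≠ 0, integration by parts (`sph_divergence`, `pvInt_mul`) trades 1/(x·l) for
log|x·l|. By Archimedes' theorem x·l is uniformly distributed on an interval (`map_hgt_sphMeasure`),
so truncating at |x·l| = η costs O(η), locally uniformly in x (`exists_abs_pvInt_sub_pv_le`).
Principal values therefore exist, the gradient of the logarithmic potential of H consists of the
principal values of l_a H (`hasFDerivAt_logInt_zero`), and principal values are in turn expressed by
logarithmic potentials. Bootstrapping makes both smooth on spacelike vectors.

As l_0 = 1, pv(H) is the time derivative of the logarithmic potential, hence ∂_a pv(H) = ∂_0 pv(l_a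
H), and l² = 0 gives □ pv(H) = 0. For F = (1/2π) ∫ x·W/(x·l), where W = V_v(0,l) - e v/(2 v·l), only
the cross terms of □ survive: □F = (1/π) ∂_0 pv(l·W). Orthogonality of the profile to l makes l·W =
-e/2 for every choice of profile, and pv(1) is elementary, so □F = 2e/x² (`box_cloudF`). Such an F
is constant on no nonempty open set of spacelike vectors (`not_const_of_box`).

The first claim follows by duality. On z = (sinh θ, cosh θ n), for densities cosh²θ · ρ that are
finite sums of products c(θ) b(n) of zero total mass, the tail is an integral of principal values
over θ. It satisfies all conditions on tails (`isTail_coneTail`) and is attained by an explicit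
element of the test space (`memV_tailV`). The principal value kernel sinh θ - cosh θ ⟪m, n⟫ is
symmetric in m and n, and this turns the phase into ∫ ρ F dν (`phase_eq_integral_cloudF`). Two even
packets placed where F takes different values, with opposite masses, then give an admissible ρ with
nonzero phase. Scaling makes the phase π, and exp(iπ) = -1 is not 1. -/

noncomputable section

namespace AsympQED

open Metric Set
open scoped RealInnerProductSpace Pointwise

/-! ### Rotations and integration by parts on the unit sphere -/

/-- The unit sphere in `Space`. -/
abbrev Sph : Type := sphere (0 : Space) 1

/-- The surface measure of the unit sphere. -/
abbrev sphMeasure : Measure Sph := (volume : Measure Space).toSphere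

theorem norm_sph (n : Sph) : ‖(n : Space)‖ = 1 := by
  simp

theorem sph_ne_zero (n : Sph) : (n : Space) ≠ 0 := by
  intro h
  have := norm_sph n
  rw [h] at this
  simp at this

/-- The action of a linear isometry on the unit sphere. -/
def sphMap (R : Space ≃ₗᵢ[ℝ] Space) (n : Sph) : Sph :=
  ⟨R n, by simp⟩

theorem measurable_sphMap (R : Space ≃ₗᵢ[ℝ] Space) : Measurable (sphMap R) :=
  (Continuous.subtype_mk (R.continuous.comp continuous_subtype_val) _).measurable

/-- Surface measure of a set is, up to the dimension factor, the volume of the truncated cone over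
it; a linear isometry maps cones to cones and preserves volume. -/
theorem measurePreserving_sphMap (R : Space ≃ₗᵢ[ℝ] Space) :
    MeasurePreserving (sphMap R) sphMeasure sphMeasure := by
  refine ⟨measurable_sphMap R, ?_⟩
  ext s hs
  rw [Measure.map_apply (measurable_sphMap R) hs, Measure.toSphere_apply' _ hs,
    Measure.toSphere_apply' _ (measurable_sphMap R hs)]
  congr 1
  have key : Ioo (0 : ℝ) 1 • ((↑) '' (sphMap R ⁻¹' s) : Set Space)
      = R ⁻¹' (Ioo (0 : ℝ) 1 • ((↑) '' s)) := by
    ext x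
    simp only [Set.mem_smul, mem_preimage]
    constructor
    · rintro ⟨r, hr, _, ⟨n, hn, rfl⟩, rfl⟩
      exact ⟨r, hr, R n, ⟨sphMap R n, hn, rfl⟩, by simp⟩
    · rintro ⟨r, hr, _, ⟨n, hn, rfl⟩, h⟩
      have hn' : sphMap R (sphMap R.symm n) = n := by
        ext1; simp [sphMap]
      refine ⟨r, hr, R.symm n, ⟨sphMap R.symm n, ?_, rfl⟩, ?_⟩
      · rwa [mem_preimage, hn']
      · apply R.injective
        simp [h]
  rw [key]
  exact R.measurePreserving.measure_preimage_equiv (f := R.toMeasurableEquiv) _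

theorem integral_sphMap (R : Space ≃ₗᵢ[ℝ] Space) (f : Sph → ℝ) :
    ∫ n, f (sphMap R n) ∂sphMeasure = ∫ n, f n ∂sphMeasure := by
  have hR : MeasurableEmbedding (sphMap R) := by
    refine MeasurableEquiv.measurableEmbedding
      ⟨⟨sphMap R, sphMap R.symm, fun n => ?_, fun n => ?_⟩, measurable_sphMap R,
        measurable_sphMap R.symm⟩ <;> ext1 <;> simp [sphMap]
  exact (measurePreserving_sphMap R).integral_comp hR f

/-- The infinitesimal rotation `m ↦ ⟨b, m⟩ a - ⟨a, m⟩ b`. -/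
def rotGen (a b : Space) : Space →L[ℝ] Space :=
  (innerSL ℝ b).smulRight a - (innerSL ℝ a).smulRight b

@[simp] theorem rotGen_apply (a b m : Space) : rotGen a b m = ⟪b, m⟫ • a - ⟪a, m⟫ • b := by
  simp [rotGen]

theorem rotGen_mem_skewAdjoint (a b : Space) :
    rotGen a b ∈ skewAdjoint (Space →L[ℝ] Space) := by
  rw [skewAdjoint.mem_iff, ContinuousLinearMap.star_eq_adjoint, eq_comm,
    ContinuousLinearMap.eq_adjoint_iff]
  intro x y
  simp only [_root_.neg_apply, rotGen_apply, inner_neg_left, inner_sub_left,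
    inner_sub_right, real_inner_smul_left, real_inner_smul_right]
  rw [real_inner_comm x b, real_inner_comm x a]
  ring

instance : NormedAlgebra ℚ (Space →L[ℝ] Space) := NormedAlgebra.restrictScalars ℚ ℝ _

/-- The rotation `exp (t A)` for skew-adjoint `A`. -/
def rotFlow (A : Space →L[ℝ] Space) (hA : A ∈ skewAdjoint (Space →L[ℝ] Space)) (t : ℝ) :
    Space ≃ₗᵢ[ℝ] Space :=
  Unitary.linearIsometryEquiv ⟨NormedSpace.exp (t • A),
    NormedSpace.exp_mem_unitary_of_mem_skewAdjoint (skewAdjoint.smul_mem t hA)⟩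

theorem rotFlow_apply (A : Space →L[ℝ] Space) (hA) (t : ℝ) (m : Space) :
    rotFlow A hA t m = NormedSpace.exp (t • A) m := rfl

theorem hasDerivAt_rotFlow (A : Space →L[ℝ] Space) (hA) (t : ℝ) (m : Space) :
    HasDerivAt (fun t => rotFlow A hA t m) (A (rotFlow A hA t m)) t := by
  have h := hasDerivAt_exp_smul_const' (𝕂 := ℝ) A t
  exact (ContinuousLinearMap.apply ℝ Space m).hasFDerivAt.comp_hasDerivAt t h

/-- The orbit speed is at most ‖A‖ because the flow stays on the sphere. This supplies a dominating
constant uniform in n for differentiation under the integral. -/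
theorem norm_rotFlow_sub_le (A : Space →L[ℝ] Space) (hA) (s t : ℝ) (n : Sph) :
    ‖rotFlow A hA t n - rotFlow A hA s n‖ ≤ ‖A‖ * ‖t - s‖ := by
  refine convex_univ.norm_image_sub_le_of_norm_hasDerivWithin_le
    (f := fun t => rotFlow A hA t n) (f' := fun t => A (rotFlow A hA t n))
    (fun u _ => (hasDerivAt_rotFlow A hA u n).hasDerivWithinAt) (fun u _ => ?_)
    (mem_univ s) (mem_univ t)
  refine (A.le_opNorm _).trans ?_
  rw [LinearIsometryEquiv.norm_map, norm_sph, mul_one]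

/-- Infinitesimal rotations integrate to zero over the sphere. -/
theorem integral_fderiv_skew_eq_zero (A : Space →L[ℝ] Space)
    (hA : A ∈ skewAdjoint (Space →L[ℝ] Space)) (f : Space → ℝ) {K : NNReal}
    (hf : LipschitzOnWith K f (sphere 0 1))
    (hd : ∀ᵐ n : Sph ∂sphMeasure, DifferentiableAt ℝ f n) :
    Integrable (fun n : Sph => fderiv ℝ f n (A n)) sphMeasure ∧
      ∫ n : Sph, fderiv ℝ f n (A n) ∂sphMeasure = 0 := by
  have hmem : ∀ t (n : Sph), rotFlow A hA t n ∈ sphere (0 : Space) 1 := fun t n => by simp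
  have hcont : ∀ t, Continuous fun n : Sph => f (rotFlow A hA t n) := fun t =>
    hf.continuousOn.comp_continuous
      ((rotFlow A hA t).continuous.comp continuous_subtype_val) (hmem t)
  have hf_int : ∀ t, Integrable (fun n : Sph => f (rotFlow A hA t n)) sphMeasure := fun t =>
    (hcont t).integrable_of_hasCompactSupport (HasCompactSupport.of_compactSpace _)
  have hzero : ∀ m : Space, rotFlow A hA 0 m = m := fun m => by
    have h0 : (0 : ℝ) • A = 0 := zero_smul ℝ A
    rw [rotFlow_apply, h0, NormedSpace.exp_zero]; rfl
  have hderiv : ∀ᵐ n : Sph ∂sphMeasure,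
      HasDerivAt (fun t => f (rotFlow A hA t n)) (fderiv ℝ f n (A n)) 0 := by
    filter_upwards [hd] with n hn
    have h1 : HasFDerivAt f (fderiv ℝ f n) (rotFlow A hA 0 n) := by
      rw [hzero]; exact hn.hasFDerivAt
    have h2 := h1.comp_hasDerivAt (0 : ℝ) (hasDerivAt_rotFlow A hA 0 (n : Space))
    rwa [hzero] at h2
  have hmeas : AEStronglyMeasurable (fun n : Sph => fderiv ℝ f n (A n)) sphMeasure :=
    (isBoundedBilinearMap_apply.continuous.measurable.comp
      (((measurable_fderiv ℝ f).comp measurable_subtype_coe).prodMk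
        (A.continuous.measurable.comp measurable_subtype_coe))).aestronglyMeasurable
  -- By rotation invariance the integral of f along the flow does not depend on t, so its derivative
  -- at 0 vanishes. The Lipschitz form of dominated differentiation is needed because f is
  -- differentiable only almost everywhere.
  have h := (hasDerivAt_integral_of_dominated_loc_of_lip (μ := sphMeasure) (s := univ)
    (F := fun t (n : Sph) => f (rotFlow A hA t n)) (F' := fun n : Sph => fderiv ℝ f n (A n))
    (x₀ := (0 : ℝ)) (bound := fun _ => K * ‖A‖) univ_mem
    (Eventually.of_forall fun t => (hf_int t).1) (hf_int 0) hmeas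
    (Eventually.of_forall fun n => ?_) (integrable_const _) hderiv)
  · have hc : (fun t => ∫ n : Sph, f (rotFlow A hA t n) ∂sphMeasure)
        = fun _ => ∫ n : Sph, f n ∂sphMeasure := by
      funext t
      exact integral_sphMap (rotFlow A hA t) fun n => f n
    rw [hc] at h
    exact ⟨h.1, h.2.unique (hasDerivAt_const _ _)⟩
  · refine LipschitzOnWith.of_dist_le_mul fun t _ s _ => ?_
    refine (hf.dist_le_mul _ (hmem t n) _ (hmem s n)).trans ?_
    rw [Real.coe_nnabs, abs_of_nonneg (by positivity), dist_eq_norm, dist_eq_norm, mul_assoc]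
    exact mul_le_mul_of_nonneg_left (norm_rotFlow_sub_le A hA s t n) K.2

/-- Functions that are Lipschitz on the unit sphere. -/
def LipSph (f : Space → ℝ) : Prop := ∃ K : NNReal, LipschitzOnWith K f (sphere 0 1)

theorem LipSph.continuousOn {f : Space → ℝ} (hf : LipSph f) : ContinuousOn f (sphere 0 1) :=
  hf.choose_spec.continuousOn

theorem LipSph.continuous {f : Space → ℝ} (hf : LipSph f) : Continuous fun n : Sph => f n :=
  hf.continuousOn.comp_continuous continuous_subtype_val fun n => n.2

theorem integrable_sph {E : Type*} [NormedAddCommGroup E] {f : Sph → E} (hf : Continuous f) :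
    Integrable f sphMeasure :=
  hf.integrable_of_hasCompactSupport (HasCompactSupport.of_compactSpace _)

theorem LipSph.mul {f g : Space → ℝ} (hf : LipSph f) (hg : LipSph g) :
    LipSph fun n => f n * g n := by
  obtain ⟨C, hC⟩ := (isCompact_sphere (0 : Space) 1).exists_bound_of_continuousOn hf.continuousOn
  obtain ⟨D, hD⟩ := (isCompact_sphere (0 : Space) 1).exists_bound_of_continuousOn hg.continuousOn
  obtain ⟨K, hK⟩ := hf
  obtain ⟨L, hL⟩ := hg
  refine ⟨C.toNNReal * L + K * D.toNNReal, LipschitzOnWith.of_dist_le_mul fun x hx y hy => ?_⟩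
  have h1 := hK.dist_le_mul x hx y hy
  have h2 := hL.dist_le_mul x hx y hy
  have hCx := (hC x hx).trans (Real.le_coe_toNNReal C)
  have hDy := (hD y hy).trans (Real.le_coe_toNNReal D)
  rw [Real.dist_eq] at *
  rw [Real.norm_eq_abs] at hCx hDy
  have e : f x * g x - f y * g y = f x * (g x - g y) + (f x - f y) * g y := by ring
  rw [e]
  refine (abs_add_le _ _).trans ?_
  rw [abs_mul, abs_mul]
  have h3 : |f x| * |g x - g y| ≤ C.toNNReal * (L * dist x y) :=
    mul_le_mul hCx h2 (abs_nonneg _) (by positivity)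
  have h4 : |f x - f y| * |g y| ≤ K * dist x y * D.toNNReal :=
    mul_le_mul h1 hDy (abs_nonneg _) (by positivity)
  push_cast
  linarith

theorem lipSph_of_contDiffOn {f : Space → ℝ} (hf : ContDiffOn ℝ 1 f {0}ᶜ) : LipSph f := by
  refine LocallyLipschitzOn.exists_lipschitzOnWith_of_compact (isCompact_sphere _ _) ?_
  intro x hx
  have hx0 : x ≠ 0 := fun h => by simp [h] at hx
  have h1 : ContDiffAt ℝ 1 f x := hf.contDiffAt (isOpen_compl_singleton.mem_nhds hx0)
  obtain ⟨K, t, ht, hK⟩ := h1.exists_lipschitzOnWith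
  exact ⟨K, t, mem_nhdsWithin_of_mem_nhds ht, hK⟩

theorem lipSph_coord (j : Fin 3) : LipSph fun n => n j :=
  lipSph_of_contDiffOn (by fun_prop)

theorem sum_coord_sq (n : Sph) : ∑ j : Fin 3, (n : Space) j * (n : Space) j = 1 := by
  have h := EuclideanSpace.real_norm_sq_eq (n : Space)
  rw [norm_sph] at h
  simp_rw [← pow_two]
  linarith

/-- The divergence theorem on the unit sphere for the gradient of `n ↦ ⟨a, n⟩`. -/
theorem sph_divergence (a : Space) (g : Space → ℝ) (hg : LipSph g)
    (hd : ∀ᵐ n : Sph ∂sphMeasure, DifferentiableAt ℝ g n) :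
    Integrable (fun n : Sph => fderiv ℝ g n (a - ⟪a, (n : Space)⟫ • (n : Space))) sphMeasure ∧
    ∫ n : Sph, fderiv ℝ g n (a - ⟪a, (n : Space)⟫ • (n : Space)) ∂sphMeasure
      = ∫ n : Sph, 2 * ⟪a, (n : Space)⟫ * g n ∂sphMeasure := by
  let e : Fin 3 → Space := fun j => EuclideanSpace.single j 1
  have hj : ∀ j, Integrable (fun n : Sph => fderiv ℝ (fun m : Space => m j * g m) n
      (rotGen a (e j) n)) sphMeasure ∧
      ∫ n : Sph, fderiv ℝ (fun m : Space => m j * g m) n (rotGen a (e j) n) ∂sphMeasure = 0 := by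
    intro j
    obtain ⟨K, hK⟩ := (lipSph_coord j).mul hg
    refine integral_fderiv_skew_eq_zero _ (rotGen_mem_skewAdjoint _ _) _ hK ?_
    filter_upwards [hd] with n hn
    have : DifferentiableAt ℝ (fun m : Space => m j) n := by fun_prop
    exact this.mul hn
  -- Rotation fields in the planes (a, e_j), weighted by n_j, add up to a - ⟪a, n⟫ n on the unit
  -- sphere. Differentiating the weights contributes ⟪a, n⟫ - 3⟪a, n⟫, the 3 being the dimension;
  -- hence the term -2⟪a, n⟫ g.
  have hsum : (fun n : Sph => ∑ j, fderiv ℝ (fun m : Space => m j * g m) n (rotGen a (e j) n))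
      =ᵐ[sphMeasure] fun n => fderiv ℝ g n (a - ⟪a, (n : Space)⟫ • (n : Space))
        - 2 * ⟪a, (n : Space)⟫ * g n := by
    filter_upwards [hd] with n hn
    have hcoord : ∀ j, HasFDerivAt (fun m : Space => m j)
        (EuclideanSpace.proj j : Space →L[ℝ] ℝ) (n : Space) := fun j =>
      (EuclideanSpace.proj j : Space →L[ℝ] ℝ).hasFDerivAt
    have h1 : ∀ j, fderiv ℝ (fun m : Space => m j * g m) n (rotGen a (e j) n)
        = (n : Space) j * fderiv ℝ g n (rotGen a (e j) n)
          + g n * (rotGen a (e j) n) j := by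
      intro j
      rw [show fderiv ℝ (fun m : Space => m j * g m) n = _ from
        ((hcoord j).mul hn.hasFDerivAt).fderiv]
      simp
    have h2 : ∀ j, rotGen a (e j) n = (n : Space) j • a - ⟪a, (n : Space)⟫ • e j := by
      intro j
      simp [e, EuclideanSpace.inner_single_left]
    have h3 : (n : Space) = ∑ j, (n : Space) j • e j := by
      ext i
      simp [e, Finset.sum_apply, Pi.single_apply]
    have h4 : ⟪a, (n : Space)⟫ = ∑ j, a j * (n : Space) j := by
      simp [PiLp.inner_apply, mul_comm]
    have h5 : fderiv ℝ g n (n : Space) = ∑ j, (n : Space) j * fderiv ℝ g n (e j) := by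
      have := congrArg (fderiv ℝ g n) h3
      rwa [map_sum, Finset.sum_congr rfl fun j _ => map_smul _ _ _] at this
    simp_rw [h1, h2, map_sub, map_smul, smul_eq_mul, h5, Finset.sum_add_distrib]
    have h6 := sum_coord_sq n
    have h7 : ∑ j, g n * ((n : Space) j • a - ⟪a, (n : Space)⟫ • e j).ofLp j
        = g n * (⟪a, (n : Space)⟫ - 3 * ⟪a, (n : Space)⟫) := by
      simp only [PiLp.sub_apply, PiLp.smul_apply, smul_eq_mul, e, PiLp.single_apply, if_true,
        ← Finset.mul_sum, Finset.sum_sub_distrib]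
      rw [h4]
      congr 1
      simp [Fin.sum_univ_three]
      ring
    have h8 : ∑ j, (n : Space) j * ((n : Space) j * fderiv ℝ g n a
        - ⟪a, (n : Space)⟫ * fderiv ℝ g n (e j))
        = fderiv ℝ g n a - ⟪a, (n : Space)⟫ * ∑ j, (n : Space) j * fderiv ℝ g n (e j) := by
      simp_rw [mul_sub, Finset.sum_sub_distrib, ← mul_assoc, ← Finset.sum_mul, h6, Finset.mul_sum]
      congr 1
      · ring
      · exact Finset.sum_congr rfl fun j _ => by ring
    rw [h7, h8]
    ring
  have hint : Integrable (fun n : Sph => ∑ j, fderiv ℝ (fun m : Space => m j * g m) n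
      (rotGen a (e j) n)) sphMeasure := integrable_finsetSum _ fun j _ => (hj j).1
  have hg' : Integrable (fun n : Sph => 2 * ⟪a, (n : Space)⟫ * g n) sphMeasure :=
    integrable_sph ((by fun_prop : Continuous fun n : Sph => 2 * ⟪a, (n : Space)⟫).mul hg.continuous)
  have hI := (hint.congr hsum).add hg'
  simp only [Pi.add_def, sub_add_cancel] at hI
  refine ⟨hI, ?_⟩
  have := integral_congr_ae hsum
  rw [integral_finsetSum _ fun j _ => (hj j).1, integral_sub hI hg'] at this
  simp only [(hj _).2, Finset.sum_const_zero] at this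
  linarith

/-! ### Archimedes' theorem on the distribution of the height -/

theorem sphMeasure_real_univ : sphMeasure.real univ = 4 * Real.pi := by
  rw [Measure.toSphere_real_apply_univ, Measure.real, EuclideanSpace.volume_ball_fin_three]
  simp only [finrank_euclideanSpace, Fintype.card_fin, ENNReal.ofReal_one, one_pow, one_mul]
  rw [ENNReal.toReal_ofReal (by positivity)]
  push_cast
  ring

/-- Apply `sph_divergence` along w to the k-th power of u = ⟪w, n⟫, using that the tangential
derivative of u is 1 - u². At k = 0 the truncated exponent k - 1 is harmless, since its factor is 0.
-/
theorem moment_succ (w : Space) (hw : ‖w‖ = 1) (k : ℕ) :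
    (k + 2) * ∫ n : Sph, ⟪w, (n : Space)⟫ ^ (k + 1) ∂sphMeasure
      = k * ∫ n : Sph, ⟪w, (n : Space)⟫ ^ (k - 1) ∂sphMeasure := by
  have hd : ∀ m : Space, HasFDerivAt (fun m : Space => ⟪w, m⟫ ^ k)
      ((k * ⟪w, m⟫ ^ (k - 1)) • (innerSL ℝ w : Space →L[ℝ] ℝ)) m := by
    intro m
    have h := ((innerSL ℝ w : Space →L[ℝ] ℝ).hasFDerivAt (x := m)).pow k
    simpa using h
  have h := (sph_divergence w (fun m => ⟪w, m⟫ ^ k)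
    (lipSph_of_contDiffOn (((innerSL ℝ w : Space →L[ℝ] ℝ).contDiff.pow k).contDiffOn))
    (Eventually.of_forall fun n => (hd n).differentiableAt)).2
  have e : ∀ n : Sph, fderiv ℝ (fun m : Space => ⟪w, m⟫ ^ k) n (w - ⟪w, (n : Space)⟫ • (n : Space))
      = k * ⟪w, (n : Space)⟫ ^ (k - 1) - k * ⟪w, (n : Space)⟫ ^ (k + 1) := by
    intro n
    rw [(hd n).fderiv]
    simp only [smul_apply, innerSL_apply_apply, inner_sub_right, real_inner_self_eq_norm_sq, hw,
      real_inner_smul_right, smul_eq_mul]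
    rcases k with _ | k
    · simp
    · simp; ring
  simp_rw [e] at h
  rw [integral_sub (integrable_sph (by fun_prop)) (integrable_sph (by fun_prop)),
    integral_const_mul, integral_const_mul] at h
  have e2 : ∀ n : Sph, 2 * ⟪w, (n : Space)⟫ * ⟪w, (n : Space)⟫ ^ k
      = 2 * ⟪w, (n : Space)⟫ ^ (k + 1) := fun n => by ring
  simp_rw [e2] at h
  rw [integral_const_mul] at h
  linarith

/-- Moments of Lebesgue measure on [-1, 1] obey the same two-step recursion, so only k = 0 (total
mass 4π) and k = 1 need comparison. -/
theorem moment_eq (w : Space) (hw : ‖w‖ = 1) (k : ℕ) :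
    ∫ n : Sph, ⟪w, (n : Space)⟫ ^ k ∂sphMeasure = 2 * Real.pi * ∫ u in (-1 : ℝ)..1, u ^ k := by
  induction k using Nat.strong_induction_on with
  | _ k ih =>
    rcases k with _ | _ | k
    · simp only [pow_zero, integral_const, sphMeasure_real_univ, intervalIntegral.integral_const,
        smul_eq_mul]
      ring
    · have h := moment_succ w hw 0
      simp at h
      simp [h]
    · have h := moment_succ w hw (k + 1)
      rw [show k + 1 - 1 = k by omega, ih k (by omega)] at h
      rw [integral_pow] at *
      have h3 : ((k : ℝ) + 1 + 2) ≠ 0 := by positivity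
      have h4 : ((k : ℝ) + 1) ≠ 0 := by positivity
      push_cast at h ⊢
      apply mul_left_cancel₀ h3
      rw [show k + 1 + 1 = k + 2 by ring] at *
      rw [h]
      field_simp
      ring

/-- Archimedes: the height function maps surface measure of the sphere to `2π` times Lebesgue
measure on `[-1, 1]`. -/
theorem map_inner_sphMeasure (w : Space) (hw : ‖w‖ = 1) :
    sphMeasure.map (fun n : Sph => ⟪w, (n : Space)⟫)
      = ENNReal.ofReal (2 * Real.pi) • (volume : Measure ℝ).restrict (Icc (-1) 1) := by
  have hc : Continuous fun n : Sph => ⟪w, (n : Space)⟫ := by fun_prop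
  have hmem : ∀ n : Sph, ⟪w, (n : Space)⟫ ∈ Icc (-1 : ℝ) 1 := fun n => by
    have := abs_real_inner_le_norm w (n : Space)
    rw [hw, norm_sph, mul_one] at this
    exact abs_le.1 this
  have : IsFiniteMeasure (ENNReal.ofReal (2 * Real.pi) •
      (volume : Measure ℝ).restrict (Icc (-1) 1)) :=
    Measure.smul_finite _ ENNReal.ofReal_ne_top
  refine ext_of_forall_integral_eq_of_IsFiniteMeasure fun f => ?_
  rw [integral_map hc.aemeasurable f.continuous.aestronglyMeasurable, integral_smul_measure,
    ENNReal.toReal_ofReal (by positivity), smul_eq_mul, integral_Icc_eq_integral_Ioc,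
    ← intervalIntegral.integral_of_le (by norm_num)]
  have hpoly : ∀ p : Polynomial ℝ, ∫ n : Sph, p.eval ⟪w, (n : Space)⟫ ∂sphMeasure
      = 2 * Real.pi * ∫ u in (-1 : ℝ)..1, p.eval u := by
    intro p
    simp_rw [Polynomial.eval_eq_sum_range]
    rw [integral_finsetSum _ fun i _ => integrable_sph (by fun_prop),
      intervalIntegral.integral_finsetSum fun i _ =>
        Continuous.intervalIntegrable (by fun_prop) _ _, Finset.mul_sum]
    refine Finset.sum_congr rfl fun i _ => ?_
    rw [integral_const_mul, intervalIntegral.integral_const_mul, moment_eq w hw]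
    ring
  refine eq_of_forall_dist_le fun ε hε => ?_
  -- The tolerance ε/(8π) gives an error ε/2 on the sphere, of mass 4π, and again ε/2 on the
  -- interval of length 2 after multiplication by 2π.
  obtain ⟨p, hp⟩ := exists_polynomial_near_of_continuousOn (-1) 1 f f.continuous.continuousOn
    (ε / (8 * Real.pi)) (by positivity)
  have h1 : ‖∫ n : Sph, (p.eval ⟪w, (n : Space)⟫ - f ⟪w, (n : Space)⟫) ∂sphMeasure‖
      ≤ ε / (8 * Real.pi) * (4 * Real.pi) := by
    rw [← sphMeasure_real_univ]
    exact norm_integral_le_of_norm_le_const (Eventually.of_forall fun n => (hp _ (hmem n)).le)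
  have h2 : ‖∫ u in (-1 : ℝ)..1, (p.eval u - f u)‖ ≤ ε / (8 * Real.pi) * |1 - (-1)| := by
    refine intervalIntegral.norm_integral_le_of_norm_le_const fun u hu => ?_
    rw [uIoc_of_le (by norm_num)] at hu
    exact (hp u ⟨hu.1.le, hu.2⟩).le
  rw [integral_sub (integrable_sph (by fun_prop))
    (integrable_sph (f := fun n : Sph => f ⟪w, (n : Space)⟫) (f.continuous.comp hc)), hpoly] at h1
  rw [intervalIntegral.integral_sub (Continuous.intervalIntegrable (by fun_prop) _ _)
    (f.continuous.intervalIntegrable _ _)] at h2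
  rw [Real.norm_eq_abs] at h1 h2
  have hpi := Real.pi_pos
  have e1 : ε / (8 * Real.pi) * (4 * Real.pi) = ε / 2 := by field_simp; ring
  have e2 : ε / (8 * Real.pi) * |1 - (-1)| = ε / 2 / (2 * Real.pi) := by
    norm_num; field_simp; ring
  rw [e1] at h1
  rw [e2, le_div_iff₀ (by positivity)] at h2
  rw [Real.dist_eq]
  rw [abs_le] at *
  have h3 := abs_le.1 (show |(2 * Real.pi) * ((∫ u in (-1 : ℝ)..1, p.eval u)
      - ∫ u in (-1 : ℝ)..1, f u)| ≤ ε / 2 by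
    rw [abs_mul, abs_of_pos (by positivity), mul_comm]; exact h2)
  constructor <;> nlinarith [h1.1, h1.2, h3.1, h3.2]

/-! ### The product with null vectors and its law on the sphere -/

/-- The linear form `x ↦ x · (1, n)`. -/
def nullForm (n : Space) : Mink →L[ℝ] ℝ :=
  ContinuousLinearMap.proj 0 - ∑ i : Fin 3, n i • ContinuousLinearMap.proj (Fin.succ i)

/-- The product of `x` with the null vector `(1, n)`. -/
def hgt (x : Mink) (n : Space) : ℝ := nullForm n x

theorem hgt_eq_sum (x : Mink) (n : Space) : hgt x n = x 0 - ∑ i : Fin 3, x i.succ * n i := by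
  simp [hgt, nullForm, ContinuousLinearMap.proj_apply, mul_comm]

@[simp] theorem spatial_apply (x : Mink) (i : Fin 3) : spatial x i = x i.succ := rfl

theorem hgt_eq_inner (x : Mink) (n : Space) : hgt x n = x 0 - ⟪spatial x, n⟫ := by
  simp [hgt_eq_sum, PiLp.inner_apply, mul_comm]

@[simp] theorem mkVec_zero (t : ℝ) (y : Space) : mkVec t y 0 = t := rfl

@[simp] theorem mkVec_succ (t : ℝ) (y : Space) (i : Fin 3) : mkVec t y i.succ = y i := rfl

theorem dot_mkVec_one (x : Mink) (n : Space) : dot x (mkVec 1 n) = hgt x n := by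
  simp [dot, hgt_eq_sum]

theorem dot_self_eq (x : Mink) : dot x x = x 0 ^ 2 - ‖spatial x‖ ^ 2 := by
  rw [EuclideanSpace.real_norm_sq_eq]
  simp [dot, pow_two]

theorem norm_spatial_pos {x : Mink} (hx : x ∈ spacelike) : 0 < ‖spatial x‖ := by
  have h : dot x x < 0 := hx
  rw [dot_self_eq] at h
  have : 0 < ‖spatial x‖ ^ 2 := by nlinarith [sq_nonneg (x 0)]
  exact lt_of_le_of_ne (norm_nonneg _) fun h' => by simp [← h'] at this

theorem continuous_spatial : Continuous spatial := by
  unfold spatial; fun_prop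

theorem isOpen_spacelike : IsOpen spacelike := by
  have : Continuous fun x : Mink => dot x x := by unfold dot; fun_prop
  exact isOpen_lt this continuous_const

theorem continuous_hgt : Continuous fun p : Mink × Space => hgt p.1 p.2 := by
  simp_rw [hgt_eq_sum]
  fun_prop

theorem continuous_hgt_right (x : Mink) : Continuous (hgt x) := by
  rw [show hgt x = _ from funext (hgt_eq_sum x)]
  fun_prop

theorem hasFDerivAt_hgt_right (x : Mink) (n : Space) :
    HasFDerivAt (hgt x) (-(innerSL ℝ (spatial x)) : Space →L[ℝ] ℝ) n := by
  have h := (innerSL ℝ (spatial x)).hasFDerivAt (x := n) |>.const_sub (x 0)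
  refine h.congr_of_eventuallyEq (Eventually.of_forall fun m => ?_)
  simp [hgt_eq_inner]

/-- The distribution of `n ↦ x · (1, n)` is uniform. -/
theorem map_hgt_sphMeasure (x : Mink) (hr : 0 < ‖spatial x‖) :
    sphMeasure.map (fun n : Sph => hgt x n) = ENNReal.ofReal (2 * Real.pi / ‖spatial x‖) •
      (volume : Measure ℝ).restrict (Icc (x 0 - ‖spatial x‖) (x 0 + ‖spatial x‖)) := by
  set r := ‖spatial x‖ with hrdef
  have : IsFiniteMeasure (ENNReal.ofReal (2 * Real.pi / r) •
      (volume : Measure ℝ).restrict (Icc (x 0 - r) (x 0 + r))) :=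
    Measure.smul_finite _ ENNReal.ofReal_ne_top
  have hw : ‖r⁻¹ • spatial x‖ = 1 := by
    rw [norm_smul, norm_inv, Real.norm_of_nonneg hr.le, ← hrdef, inv_mul_cancel₀ hr.ne']
  have hc : Continuous fun n : Sph => hgt x n := (continuous_hgt_right x).comp continuous_subtype_val
  have hc' : Continuous fun n : Sph => ⟪r⁻¹ • spatial x, (n : Space)⟫ := by fun_prop
  refine ext_of_forall_integral_eq_of_IsFiniteMeasure fun f => ?_
  rw [integral_map hc.aemeasurable f.continuous.aestronglyMeasurable, integral_smul_measure,
    ENNReal.toReal_ofReal (by positivity), smul_eq_mul, integral_Icc_eq_integral_Ioc,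
    ← intervalIntegral.integral_of_le (by linarith)]
  have h1 : ∀ n : Sph, f (hgt x n) = (fun u => f (x 0 - r * u)) ⟪r⁻¹ • spatial x, (n : Space)⟫ := by
    intro n
    simp only [hgt_eq_inner, real_inner_smul_left]
    congr 2
    rw [mul_inv_cancel_left₀ hr.ne']
  simp_rw [h1]
  have hf : Continuous fun u => f (x 0 - r * u) := f.continuous.comp (by fun_prop)
  rw [← integral_map (φ := fun n : Sph => ⟪r⁻¹ • spatial x, (n : Space)⟫)
    (f := fun u => f (x 0 - r * u)) hc'.aemeasurable hf.aestronglyMeasurable,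
    map_inner_sphMeasure _ hw, integral_smul_measure,
    ENNReal.toReal_ofReal (by positivity), smul_eq_mul, integral_Icc_eq_integral_Ioc,
    ← intervalIntegral.integral_of_le (by norm_num), intervalIntegral.integral_comp_sub_mul _ hr.ne']
  simp only [smul_eq_mul]
  rw [← mul_assoc]
  congr 2 <;> ring

theorem integral_comp_hgt (x : Mink) (hr : 0 < ‖spatial x‖) (f : ℝ → ℝ) (hf : Measurable f) :
    ∫ n : Sph, f (hgt x n) ∂sphMeasure = 2 * Real.pi / ‖spatial x‖ *
      ∫ s in (x 0 - ‖spatial x‖)..(x 0 + ‖spatial x‖), f s := by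
  have hc : Continuous fun n : Sph => hgt x n := (continuous_hgt_right x).comp continuous_subtype_val
  rw [← integral_map hc.aemeasurable hf.aestronglyMeasurable, map_hgt_sphMeasure x hr,
    integral_smul_measure, ENNReal.toReal_ofReal (by positivity), smul_eq_mul,
    integral_Icc_eq_integral_Ioc, ← intervalIntegral.integral_of_le (by linarith)]

theorem integrable_comp_hgt (x : Mink) (hr : 0 < ‖spatial x‖) (f : ℝ → ℝ)
    (hf : ∀ a b, IntervalIntegrable f volume a b) :
    Integrable (fun n : Sph => f (hgt x n)) sphMeasure := by
  have hc : Continuous fun n : Sph => hgt x n := (continuous_hgt_right x).comp continuous_subtype_val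
  have h : Integrable f (sphMeasure.map fun n : Sph => hgt x n) := by
    rw [map_hgt_sphMeasure x hr]
    refine Integrable.smul_measure ?_ ENNReal.ofReal_ne_top
    have := (hf (x 0 - ‖spatial x‖) (x 0 + ‖spatial x‖)).1
    rwa [IntegrableOn, Measure.restrict_congr_set Ioc_ae_eq_Icc] at this
  exact h.comp_measurable hc.measurable

/-- The law of the height has a density, so level sets are null. It is used for the zero set of x·l
and for the kinks of the regularized logarithm at ±η. -/
theorem ae_hgt_ne (x : Mink) (hr : 0 < ‖spatial x‖) (c : ℝ) :
    ∀ᵐ n : Sph ∂sphMeasure, hgt x n ≠ c := by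
  have hc : Continuous fun n : Sph => hgt x n := (continuous_hgt_right x).comp continuous_subtype_val
  have h : ∀ᵐ s ∂(sphMeasure.map fun n : Sph => hgt x n), s ≠ c := by
    rw [map_hgt_sphMeasure x hr]
    refine Measure.ae_smul_measure ?_ _
    exact ae_restrict_of_ae (Measure.ae_ne volume c)
  exact ae_of_ae_map hc.aemeasurable h

/-! ### Regularized logarithm and truncated kernel -/

/-- The regularized logarithm. -/
def logK (η y : ℝ) : ℝ := Real.log (max |y| η)

/-- The truncated kernel `1 / y`. -/
def pvK (η y : ℝ) : ℝ := if η ≤ |y| then y⁻¹ else 0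

theorem logK_zero (y : ℝ) : logK 0 y = Real.log y := by
  simp [logK]

theorem measurable_logK (η : ℝ) : Measurable (logK η) := by
  unfold logK; fun_prop

theorem measurable_pvK (η : ℝ) : Measurable (pvK η) :=
  Measurable.ite (measurableSet_le measurable_const measurable_id.abs) measurable_inv
    measurable_const

theorem abs_pvK_le {η : ℝ} (hη : 0 < η) (y : ℝ) : |pvK η y| ≤ η⁻¹ := by
  unfold pvK
  split_ifs with h
  · rw [abs_inv]; exact inv_anti₀ hη h
  · simp; positivity

theorem abs_logK_sub_le {η : ℝ} (hη : 0 < η) (y z : ℝ) :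
    |logK η y - logK η z| ≤ η⁻¹ * |y - z| := by
  have key : ∀ a b : ℝ, logK η a - logK η b ≤ η⁻¹ * |a - b| := by
    intro a b
    have ha : 0 < max |a| η := lt_max_of_lt_right hη
    have hb : 0 < max |b| η := lt_max_of_lt_right hη
    have h1 := Real.log_le_sub_one_of_pos (div_pos ha hb)
    rw [Real.log_div ha.ne' hb.ne'] at h1
    have h2 : max |a| η / max |b| η - 1 = (max |b| η)⁻¹ * (max |a| η - max |b| η) := by
      field_simp
    have h3 : max |a| η - max |b| η ≤ |a - b| :=
      (le_abs_self _).trans ((abs_max_sub_max_le_abs _ _ _).trans (abs_abs_sub_abs_le _ _))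
    have h4 : (max |b| η)⁻¹ ≤ η⁻¹ := inv_anti₀ hη (le_max_right _ _)
    calc logK η a - logK η b ≤ (max |b| η)⁻¹ * (max |a| η - max |b| η) := by
          rw [← h2]; exact h1
      _ ≤ (max |b| η)⁻¹ * |a - b| := by gcongr
      _ ≤ η⁻¹ * |a - b| := by gcongr
  rw [abs_sub_le_iff]
  exact ⟨key y z, by rw [abs_sub_comm]; exact key z y⟩

theorem lipschitzWith_logK {η : ℝ} (hη : 0 < η) : LipschitzWith (Real.nnabs η⁻¹) (logK η) :=
  LipschitzWith.of_dist_le_mul fun y z => by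
    rw [Real.coe_nnabs, abs_of_pos (by positivity), Real.dist_eq, Real.dist_eq]
    exact abs_logK_sub_le hη y z

/-- The two truncations are matched: the logarithm is frozen at log η exactly where the kernel is
cut to 0. Sharp truncation of the principal value thus integrates by parts without boundary terms.
-/
theorem hasDerivAt_logK {η y : ℝ} (hη : 0 < η) (h1 : y ≠ η) (h2 : y ≠ -η) :
    HasDerivAt (logK η) (pvK η y) y := by
  rcases lt_or_ge |y| η with h | h
  · rw [pvK, if_neg (not_le.2 h)]
    refine (hasDerivAt_const y (Real.log η)).congr_of_eventuallyEq ?_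
    filter_upwards [continuous_abs.continuousAt.eventually_lt continuousAt_const h] with z hz
    rw [logK, max_eq_right hz.le]
  · have h' : η < |y| := lt_of_le_of_ne h fun e => by
      rcases abs_choice y with h3 | h3 <;> rw [h3] at e
      · exact h1 e.symm
      · exact h2 (by linarith)
    have hy : y ≠ 0 := fun e => by simp [e] at h'; linarith
    rw [pvK, if_pos h]
    refine (Real.hasDerivAt_log hy).congr_of_eventuallyEq ?_
    filter_upwards [continuousAt_const.eventually_lt continuous_abs.continuousAt h'] with z hz
    rw [logK, max_eq_left hz.le, Real.log_abs]

theorem intervalIntegrable_logK_zero (a b : ℝ) : IntervalIntegrable (logK 0) volume a b := by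
  have : logK 0 = Real.log := funext logK_zero
  rw [this]
  exact intervalIntegral.intervalIntegrable_log'

theorem logK_sub_nonneg {η : ℝ} (hη : 0 < η) {y : ℝ} (hy : y ≠ 0) : 0 ≤ logK η y - logK 0 y := by
  rw [sub_nonneg, logK, logK]
  refine Real.log_le_log (lt_max_of_lt_left (abs_pos.2 hy)) ?_
  exact max_le_max le_rfl hη.le

/-- The difference is log η - log|s| on [-η, η] and zero elsewhere, almost everywhere; its integral
over that interval is exactly 2η. -/
theorem integral_logK_sub_le {η : ℝ} (hη : 0 < η) {a b : ℝ} (hab : a ≤ b) :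
    ∫ s in a..b, |logK η s - logK 0 s| ≤ 2 * η := by
  have hint : IntegrableOn (fun s => Real.log η - Real.log s) (Icc (-η) η) := by
    have : IntervalIntegrable (fun s => Real.log η - Real.log s) volume (-η) η :=
      intervalIntegrable_const.sub intervalIntegral.intervalIntegrable_log'
    rw [intervalIntegrable_iff_integrableOn_Icc_of_le (by linarith)] at this
    exact this
  have hval : ∫ s in Icc (-η) η, (Real.log η - Real.log s) = 2 * η := by
    rw [integral_Icc_eq_integral_Ioc, ← intervalIntegral.integral_of_le (by linarith),
      intervalIntegral.integral_sub intervalIntegrable_const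
        intervalIntegral.intervalIntegrable_log', integral_log]
    simp
    ring
  rw [intervalIntegral.integral_of_le hab, ← hval, ← integral_indicator measurableSet_Icc]
  have h0 : ∀ s, 0 ≤ (Icc (-η) η).indicator (fun s => Real.log η - Real.log s) s ∨ s = 0 := by
    intro s
    by_cases hs0 : s = 0
    · exact Or.inr hs0
    refine Or.inl (indicator_apply_nonneg fun hs => ?_)
    rw [← Real.log_abs s]
    exact sub_nonneg.2 (Real.log_le_log (abs_pos.2 hs0) (abs_le.2 hs))
  have heq : ∀ s, s ≠ 0 → |logK η s - logK 0 s|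
      = (Icc (-η) η).indicator (fun s => Real.log η - Real.log s) s := by
    intro s hs
    rw [abs_of_nonneg (logK_sub_nonneg hη hs), logK_zero, indicator_apply]
    split_ifs with h
    · rw [logK, max_eq_right (abs_le.2 h)]
    · rw [logK, max_eq_left (not_le.1 fun h' => h (abs_le.1 h')).le, Real.log_abs, sub_self]
  have hae : (fun s => |logK η s - logK 0 s|) =ᵐ[volume]
      (Icc (-η) η).indicator (fun s => Real.log η - Real.log s) := by
    filter_upwards [Measure.ae_ne volume (0 : ℝ)] with s hs using heq s hs
  rw [integral_congr_ae (ae_restrict_of_ae hae)]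
  refine setIntegral_le_integral ((integrable_indicator_iff measurableSet_Icc).2 hint) ?_
  filter_upwards [Measure.ae_ne volume (0 : ℝ)] with s hs
  exact (h0 s).resolve_right hs

theorem integral_abs_logK_hgt_sub_le {η : ℝ} (hη : 0 < η) (x : Mink) (hr : 0 < ‖spatial x‖) :
    ∫ n : Sph, |logK η (hgt x n) - logK 0 (hgt x n)| ∂sphMeasure
      ≤ 4 * Real.pi / ‖spatial x‖ * η := by
  rw [integral_comp_hgt x hr (fun s => |logK η s - logK 0 s|)
    ((measurable_logK η).sub (measurable_logK 0)).abs]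
  calc _ ≤ 2 * Real.pi / ‖spatial x‖ * (2 * η) := by
        gcongr
        exact integral_logK_sub_le hη (by linarith)
    _ = _ := by ring

theorem measureReal_abs_hgt_lt_le {η : ℝ} (hη : 0 < η) (x : Mink) (hr : 0 < ‖spatial x‖) :
    sphMeasure.real {n : Sph | |hgt x n| < η} ≤ 4 * Real.pi / ‖spatial x‖ * η := by
  have hc : Continuous fun n : Sph => hgt x n := (continuous_hgt_right x).comp continuous_subtype_val
  have h1 : sphMeasure.real {n : Sph | |hgt x n| < η}
      = (sphMeasure.map fun n : Sph => hgt x n).real (Ioo (-η) η) := by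
    rw [map_measureReal_apply hc.measurable measurableSet_Ioo]
    congr 1
    ext n
    simp [abs_lt]
  rw [h1, map_hgt_sphMeasure x hr, measureReal_ennreal_smul_apply,
    ENNReal.toReal_ofReal (by positivity)]
  have h2 : ((volume : Measure ℝ).restrict (Icc (x 0 - ‖spatial x‖) (x 0 + ‖spatial x‖))).real
      (Ioo (-η) η) ≤ 2 * η := by
    rw [measureReal_restrict_apply measurableSet_Ioo]
    refine (measureReal_mono inter_subset_left (by simp)).trans ?_
    rw [Real.volume_real_Ioo_of_le (by linarith)]; linarith
  calc _ ≤ 2 * Real.pi / ‖spatial x‖ * (2 * η) := by gcongr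
    _ = _ := by ring

/-! ### Principal values through logarithmic potentials -/

/-- Functions smooth away from the origin, considered as extensions of functions on the sphere. -/
def SphSmooth (H : Space → ℝ) : Prop := ContDiffOn ℝ ∞ H {0}ᶜ

/-- The regularized logarithmic potential. -/
def logInt (η : ℝ) (H : Space → ℝ) (x : Mink) : ℝ :=
  ∫ n : Sph, logK η (hgt x n) * H n ∂sphMeasure

/-- The truncated integral of `H / (x · l)`. -/
def pvInt (η : ℝ) (H : Space → ℝ) (x : Mink) : ℝ :=
  ∫ n : Sph, pvK η (hgt x n) * H n ∂sphMeasure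

/-- The formal adjoint of the gradient field of `n ↦ -⟨a, n⟩`. -/
def tanOp (a : Space) (H : Space → ℝ) (n : Space) : ℝ :=
  fderiv ℝ H n (a - ⟪a, n⟫ • n) - 2 * ⟪a, n⟫ * H n

/-- The principal value integral of `H / (x · l)`, in a form without singular integrals. -/
def pv (H : Space → ℝ) (x : Mink) : ℝ :=
  (logInt 0 (tanOp (spatial x) H) x - ∫ n : Sph, (2 * x 0 - hgt x n) * H n ∂sphMeasure)
    / (-dot x x)

theorem SphSmooth.continuousOn {H : Space → ℝ} (hH : SphSmooth H) : ContinuousOn H {0}ᶜ :=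
  ContDiffOn.continuousOn hH

theorem SphSmooth.continuous {H : Space → ℝ} (hH : SphSmooth H) : Continuous fun n : Sph => H n :=
  hH.continuousOn.comp_continuous continuous_subtype_val sph_ne_zero

theorem SphSmooth.differentiableAt {H : Space → ℝ} (hH : SphSmooth H) (n : Sph) :
    DifferentiableAt ℝ H n :=
  (ContDiffOn.contDiffAt hH (isOpen_compl_singleton.mem_nhds (sph_ne_zero n))).differentiableAt
    (by simp)

theorem SphSmooth.lipSph {H : Space → ℝ} (hH : SphSmooth H) : LipSph H :=
  lipSph_of_contDiffOn (ContDiffOn.of_le hH (by simp))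

theorem SphSmooth.fderiv {H : Space → ℝ} (hH : SphSmooth H) :
    ContDiffOn ℝ ∞ (fderiv ℝ H) {0}ᶜ :=
  ContDiffOn.fderiv_of_isOpen hH isOpen_compl_singleton (by simp)

theorem ContDiff.sphSmooth {H : Space → ℝ} (hH : ContDiff ℝ ∞ H) : SphSmooth H := hH.contDiffOn

theorem SphSmooth.mul {H G : Space → ℝ} (hH : SphSmooth H) (hG : SphSmooth G) :
    SphSmooth fun n => H n * G n := ContDiffOn.mul hH hG

theorem sphSmooth_hgt (x : Mink) : SphSmooth (hgt x) := by
  refine ContDiff.sphSmooth ?_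
  rw [show hgt x = _ from funext (hgt_eq_sum x)]
  fun_prop

theorem contDiff_inner_right (a : Space) : ContDiff ℝ ∞ fun n : Space => ⟪a, n⟫ :=
  (innerSL ℝ a : Space →L[ℝ] ℝ).contDiff

theorem SphSmooth.tanOp {H : Space → ℝ} (hH : SphSmooth H) (a : Space) : SphSmooth (tanOp a H) := by
  have h1 : ContDiff ℝ ∞ fun n : Space => a - ⟪a, n⟫ • n :=
    contDiff_const.sub ((contDiff_inner_right a).smul contDiff_id)
  exact (hH.fderiv.clm_apply h1.contDiffOn).sub
    (((contDiff_const.mul (contDiff_inner_right a)).contDiffOn).mul hH)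

theorem space_eq_sum (a : Space) : a = ∑ i, a i • EuclideanSpace.single i (1 : ℝ) := by
  ext i
  simp [Finset.sum_apply, Pi.single_apply]

theorem tanOp_eq_sum (a : Space) (H : Space → ℝ) (n : Space) :
    tanOp a H n = ∑ i, a i * tanOp (EuclideanSpace.single i 1) H n := by
  have hlin : ∀ b : Space, tanOp b H n
      = (fderiv ℝ H n) b - ⟪b, n⟫ * (fderiv ℝ H n n + 2 * H n) := by
    intro b
    simp only [tanOp, map_sub, map_smul, smul_eq_mul]
    ring
  have h1 := congrArg (fderiv ℝ H n) (space_eq_sum a)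
  rw [map_sum, Finset.sum_congr rfl fun j _ => map_smul _ _ _] at h1
  have h2 : ⟪a, n⟫ = ∑ i, a i * ⟪EuclideanSpace.single i (1 : ℝ), n⟫ := by
    simp [PiLp.inner_apply, mul_comm]
  simp_rw [hlin, h2, mul_sub, Finset.sum_sub_distrib, h1, smul_eq_mul, Finset.sum_mul]
  congr 1
  exact Finset.sum_congr rfl fun i _ => by ring

theorem exists_sph_bound {f : Sph → ℝ} (hf : Continuous f) : ∃ C, 0 ≤ C ∧ ∀ n, |f n| ≤ C := by
  obtain ⟨C, hC⟩ := isCompact_univ.exists_bound_of_continuousOn hf.continuousOn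
  exact ⟨|C|, abs_nonneg _, fun n => (hC n (mem_univ n)).trans (le_abs_self C)⟩

theorem continuous_logK {η : ℝ} (hη : 0 < η) : Continuous (logK η) :=
  (lipschitzWith_logK hη).continuous

theorem continuous_hgt_sph (x : Mink) : Continuous fun n : Sph => hgt x n :=
  (continuous_hgt_right x).comp continuous_subtype_val

theorem integrable_logK_mul {η : ℝ} (hη : 0 ≤ η) {x : Mink} (hr : 0 < ‖spatial x‖) {H : Sph → ℝ}
    (hH : Continuous H) : Integrable (fun n : Sph => logK η (hgt x n) * H n) sphMeasure := by
  have h1 : Integrable (fun n : Sph => logK η (hgt x n)) sphMeasure := by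
    rcases hη.eq_or_lt with rfl | hη
    · exact integrable_comp_hgt x hr _ intervalIntegrable_logK_zero
    · exact integrable_sph ((continuous_logK hη).comp (continuous_hgt_sph x))
  obtain ⟨C, -, hC⟩ := exists_sph_bound hH
  exact h1.mul_bdd (c := C) hH.aestronglyMeasurable (Eventually.of_forall hC)

theorem integrable_pvK_mul {η : ℝ} (hη : 0 < η) (x : Mink) {H : Sph → ℝ} (hH : Continuous H) :
    Integrable (fun n : Sph => pvK η (hgt x n) * H n) sphMeasure :=
  (integrable_sph hH).bdd_mul (c := η⁻¹)
    ((measurable_pvK η).comp (continuous_hgt_sph x).measurable).aestronglyMeasurable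
    (Eventually.of_forall fun _ => abs_pvK_le hη _)

/-- In the formula for `pv` the density itself varies with x through its spatial part. Linearity in
that vector leaves three fixed densities with coefficients depending on x, to which smoothness
results for fixed densities apply. -/
theorem logInt_tanOp {η : ℝ} (hη : 0 ≤ η) {x : Mink} (hr : 0 < ‖spatial x‖) {H : Space → ℝ}
    (hH : SphSmooth H) (a : Space) :
    logInt η (tanOp a H) x = ∑ i, a i * logInt η (tanOp (EuclideanSpace.single i 1) H) x := by
  unfold logInt
  simp_rw [← integral_const_mul]
  rw [← integral_finsetSum _ fun i _ =>
    (integrable_logK_mul hη hr (hH.tanOp (EuclideanSpace.single i 1)).continuous).const_mul _]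
  refine integral_congr_ae (Eventually.of_forall fun n => ?_)
  simp only
  rw [tanOp_eq_sum, Finset.mul_sum]
  exact Finset.sum_congr rfl fun i _ => by ring

/-- The integration by parts which trades the truncated kernel `1/y` for a logarithm. -/
theorem pvInt_mul {η : ℝ} (hη : 0 < η) {x : Mink} (hr : 0 < ‖spatial x‖) {H : Space → ℝ}
    (hH : SphSmooth H) :
    pvInt η H x * (-dot x x) = logInt η (tanOp (spatial x) H) x
      - ∫ n : Sph, (if η ≤ |hgt x n| then (2 * x 0 - hgt x n) * H n else 0) ∂sphMeasure := by
  set a := spatial x with ha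
  -- The truncated logarithm has kinks, so the divergence theorem is applied in its Lipschitz,
  -- almost everywhere differentiable form.
  have hlip : LipSph fun n => logK η (hgt x n) * H n := by
    refine LipSph.mul ?_ hH.lipSph
    obtain ⟨K, hK⟩ := (sphSmooth_hgt x).lipSph
    exact ⟨_, (lipschitzWith_logK hη).comp_lipschitzOnWith hK⟩
  have hder : ∀ᵐ n : Sph ∂sphMeasure, HasFDerivAt (fun n => logK η (hgt x n) * H n)
      (logK η (hgt x n) • fderiv ℝ H n + H n • (pvK η (hgt x n) • -(innerSL ℝ a : Space →L[ℝ] ℝ)))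
      (n : Space) := by
    filter_upwards [ae_hgt_ne x hr η, ae_hgt_ne x hr (-η)] with n h1 h2
    exact ((hasDerivAt_logK hη h1 h2).comp_hasFDerivAt (n : Space)
      (hasFDerivAt_hgt_right x n)).mul (hH.differentiableAt n).hasFDerivAt
  obtain ⟨-, hI⟩ := sph_divergence a _ hlip (hder.mono fun n h => h.differentiableAt)
  have hL : Integrable (fun n : Sph => logK η (hgt x n) * tanOp a H n) sphMeasure :=
    integrable_logK_mul hη.le hr (hH.tanOp a).continuous
  have hind : ∀ n : Sph, (if η ≤ |hgt x n| then (2 * x 0 - hgt x n) * H n else 0)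
      = pvK η (hgt x n) * (hgt x n * (2 * x 0 - hgt x n) * H n) := by
    intro n
    unfold pvK
    split_ifs with h
    · have : hgt x n ≠ 0 := fun e => by rw [e] at h; simp at h; linarith
      field_simp
    · simp
  have hQ : Integrable (fun n : Sph => pvK η (hgt x n) * (hgt x n * (2 * x 0 - hgt x n) * H n))
      sphMeasure := integrable_pvK_mul hη x
    (((continuous_hgt_sph x).mul (continuous_const.sub (continuous_hgt_sph x))).mul hH.continuous)
  have hP := integrable_pvK_mul hη x hH.continuous
  -- With h = x·l = x⁰ - ⟪a, n⟫ one has |a|² - ⟪a, n⟫² = -x² + h(2x⁰ - h). The first term gives the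
  -- wanted integral times -x²; in the second, h cancels the singular kernel.
  have hkey : (fun n : Sph => fderiv ℝ (fun n => logK η (hgt x n) * H n) n
      (a - ⟪a, (n : Space)⟫ • (n : Space))) =ᵐ[sphMeasure] fun n => logK η (hgt x n) * tanOp a H n
        - pvK η (hgt x n) * H n * (-dot x x)
        - pvK η (hgt x n) * (hgt x n * (2 * x 0 - hgt x n) * H n)
        + 2 * ⟪a, (n : Space)⟫ * (logK η (hgt x n) * H n) := by
    filter_upwards [hder] with n hn
    rw [hn.fderiv]
    simp only [add_apply, smul_apply, smul_eq_mul, _root_.neg_apply, innerSL_apply_apply,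
      inner_sub_right, real_inner_smul_right, real_inner_self_eq_norm_sq, tanOp]
    rw [dot_self_eq, hgt_eq_inner, ← ha]
    ring
  have h1 := hL.sub (hP.mul_const (-dot x x))
  have h2 := h1.sub hQ
  simp only [Pi.sub_def] at h1 h2
  have h3 : Integrable (fun n : Sph => 2 * ⟪a, (n : Space)⟫ * (logK η (hgt x n) * H n))
      sphMeasure := integrable_sph
    ((by fun_prop : Continuous fun n : Sph => 2 * ⟪a, (n : Space)⟫).mul hlip.continuous)
  rw [integral_congr_ae hkey, integral_add h2 h3, integral_sub h1 hQ,
    integral_sub hL (hP.mul_const _), integral_mul_const] at hI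
  simp_rw [hind]
  unfold pvInt logInt
  linarith

theorem abs_logInt_sub_le {η : ℝ} (hη : 0 < η) {x : Mink} (hr : 0 < ‖spatial x‖) {G : Space → ℝ}
    (hG : Continuous fun n : Sph => G n) {C : ℝ} (hC : ∀ n : Sph, |G n| ≤ C) :
    |logInt η G x - logInt 0 G x| ≤ C * (4 * Real.pi / ‖spatial x‖ * η) := by
  have hC0 : 0 ≤ C := (abs_nonneg _).trans (hC ⟨EuclideanSpace.single 0 1, by simp⟩)
  have h1 := integrable_logK_mul hη.le hr hG
  have h2 := integrable_logK_mul le_rfl hr hG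
  have h3 := integrable_logK_mul hη.le hr (H := fun _ => 1) continuous_const
  have h4 := integrable_logK_mul le_rfl hr (H := fun _ => 1) continuous_const
  simp only [mul_one] at h3 h4
  unfold logInt
  rw [← integral_sub h1 h2]
  refine (abs_integral_le_integral_abs).trans ?_
  calc ∫ n : Sph, |logK η (hgt x n) * G n - logK 0 (hgt x n) * G n| ∂sphMeasure
      ≤ ∫ n : Sph, C * |logK η (hgt x n) - logK 0 (hgt x n)| ∂sphMeasure := by
        refine integral_mono (h1.sub h2).abs ((h3.sub h4).abs.const_mul C) fun n => ?_
        simp only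
        rw [← sub_mul, abs_mul, mul_comm]
        exact mul_le_mul_of_nonneg_right (hC n) (abs_nonneg _)
    _ ≤ _ := by
        rw [integral_const_mul]
        exact mul_le_mul_of_nonneg_left (integral_abs_logK_hgt_sub_le hη x hr) hC0

theorem continuous_dot_self : Continuous fun x : Mink => dot x x := by unfold dot; fun_prop

/-- The truncated integrals converge to the principal value, locally uniformly at rate `η`. -/
theorem exists_abs_pvInt_sub_pv_le {H : Space → ℝ} (hH : SphSmooth H) :
    ∃ M : Mink → ℝ, ContinuousOn M spacelike ∧ ∀ x ∈ spacelike, ∀ η, 0 < η → η ≤ 1 →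
      |pvInt η H x - pv H x| ≤ M x * η := by
  obtain ⟨C, hC0, hC⟩ := exists_sph_bound hH.continuous
  choose D hD0 hD using fun i : Fin 3 =>
    exists_sph_bound (hH.tanOp (EuclideanSpace.single i 1)).continuous
  -- The first summand bounds the density multiplying the logarithm. The second bounds (2x⁰ - x·l) H
  -- on the removed band |x·l| < η, where η ≤ 1 forces |x·l| ≤ 1. Both errors carry the same factor
  -- 4πη/‖spatial x‖.
  refine ⟨fun x => (4 * Real.pi / ‖spatial x‖)
    * (∑ i : Fin 3, |x i.succ| * D i + (2 * |x 0| + 1) * C) / (-dot x x), ?_, ?_⟩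
  · refine ContinuousOn.div (ContinuousOn.mul (ContinuousOn.div continuousOn_const
      continuous_spatial.norm.continuousOn fun x hx => (norm_spatial_pos hx).ne') ?_)
      continuous_dot_self.neg.continuousOn fun x hx => ?_
    · fun_prop
    · have : dot x x < 0 := hx
      linarith
  · intro x hx η hη hη1
    have hr := norm_spatial_pos hx
    have hxx : 0 < -dot x x := by have : dot x x < 0 := hx; linarith
    have hlin := pvInt_mul hη hr hH
    have hbd : ∀ n : Sph, |tanOp (spatial x) H n| ≤ ∑ i : Fin 3, |x i.succ| * D i := by
      intro n
      rw [tanOp_eq_sum]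
      refine (Finset.abs_sum_le_sum_abs _ _).trans (Finset.sum_le_sum fun i _ => ?_)
      rw [abs_mul, spatial_apply]
      exact mul_le_mul_of_nonneg_left (hD i n) (abs_nonneg _)
    have h1 := abs_logInt_sub_le hη hr (hH.tanOp (spatial x)).continuous hbd
    have hQ : Continuous fun n : Sph => (2 * x 0 - hgt x n) * H n :=
      (continuous_const.sub (continuous_hgt_sph x)).mul hH.continuous
    have hS : MeasurableSet {n : Sph | η ≤ |hgt x n|} :=
      measurableSet_le measurable_const (continuous_hgt_sph x).abs.measurable
    have h2 : ∫ n : Sph, (2 * x 0 - hgt x n) * H n ∂sphMeasure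
        - ∫ n : Sph, (if η ≤ |hgt x n| then (2 * x 0 - hgt x n) * H n else 0) ∂sphMeasure
        = ∫ n in {n : Sph | |hgt x n| < η}, (2 * x 0 - hgt x n) * H n ∂sphMeasure := by
      have e1 : (fun n : Sph => if η ≤ |hgt x n| then (2 * x 0 - hgt x n) * H n else 0)
          = {n : Sph | η ≤ |hgt x n|}.indicator fun n => (2 * x 0 - hgt x n) * H n := by
        ext n; simp [indicator_apply]
      have e2 : {n : Sph | |hgt x n| < η} = {n : Sph | η ≤ |hgt x n|}ᶜ := by
        ext n; simp
      rw [e1, integral_indicator hS, e2, setIntegral_compl hS (integrable_sph hQ)]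
    have h3 : |∫ n in {n : Sph | |hgt x n| < η}, (2 * x 0 - hgt x n) * H n ∂sphMeasure|
        ≤ (2 * |x 0| + 1) * C * (4 * Real.pi / ‖spatial x‖ * η) := by
      have hb : ∀ n ∈ {n : Sph | |hgt x n| < η}, ‖(2 * x 0 - hgt x n) * H n‖
          ≤ (2 * |x 0| + 1) * C := fun n hn => ?_
      · exact (norm_setIntegral_le_of_norm_le_const (measure_lt_top sphMeasure _) hb).trans
          (mul_le_mul_of_nonneg_left (measureReal_abs_hgt_lt_le hη x hr) (by positivity))
      · rw [norm_mul]
        refine mul_le_mul ?_ (hC n) (abs_nonneg _) (by positivity)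
        refine (norm_sub_le _ _).trans ?_
        rw [Real.norm_eq_abs, Real.norm_eq_abs, abs_mul, abs_two]
        have : |hgt x n| < η := hn
        linarith
    have h4 : (pvInt η H x - pv H x) * (-dot x x)
        = (logInt η (tanOp (spatial x) H) x - logInt 0 (tanOp (spatial x) H) x)
          + ∫ n in {n : Sph | |hgt x n| < η}, (2 * x 0 - hgt x n) * H n ∂sphMeasure := by
      rw [sub_mul, hlin, pv, div_mul_cancel₀ _ hxx.ne', ← h2]
      ring
    have h5 : |pvInt η H x - pv H x| * (-dot x x)
        ≤ 4 * Real.pi / ‖spatial x‖ * (∑ i : Fin 3, |x i.succ| * D i + (2 * |x 0| + 1) * C) * η := by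
      rw [← abs_of_pos hxx, ← abs_mul, h4]
      refine (abs_add_le _ _).trans ?_
      linarith
    rw [div_mul_eq_mul_div, le_div_iff₀ hxx]
    exact h5

theorem tendsto_pvInt {H : Space → ℝ} (hH : SphSmooth H) {x : Mink} (hx : x ∈ spacelike) :
    Tendsto (fun η => pvInt η H x) (𝓝[>] 0) (𝓝 (pv H x)) := by
  obtain ⟨M, -, hM⟩ := exists_abs_pvInt_sub_pv_le hH
  rw [tendsto_iff_dist_tendsto_zero]
  refine squeeze_zero' (g := fun η => M x * η) (Eventually.of_forall fun _ => dist_nonneg) ?_ ?_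
  · filter_upwards [Ioc_mem_nhdsGT (zero_lt_one' ℝ)] with η hη
    exact hM x hx η hη.1 hη.2
  · have : Tendsto (fun η : ℝ => M x * η) (𝓝 0) (𝓝 (M x * 0)) := tendsto_id.const_mul _
    rw [mul_zero] at this
    exact this.mono_left nhdsWithin_le_nhds

theorem tendsto_logInt {H : Space → ℝ} (hH : Continuous fun n : Sph => H n) {x : Mink}
    (hx : x ∈ spacelike) : Tendsto (fun η => logInt η H x) (𝓝[>] 0) (𝓝 (logInt 0 H x)) := by
  obtain ⟨C, hC0, hC⟩ := exists_sph_bound hH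
  rw [tendsto_iff_dist_tendsto_zero]
  refine squeeze_zero' (g := fun η => C * (4 * Real.pi / ‖spatial x‖ * η))
    (Eventually.of_forall fun _ => dist_nonneg) ?_ ?_
  · filter_upwards [self_mem_nhdsWithin] with η hη
    exact abs_logInt_sub_le hη (norm_spatial_pos hx) hH hC
  · have : Tendsto (fun η : ℝ => C * (4 * Real.pi / ‖spatial x‖ * η)) (𝓝 0)
        (𝓝 (C * (4 * Real.pi / ‖spatial x‖ * 0))) := (tendsto_id.const_mul _).const_mul _
    simp only [mul_zero] at this
    exact this.mono_left nhdsWithin_le_nhds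

/-! ### Derivatives and smoothness of the logarithmic potential -/

/-- The coordinate forms. -/
def coord (a : Fin 4) : Mink →L[ℝ] ℝ := ContinuousLinearMap.proj a

@[simp] theorem coord_apply (a : Fin 4) (x : Mink) : coord a x = x a := rfl

theorem nullForm_eq_sum (n : Space) :
    nullForm n = ∑ a : Fin 4, hgt (basisVec a) n • coord a := by
  ext x
  have : x = ∑ a : Fin 4, x a • basisVec a := by
    ext b; simp [basisVec, Finset.sum_apply, Pi.single_apply]
  conv_lhs => rw [this]
  simp [hgt, mul_comm]

theorem exists_norm_nullForm_le : ∃ C, 0 ≤ C ∧ ∀ n : Sph, ‖nullForm n‖ ≤ C := by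
  have hc : Continuous fun n : Sph => nullForm n := by unfold nullForm; fun_prop
  obtain ⟨C, hC⟩ := isCompact_univ.exists_bound_of_continuousOn hc.continuousOn
  exact ⟨|C|, abs_nonneg _, fun n => (hC n (mem_univ n)).trans (le_abs_self C)⟩

theorem continuous_nullForm : Continuous fun n : Sph => nullForm n := by unfold nullForm; fun_prop

/-- For η > 0 the integrand is Lipschitz in x uniformly in n and differentiable for almost every n.
The covector l is then expanded into its components l_a. -/
theorem hasFDerivAt_logInt {η : ℝ} (hη : 0 < η) {x : Mink} (hr : 0 < ‖spatial x‖) {H : Space → ℝ}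
    (hH : SphSmooth H) :
    HasFDerivAt (logInt η H) (∑ a : Fin 4, pvInt η (fun n => hgt (basisVec a) n * H n) x •
      coord a) x := by
  obtain ⟨C, hC0, hC⟩ := exists_sph_bound hH.continuous
  obtain ⟨B, hB0, hB⟩ := exists_norm_nullForm_le
  have hcont : ∀ x, Continuous fun n : Sph => logK η (hgt x n) * H n := fun x =>
    ((continuous_logK hη).comp (continuous_hgt_sph x)).mul hH.continuous
  have h := (hasFDerivAt_integral_of_dominated_loc_of_lip (μ := sphMeasure) (s := univ) (x₀ := x)
    (F := fun x (n : Sph) => logK η (hgt x n) * H n)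
    (F' := fun n : Sph => (pvK η (hgt x n) * H n) • nullForm n) (bound := fun _ => η⁻¹ * B * C)
    univ_mem (Eventually.of_forall fun x => (integrable_sph (hcont x)).1) (integrable_sph (hcont x))
    ((integrable_pvK_mul hη x hH.continuous).1.smul continuous_nullForm.aestronglyMeasurable)
    (Eventually.of_forall fun n => LipschitzOnWith.of_dist_le_mul fun y _ z _ => ?_)
    (integrable_const _) ?_).2
  · refine h.congr_fderiv ?_
    simp_rw [nullForm_eq_sum, Finset.smul_sum, smul_smul]
    have hint : ∀ a, Integrable (fun n : Sph => pvK η (hgt x n) * H n * hgt (basisVec a) n)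
        sphMeasure := fun a => by
      simp_rw [mul_assoc]
      exact integrable_pvK_mul hη x (hH.continuous.mul (continuous_hgt_sph _))
    rw [integral_finsetSum _ fun a _ => (hint a).smul_const _]
    refine Finset.sum_congr rfl fun a _ => ?_
    rw [integral_smul_const]
    congr 1
    unfold pvInt
    exact integral_congr_ae (Eventually.of_forall fun n => by simp only; ring)
  · rw [Real.coe_nnabs, abs_of_nonneg (by positivity), Real.dist_eq, ← sub_mul, abs_mul, dist_eq_norm]
    calc |logK η (hgt y n) - logK η (hgt z n)| * |H n| ≤ (η⁻¹ * |hgt y n - hgt z n|) * C :=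
          mul_le_mul (abs_logK_sub_le hη _ _) (hC n) (abs_nonneg _) (by positivity)
      _ ≤ (η⁻¹ * (B * ‖y - z‖)) * C := by
          gcongr
          rw [hgt, hgt, ← map_sub]
          exact ((nullForm n).le_opNorm _).trans (mul_le_mul_of_nonneg_right (hB n) (norm_nonneg _))
      _ = _ := by ring
  · filter_upwards [ae_hgt_ne x hr η, ae_hgt_ne x hr (-η)] with n h1 h2
    have := ((hasDerivAt_logK hη h1 h2).comp_hasFDerivAt x (nullForm n).hasFDerivAt).mul_const (H n)
    rw [smul_smul, mul_comm (H n)] at this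
    exact this

/-- The coefficient of the O(η) error is continuous in x, hence locally bounded. Local uniformity is
what allows derivatives to pass to the limit. -/
theorem tendstoLocallyUniformlyOn_pvInt {H : Space → ℝ} (hH : SphSmooth H) :
    TendstoLocallyUniformlyOn (fun η x => pvInt η H x) (pv H) (𝓝[>] 0) spacelike := by
  obtain ⟨M, hMc, hM⟩ := exists_abs_pvInt_sub_pv_le hH
  rw [Metric.tendstoLocallyUniformlyOn_iff]
  intro ε hε x hx
  have h1 : ∀ᶠ y in 𝓝[spacelike] x, M y < |M x| + 1 :=
    (hMc x hx).eventually_lt_const (lt_of_le_of_lt (le_abs_self _) (lt_add_one _))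
  refine ⟨_, inter_mem h1 self_mem_nhdsWithin, ?_⟩
  have hpos : 0 < ε / (|M x| + 1) := by positivity
  filter_upwards [Ioc_mem_nhdsGT (zero_lt_one' ℝ), Ioo_mem_nhdsGT hpos] with η hη hη' y hy
  rw [dist_comm, Real.dist_eq]
  refine (hM y hy.2 η hη.1 hη.2).trans_lt ?_
  have h2 : M y < |M x| + 1 := hy.1
  have h3 := hη'.2
  rw [lt_div_iff₀ (by positivity)] at h3
  have := mul_lt_mul_of_pos_right h2 hη.1
  linarith

theorem sphSmooth_hgt_mul (x : Mink) {H : Space → ℝ} (hH : SphSmooth H) :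
    SphSmooth fun n => hgt x n * H n := (sphSmooth_hgt x).mul hH

/-- The derivative of the logarithmic potential is a principal value integral. -/
theorem hasFDerivAt_logInt_zero {H : Space → ℝ} (hH : SphSmooth H) {x : Mink}
    (hx : x ∈ spacelike) :
    HasFDerivAt (logInt 0 H) (∑ a : Fin 4, pv (fun n => hgt (basisVec a) n * H n) x •
      coord a) x := by
  -- The parameter is restricted to the subtype η > 0 because the regularized derivative formula is
  -- required at every parameter value. The four components get tolerance ε/5 each, so that their
  -- sum stays strictly below ε.
  have hfilter : TendstoLocallyUniformlyOn
      (fun (η : Ioi (0 : ℝ)) x => ∑ a : Fin 4, pvInt η (fun n => hgt (basisVec a) n * H n) x •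
        coord a)
      (fun x => ∑ a : Fin 4, pv (fun n => hgt (basisVec a) n * H n) x •
        coord a) (comap Subtype.val (𝓝[>] 0)) spacelike := by
    rw [Metric.tendstoLocallyUniformlyOn_iff]
    intro ε hε y hy
    have h := fun a : Fin 4 => Metric.tendstoLocallyUniformlyOn_iff.1
      (tendstoLocallyUniformlyOn_pvInt (sphSmooth_hgt_mul (basisVec a) hH))
      (ε / 5) (by positivity) y hy
    choose t ht ht' using h
    refine ⟨⋂ a, t a, iInter_mem.2 ht, ?_⟩
    have h2 : ∀ᶠ η in 𝓝[>] (0 : ℝ), ∀ a : Fin 4, ∀ z ∈ t a,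
        dist (pv (fun n => hgt (basisVec a) n * H n) z)
          (pvInt η (fun n => hgt (basisVec a) n * H n) z) < ε / 5 :=
      eventually_all.2 ht'
    filter_upwards [preimage_mem_comap h2] with η hη z hz
    rw [dist_eq_norm, ← Finset.sum_sub_distrib]
    refine (norm_sum_le _ _).trans_lt ?_
    have h3 : ∀ a : Fin 4, ‖pv (fun n => hgt (basisVec a) n * H n) z •
        coord a
        - pvInt η (fun n => hgt (basisVec a) n * H n) z •
        coord a‖ ≤ ε / 5 := by
      intro a
      have e : ∀ r s : ℝ, ‖r • coord a - s • coord a‖ = dist r s * ‖coord a‖ := fun r s => by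
        rw [dist_eq_norm, ← norm_smul]
        congr 1
        ext v
        simp [sub_mul]
      rw [e]
      have h4 := hη a z (mem_iInter.1 hz a)
      have h5 : ‖coord a‖ ≤ 1 :=
        ContinuousLinearMap.opNorm_le_bound _ zero_le_one fun v => by
          simpa using norm_le_pi_norm v a
      calc _ ≤ ε / 5 * 1 := mul_le_mul h4.le h5 (norm_nonneg _) (by positivity)
        _ = _ := mul_one _
    calc _ ≤ ∑ _a : Fin 4, ε / 5 := Finset.sum_le_sum fun a _ => h3 a
      _ < ε := by simp; linarith
  have : (comap Subtype.val (𝓝[>] (0 : ℝ)) : Filter (Ioi (0 : ℝ))).NeBot := by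
    refine NeBot.comap_of_range_mem inferInstance ?_
    rw [Subtype.range_coe]
    exact self_mem_nhdsWithin
  exact hasFDerivAt_of_tendstoLocallyUniformlyOn (f := fun η : Ioi (0 : ℝ) => logInt η H)
    isOpen_spacelike hfilter
    (fun η y hy => hasFDerivAt_logInt η.2 (norm_spatial_pos hy) hH)
    (fun y hy => (tendsto_logInt hH.continuous hy).comp tendsto_comap) hx

theorem contDiff_dot_self : ContDiff ℝ ∞ fun x : Mink => dot x x := by unfold dot; fun_prop

theorem integral_linear_mul {H : Space → ℝ} (hH : SphSmooth H) (x : Mink) :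
    ∫ n : Sph, (2 * x 0 - hgt x n) * H n ∂sphMeasure = x 0 * ∫ n : Sph, H n ∂sphMeasure
      + ∑ i : Fin 3, x i.succ * ∫ n : Sph, (n : Space) i * H n ∂sphMeasure := by
  have hc := hH.continuous
  have h : ∀ n : Sph, (2 * x 0 - hgt x n) * H n
      = x 0 * H n + ∑ i : Fin 3, x i.succ * ((n : Space) i * H n) := by
    intro n
    rw [hgt_eq_sum, Fin.sum_univ_three, Fin.sum_univ_three]
    ring
  have hi : ∀ i : Fin 3, Integrable (fun n : Sph => x i.succ * ((n : Space) i * H n)) sphMeasure :=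
    fun i => integrable_sph (continuous_const.mul
      ((by fun_prop : Continuous fun n : Sph => (n : Space) i).mul hc))
  simp_rw [h]
  rw [integral_add ((integrable_sph hc).const_mul _) (integrable_finsetSum _ fun i _ => hi i),
    integral_const_mul, integral_finsetSum _ fun i _ => hi i]
  simp_rw [integral_const_mul]

/-- The integration by parts formula writes a principal value as logarithmic potentials with smooth
coefficients, divided by -x² > 0; no derivative in x is lost. -/
theorem contDiffOn_pv_of_logInt {m : ℕ∞}
    (h : ∀ H : Space → ℝ, SphSmooth H → ContDiffOn ℝ m (logInt 0 H) spacelike)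
    {H : Space → ℝ} (hH : SphSmooth H) : ContDiffOn ℝ m (pv H) spacelike := by
  have h1 : ContDiffOn ℝ m (fun x : Mink => ∑ i : Fin 3, x i.succ *
      logInt 0 (tanOp (EuclideanSpace.single i 1) H) x) spacelike :=
    ContDiffOn.sum fun i _ => (by fun_prop : ContDiff ℝ m fun x : Mink => x i.succ).contDiffOn.mul
      (h _ (hH.tanOp _))
  have h2 : ContDiff ℝ m fun x : Mink => x 0 * ∫ n : Sph, H n ∂sphMeasure
      + ∑ i : Fin 3, x i.succ * ∫ n : Sph, (n : Space) i * H n ∂sphMeasure := by fun_prop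
  have h3 : ContDiff ℝ m fun x : Mink => -dot x x :=
    (contDiff_dot_self.of_le (by exact_mod_cast le_top)).neg
  refine ((h1.sub h2.contDiffOn).div h3.contDiffOn fun x hx => ?_).congr fun x hx => ?_
  · have : dot x x < 0 := hx
    linarith
  · rw [pv, integral_linear_mul hH, logInt_tanOp le_rfl (norm_spatial_pos hx) hH]
    rfl

/-- Bootstrap: the gradient of a logarithmic potential consists of principal values, which are as
regular as logarithmic potentials of other densities. The induction must therefore treat all
densities at once. -/
theorem contDiffOn_logInt_nat (m : ℕ) :
    ∀ H : Space → ℝ, SphSmooth H → ContDiffOn ℝ m (logInt 0 H) spacelike := by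
  induction m with
  | zero =>
    intro H hH
    exact contDiffOn_zero.2 fun x hx =>
      (hasFDerivAt_logInt_zero hH hx).continuousAt.continuousWithinAt
  | succ m ih =>
    intro H hH
    rw [show ((m + 1 : ℕ) : WithTop ℕ∞) = (m : WithTop ℕ∞) + 1 by push_cast; rfl,
      contDiffOn_succ_iff_fderiv_of_isOpen isOpen_spacelike]
    refine ⟨fun x hx => (hasFDerivAt_logInt_zero hH hx).differentiableAt.differentiableWithinAt,
      by simp, ?_⟩
    refine ContDiffOn.congr ?_ fun x hx => (hasFDerivAt_logInt_zero hH hx).fderiv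
    exact ContDiffOn.sum fun a _ =>
      (contDiffOn_pv_of_logInt (m := m) (by exact_mod_cast ih)
        (sphSmooth_hgt_mul (basisVec a) hH)).smul contDiffOn_const

theorem contDiffOn_logInt {H : Space → ℝ} (hH : SphSmooth H) :
    ContDiffOn ℝ ∞ (logInt 0 H) spacelike :=
  contDiffOn_infty.2 fun m => contDiffOn_logInt_nat m H hH

theorem contDiffOn_pv {H : Space → ℝ} (hH : SphSmooth H) : ContDiffOn ℝ ∞ (pv H) spacelike :=
  contDiffOn_pv_of_logInt (m := ⊤) (fun _ h => contDiffOn_logInt h) hH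

/-! ### Partial derivatives and the wave operator on spacelike vectors -/

/-- Partial derivatives. -/
def pd (a : Fin 4) (f : Mink → ℝ) (x : Mink) : ℝ := fderiv ℝ f x (basisVec a)

/-- The diagonal entries of the metric. -/
def eta (a : Fin 4) : ℝ := dot (basisVec a) (basisVec a)

theorem eta_zero : eta 0 = 1 := by
  simp [eta, dot, basisVec]

theorem eta_succ (i : Fin 3) : eta i.succ = -1 := by
  simp [eta, dot, basisVec, Pi.single_apply]

theorem eta_mul_self (a : Fin 4) : eta a * eta a = 1 := by
  refine Fin.cases ?_ (fun i => ?_) a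
  · simp [eta_zero]
  · simp [eta_succ]

theorem dot_eq_sum (x y : Mink) : dot x y = ∑ a, eta a * (x a * y a) := by
  rw [Fin.sum_univ_succ]
  simp only [eta_zero, eta_succ, dot]
  simp
  ring

theorem hgt_basisVec_zero (n : Space) : hgt (basisVec 0) n = 1 := by
  simp [hgt_eq_sum, basisVec]

theorem hgt_basisVec_succ (i : Fin 3) (n : Space) : hgt (basisVec i.succ) n = -n i := by
  simp [hgt_eq_sum, basisVec, Pi.single_apply]

theorem hgt_eq_sum_basisVec (x : Mink) (n : Space) : hgt x n = ∑ a, hgt (basisVec a) n * x a := by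
  rw [hgt, nullForm_eq_sum]
  simp

theorem box_eq (F : Mink → ℝ) (x : Mink) : box F x = ∑ a, eta a * pd a (pd a F) x := rfl

section Calculus

variable {f g : Mink → ℝ} {x : Mink}

theorem spacelike_mem_nhds (hx : x ∈ spacelike) : spacelike ∈ 𝓝 x := isOpen_spacelike.mem_nhds hx

theorem differentiableAt_of_contDiffOn (hf : ContDiffOn ℝ ∞ f spacelike) (hx : x ∈ spacelike) :
    DifferentiableAt ℝ f x :=
  (hf.contDiffAt (spacelike_mem_nhds hx)).differentiableAt (by simp)

theorem pd_congr (h : EqOn f g spacelike) (hx : x ∈ spacelike) (a : Fin 4) : pd a f x = pd a g x := by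
  rw [pd, pd, (h.eventuallyEq_of_mem (spacelike_mem_nhds hx)).fderiv_eq]

theorem contDiffOn_pd (hf : ContDiffOn ℝ ∞ f spacelike) (a : Fin 4) :
    ContDiffOn ℝ ∞ (pd a f) spacelike :=
  (hf.fderiv_of_isOpen isOpen_spacelike (by simp)).clm_apply contDiffOn_const

theorem pd_comm (hf : ContDiffOn ℝ ∞ f spacelike) (hx : x ∈ spacelike) (a b : Fin 4) :
    pd a (pd b f) x = pd b (pd a f) x := by
  have hd : DifferentiableAt ℝ (fderiv ℝ f) x :=
    ((hf.fderiv_of_isOpen (m := ∞) isOpen_spacelike (by simp)).contDiffAt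
      (spacelike_mem_nhds hx)).differentiableAt (by simp)
  have h1 : ∀ a b, pd a (pd b f) x = fderiv ℝ (fderiv ℝ f) x (basisVec a) (basisVec b) := by
    intro a b
    have := hd.hasFDerivAt.clm_apply (hasFDerivAt_const (basisVec b) x)
    rw [pd, show pd b f = fun y => fderiv ℝ f y (basisVec b) from rfl, this.fderiv]
    simp
  have hsymm : IsSymmSndFDerivAt ℝ f x :=
    (hf.contDiffAt (spacelike_mem_nhds hx)).isSymmSndFDerivAt
      (by rw [minSmoothness_of_isRCLikeNormedField]; exact WithTop.coe_le_coe.2 le_top)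
  rw [h1, h1]
  exact hsymm.eq _ _

theorem pd_sum {ι : Type*} (s : Finset ι) (c : ι → ℝ) (F : ι → Mink → ℝ)
    (hF : ∀ i ∈ s, ContDiffOn ℝ ∞ (F i) spacelike) (hx : x ∈ spacelike) (a : Fin 4) :
    pd a (fun y => ∑ i ∈ s, c i * F i y) x = ∑ i ∈ s, c i * pd a (F i) x := by
  have h := HasFDerivAt.fun_sum fun i hi =>
    ((differentiableAt_of_contDiffOn (hF i hi) hx).hasFDerivAt.const_mul (c i))
  rw [pd, h.fderiv]
  simp [pd]

theorem pd_coord_mul (hf : ContDiffOn ℝ ∞ f spacelike) (hx : x ∈ spacelike) (a b : Fin 4) :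
    pd a (fun y => y b * f y) x = (basisVec a : Mink) b * f x + x b * pd a f x := by
  have h := (coord b).hasFDerivAt (x := x) |>.mul
    (differentiableAt_of_contDiffOn hf hx).hasFDerivAt
  rw [pd, show fderiv ℝ (fun y => y b * f y) x = _ from h.fderiv]
  simp [pd]
  ring

theorem contDiffOn_coord_mul (hf : ContDiffOn ℝ ∞ f spacelike) (b : Fin 4) :
    ContDiffOn ℝ ∞ (fun y => y b * f y) spacelike :=
  ((coord b).contDiff.contDiffOn).mul hf

theorem box_sum {ι : Type*} (s : Finset ι) (c : ι → ℝ) (F : ι → Mink → ℝ)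
    (hF : ∀ i ∈ s, ContDiffOn ℝ ∞ (F i) spacelike) (hx : x ∈ spacelike) :
    box (fun y => ∑ i ∈ s, c i * F i y) x = ∑ i ∈ s, c i * box (F i) x := by
  simp_rw [box_eq, Finset.mul_sum]
  rw [Finset.sum_comm]
  refine Finset.sum_congr rfl fun a _ => ?_
  rw [pd_congr (fun y hy => pd_sum s c F hF hy a) hx,
    pd_sum s c _ (fun i hi => contDiffOn_pd (hF i hi) a) hx, Finset.mul_sum]
  exact Finset.sum_congr rfl fun i _ => by ring

theorem box_coord_mul (hf : ContDiffOn ℝ ∞ f spacelike) (hx : x ∈ spacelike) (b : Fin 4) :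
    box (fun y => y b * f y) x = 2 * eta b * pd b f x + x b * box f x := by
  have h : ∀ a, pd a (pd a fun y => y b * f y) x
      = 2 * (basisVec a : Mink) b * pd a f x + x b * pd a (pd a f) x := by
    intro a
    -- The product rule is packaged as a two-term sum with constant coefficients, so that `pd_sum`
    -- can differentiate it again.
    have h1 : EqOn (pd a fun y => y b * f y)
        (fun y => ∑ i : Fin 2, (![(basisVec a : Mink) b, 1] i) * (![f, fun y => y b * pd a f y] i) y)
        spacelike := fun y hy => by
      simp [pd_coord_mul hf hy]
    rw [pd_congr h1 hx, pd_sum _ _ _ _ hx]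
    · simp [pd_coord_mul (contDiffOn_pd hf a) hx]
      ring
    · intro i _
      fin_cases i
      · exact hf
      · exact contDiffOn_coord_mul (contDiffOn_pd hf a) b
  simp_rw [box_eq, h, mul_add, Finset.sum_add_distrib, Finset.mul_sum]
  congr 1
  · rw [Finset.sum_eq_single b]
    · simp [basisVec]; ring
    · intro a _ hab
      simp [basisVec, hab.symm]
    · simp
  · exact Finset.sum_congr rfl fun i _ => by ring

end Calculus

/-! ### Linearity and the wave equation for principal values -/

theorem pvInt_congr {η : ℝ} {H G : Space → ℝ} (h : ∀ n : Sph, H n = G n) (x : Mink) :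
    pvInt η H x = pvInt η G x := by
  unfold pvInt
  simp_rw [h]

/-- The defining formula differentiates H off the sphere, so independence of the extension is not
visible in it; it comes from the limit of the truncated integrals. -/
theorem pv_congr {H G : Space → ℝ} (hH : SphSmooth H) (hG : SphSmooth G)
    (h : ∀ n : Sph, H n = G n) {x : Mink} (hx : x ∈ spacelike) : pv H x = pv G x := by
  refine tendsto_nhds_unique (tendsto_pvInt hH hx) ?_
  simp_rw [pvInt_congr h]
  exact tendsto_pvInt hG hx

theorem sphSmooth_sum {ι : Type*} (s : Finset ι) (c : ι → ℝ) {H : ι → Space → ℝ}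
    (hH : ∀ i ∈ s, SphSmooth (H i)) : SphSmooth fun n => ∑ i ∈ s, c i * H i n :=
  ContDiffOn.sum fun i hi => contDiffOn_const.mul (hH i hi)

theorem pvInt_sum {ι : Type*} (s : Finset ι) (c : ι → ℝ) {H : ι → Space → ℝ}
    (hH : ∀ i ∈ s, SphSmooth (H i)) {η : ℝ} (hη : 0 < η) (x : Mink) :
    pvInt η (fun n => ∑ i ∈ s, c i * H i n) x = ∑ i ∈ s, c i * pvInt η (H i) x := by
  unfold pvInt
  simp_rw [← integral_const_mul, Finset.mul_sum]
  rw [← integral_finsetSum _ fun i hi => (integrable_pvK_mul hη x (hH i hi).continuous).const_mul _]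
  refine integral_congr_ae (Eventually.of_forall fun n => Finset.sum_congr rfl fun i _ => by ring)

theorem pv_sum {ι : Type*} (s : Finset ι) (c : ι → ℝ) {H : ι → Space → ℝ}
    (hH : ∀ i ∈ s, SphSmooth (H i)) {x : Mink} (hx : x ∈ spacelike) :
    pv (fun n => ∑ i ∈ s, c i * H i n) x = ∑ i ∈ s, c i * pv (H i) x := by
  refine tendsto_nhds_unique (tendsto_pvInt (sphSmooth_sum s c hH) hx) ?_
  refine (tendsto_finsetSum s fun i hi => (tendsto_pvInt (hH i hi) hx).const_mul (c i)).congr' ?_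
  filter_upwards [self_mem_nhdsWithin] with η hη
  exact (pvInt_sum s c hH hη x).symm

theorem pv_const_mul (c : ℝ) {H : Space → ℝ} (hH : SphSmooth H) {x : Mink} (hx : x ∈ spacelike) :
    pv (fun n => c * H n) x = c * pv H x := by
  simpa using pv_sum (Finset.univ : Finset Unit) (fun _ => c) (H := fun _ => H) (fun _ _ => hH) hx

theorem pd_logInt {H : Space → ℝ} (hH : SphSmooth H) {x : Mink} (hx : x ∈ spacelike) (a : Fin 4) :
    pd a (logInt 0 H) x = pv (fun n => hgt (basisVec a) n * H n) x := by
  rw [pd, (hasFDerivAt_logInt_zero hH hx).fderiv]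
  simp [basisVec, Pi.single_apply]

/-- This is where the section l_0 = 1 pays off: every principal value is itself the time derivative
of a smooth potential. -/
theorem pd_zero_logInt {H : Space → ℝ} (hH : SphSmooth H) {x : Mink} (hx : x ∈ spacelike) :
    pd 0 (logInt 0 H) x = pv H x := by
  rw [pd_logInt hH hx]
  simp [hgt_basisVec_zero]

/-- Mixed second derivatives of the logarithmic potential commute. Any derivative is thereby
converted into a time derivative with a factor l_a in the density, avoiding the kernel (x·l)⁻². -/
theorem pd_pv {H : Space → ℝ} (hH : SphSmooth H) {x : Mink} (hx : x ∈ spacelike) (a : Fin 4) :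
    pd a (pv H) x = pd 0 (pv fun n => hgt (basisVec a) n * H n) x := by
  rw [← pd_congr (fun y hy => pd_zero_logInt hH hy) hx, pd_comm (contDiffOn_logInt hH) hx,
    pd_congr (fun y hy => pd_logInt hH hy a) hx]

/-- The divergence of a family of principal value integrals. -/
theorem sum_pd_pv (c : Fin 4 → ℝ) {H : Fin 4 → Space → ℝ} (hH : ∀ a, SphSmooth (H a))
    {x : Mink} (hx : x ∈ spacelike) :
    ∑ a, c a * pd a (pv (H a)) x
      = pd 0 (pv fun n => ∑ a, c a * (hgt (basisVec a) n * H a n)) x := by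
  have h1 : ∀ a, SphSmooth fun n => hgt (basisVec a) n * H a n := fun a =>
    sphSmooth_hgt_mul _ (hH a)
  rw [pd_congr (fun y hy => pv_sum Finset.univ c (fun a _ => h1 a) hy) hx,
    pd_sum _ _ _ (fun a _ => contDiffOn_pv (h1 a)) hx]
  exact Finset.sum_congr rfl fun a _ => by rw [pd_pv (hH a) hx]

theorem sum_eta_hgt_sq (n : Sph) :
    ∑ a, eta a * (hgt (basisVec a) n * hgt (basisVec a) n) = 0 := by
  rw [Fin.sum_univ_succ]
  simp only [eta_zero, eta_succ, hgt_basisVec_zero, hgt_basisVec_succ]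
  have := sum_coord_sq n
  simp
  linarith

theorem pd_zero_fun {f : Mink → ℝ} (h : EqOn f (fun _ => 0) spacelike) {x : Mink}
    (hx : x ∈ spacelike) (a : Fin 4) : pd a f x = 0 := by
  rw [pd_congr h hx, pd]
  simp

theorem sphSmooth_const (c : ℝ) : SphSmooth fun _ => c := contDiffOn_const

/-- The divergence of the gradient is ∂_0 of a principal value whose density contains l·l = 0. -/
theorem box_logInt {H : Space → ℝ} (hH : SphSmooth H) {x : Mink} (hx : x ∈ spacelike) :
    box (logInt 0 H) x = 0 := by
  have hs : ∀ a, SphSmooth fun n => hgt (basisVec a) n * H n := fun a => sphSmooth_hgt_mul _ hH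
  have h1 : ∀ a, pd a (pd a (logInt 0 H)) x = pd a (pv fun n => hgt (basisVec a) n * H n) x :=
    fun a => pd_congr (fun y hy => pd_logInt hH hy a) hx a
  rw [box_eq]
  simp_rw [h1]
  rw [sum_pd_pv eta hs hx]
  refine pd_zero_fun (fun y hy => ?_) hx 0
  have h2 : SphSmooth fun n => ∑ a, eta a * (hgt (basisVec a) n * (hgt (basisVec a) n * H n)) :=
    sphSmooth_sum _ _ fun a _ => sphSmooth_hgt_mul _ (hs a)
  have h3 : ∀ n : Sph, ∑ a, eta a * (hgt (basisVec a) n * (hgt (basisVec a) n * H n))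
      = (0 : ℝ) * (fun _ : Space => (1 : ℝ)) n := by
    intro n
    have h4 := sum_eta_hgt_sq n
    simp_rw [← mul_assoc] at h4 ⊢
    rw [← Finset.sum_mul, h4, zero_mul, zero_mul]
  rw [pv_congr h2 ((sphSmooth_const 0).mul (sphSmooth_const 1)) h3 hy, pv_const_mul 0 (sphSmooth_const 1) hy,
    zero_mul]

theorem box_pv {H : Space → ℝ} (hH : SphSmooth H) {x : Mink} (hx : x ∈ spacelike) :
    box (pv H) x = 0 := by
  have hq := contDiffOn_logInt hH
  have h1 : ∀ a, pd a (pd a (pv H)) x = pd 0 (pd a (pd a (logInt 0 H))) x := by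
    intro a
    have e1 : EqOn (pd a (pv H)) (pd 0 (pd a (logInt 0 H))) spacelike := fun y hy => by
      rw [← pd_congr (fun y hy => pd_zero_logInt hH hy) hy, pd_comm hq hy]
    rw [pd_congr e1 hx, pd_comm (contDiffOn_pd hq a) hx]
  rw [box_eq]
  simp_rw [h1]
  rw [← pd_sum Finset.univ eta _ (fun a _ => contDiffOn_pd (contDiffOn_pd hq a) a) hx]
  exact pd_zero_fun (fun y hy => box_logInt hH hy) hx 0

/-! ### The constant density in closed form -/

theorem hasDerivAt_line {f : Mink → ℝ} (hf : ContDiffOn ℝ ∞ f spacelike) {x : Mink}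
    (hx : x ∈ spacelike) (a : Fin 4) :
    HasDerivAt (fun t : ℝ => f (x + t • basisVec a)) (pd a f x) 0 := by
  have h1 : HasDerivAt (fun t : ℝ => x + t • basisVec a) (basisVec a) 0 := by
    simpa using ((hasDerivAt_id (0 : ℝ)).smul_const (basisVec a)).const_add x
  have h2 : HasFDerivAt f (fderiv ℝ f x) (x + (0 : ℝ) • basisVec a) := by
    simpa using (differentiableAt_of_contDiffOn hf hx).hasFDerivAt
  exact h2.comp_hasDerivAt 0 h1

theorem eventually_line_mem {x : Mink} (hx : x ∈ spacelike) (a : Fin 4) :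
    ∀ᶠ t : ℝ in 𝓝 0, x + t • basisVec a ∈ spacelike := by
  have h1 : Continuous fun t : ℝ => x + t • basisVec a := by fun_prop
  exact h1.continuousAt.eventually_mem (by simpa using spacelike_mem_nhds hx)

theorem spatial_line (x : Mink) (t : ℝ) : spatial (x + t • basisVec 0) = spatial x := by
  ext i
  simp [basisVec]

theorem sub_norm_ne_zero {x : Mink} (hx : x ∈ spacelike) :
    x 0 - ‖spatial x‖ ≠ 0 ∧ x 0 + ‖spatial x‖ ≠ 0 := by
  have h : dot x x < 0 := hx
  rw [dot_self_eq] at h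
  have : (x 0 - ‖spatial x‖) * (x 0 + ‖spatial x‖) ≠ 0 := by nlinarith
  exact mul_ne_zero_iff.1 this

theorem logInt_one {x : Mink} (hx : x ∈ spacelike) :
    logInt 0 (fun _ => 1) x = 2 * Real.pi / ‖spatial x‖ *
      ((x 0 + ‖spatial x‖) * Real.log (x 0 + ‖spatial x‖)
        - (x 0 - ‖spatial x‖) * Real.log (x 0 - ‖spatial x‖) - 2 * ‖spatial x‖) := by
  unfold logInt
  simp_rw [mul_one]
  rw [integral_comp_hgt x (norm_spatial_pos hx) _ (measurable_logK 0)]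
  simp_rw [logK_zero]
  rw [integral_log]
  ring

/-- Differentiate the closed form of the logarithmic potential in time, at fixed spatial part. One
of the arguments is negative; `Real.log` there is the logarithm of the absolute value, as needed. -/
theorem pv_one {x : Mink} (hx : x ∈ spacelike) :
    pv (fun _ => 1) x = 2 * Real.pi / ‖spatial x‖ *
      (Real.log (x 0 + ‖spatial x‖) - Real.log (x 0 - ‖spatial x‖)) := by
  have h1 := hasDerivAt_line (contDiffOn_logInt (sphSmooth_const 1)) hx 0
  rw [pd_zero_logInt (sphSmooth_const 1) hx] at h1
  refine h1.unique ?_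
  obtain ⟨hm, hp⟩ := sub_norm_ne_zero hx
  set r := ‖spatial x‖ with hr
  have h2 : (fun t : ℝ => logInt 0 (fun _ => 1) (x + t • basisVec 0)) =ᶠ[𝓝 0] fun t =>
      2 * Real.pi / r * ((x 0 + t + r) * Real.log (x 0 + t + r)
        - (x 0 + t - r) * Real.log (x 0 + t - r) - 2 * r) := by
    filter_upwards [eventually_line_mem hx 0] with t ht
    rw [logInt_one ht, spatial_line, ← hr]
    simp [basisVec]
  refine HasDerivAt.congr_of_eventuallyEq ?_ h2
  have h3 : ∀ c : ℝ, HasDerivAt (fun t : ℝ => x 0 + t + c) 1 0 := fun c =>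
    ((hasDerivAt_id (0 : ℝ)).const_add (x 0)).add_const c
  have h4 : ∀ c : ℝ, x 0 + c ≠ 0 → HasDerivAt
      (fun t : ℝ => (x 0 + t + c) * Real.log (x 0 + t + c)) (Real.log (x 0 + c) + 1) 0 := by
    intro c hc
    have h5 := (Real.hasDerivAt_mul_log hc)
    have h6 : HasDerivAt (fun y => y * Real.log y) (Real.log (x 0 + c) + 1) (x 0 + 0 + c) := by
      simpa using h5
    simpa [Function.comp_def] using h6.comp (0 : ℝ) (h3 c)
  have h7 := (((h4 r hp).sub (h4 (-r) (by simpa [sub_eq_add_neg] using hm))).sub_const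
    (2 * r)).const_mul (2 * Real.pi / r)
  simp only [← sub_eq_add_neg] at h7
  refine h7.congr_deriv ?_
  ring

theorem pd_pv_one {x : Mink} (hx : x ∈ spacelike) :
    pd 0 (pv fun _ => 1) x = -(4 * Real.pi) / dot x x := by
  have h1 := hasDerivAt_line (contDiffOn_pv (sphSmooth_const 1)) hx 0
  refine h1.unique ?_
  obtain ⟨hm, hp⟩ := sub_norm_ne_zero hx
  have hrpos := norm_spatial_pos hx
  rw [dot_self_eq]
  set r := ‖spatial x‖ with hr
  have h2 : (fun t : ℝ => pv (fun _ => 1) (x + t • basisVec 0)) =ᶠ[𝓝 0] fun t =>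
      2 * Real.pi / r * (Real.log (x 0 + t + r) - Real.log (x 0 + t - r)) := by
    filter_upwards [eventually_line_mem hx 0] with t ht
    rw [pv_one ht, spatial_line, ← hr]
    simp [basisVec]
  refine HasDerivAt.congr_of_eventuallyEq ?_ h2
  have h4 : ∀ c : ℝ, x 0 + c ≠ 0 → HasDerivAt
      (fun t : ℝ => Real.log (x 0 + t + c)) (x 0 + c)⁻¹ 0 := by
    intro c hc
    have h3 : HasDerivAt (fun t : ℝ => x 0 + t + c) 1 0 :=
      ((hasDerivAt_id (0 : ℝ)).const_add (x 0)).add_const c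
    simpa using h3.log (by simpa using hc)
  have h7 := ((h4 r hp).sub (h4 (-r) (by simpa [sub_eq_add_neg] using hm))).const_mul
    (2 * Real.pi / r)
  simp only [← sub_eq_add_neg] at h7
  refine h7.congr_deriv ?_
  have h8 : x 0 ^ 2 - r ^ 2 = (x 0 + r) * (x 0 - r) := by ring
  rw [h8]
  field_simp
  ring

/-! ### The potential F_v -/

/-- The function `x ↦ (1/2π) ∫ x·W(l) / x·l d²l`. -/
def cloudF (W : Fin 4 → Space → ℝ) (x : Mink) : ℝ :=
  ∑ b, (1 / (2 * Real.pi) * eta b) * (x b * pv (W b) x)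

theorem contDiffOn_cloudF {W : Fin 4 → Space → ℝ} (hW : ∀ b, SphSmooth (W b)) :
    ContDiffOn ℝ ∞ (cloudF W) spacelike :=
  ContDiffOn.sum fun b _ => contDiffOn_const.mul (contDiffOn_coord_mul (contDiffOn_pv (hW b)) b)

/-- Principal values solve the wave equation, so □ applied to x_b pv(W_b) leaves only the cross
terms. These assemble into ∂_0 pv(l·W), and l·W is the constant -e/2: only the contraction of W with
l matters. -/
theorem box_cloudF {W : Fin 4 → Space → ℝ} (hW : ∀ b, SphSmooth (W b)) {e : ℝ}
    (hl : ∀ n : Sph, ∑ a, hgt (basisVec a) n * W a n = -e / 2) {x : Mink} (hx : x ∈ spacelike) :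
    box (cloudF W) x = 2 * e / dot x x := by
  have h1 : box (cloudF W) x = ∑ b, (1 / (2 * Real.pi) * eta b) *
      box (fun y => y b * pv (W b) y) x :=
    box_sum _ _ _ (fun b _ => contDiffOn_coord_mul (contDiffOn_pv (hW b)) b) hx
  have h2 : ∀ b, (1 / (2 * Real.pi) * eta b) * box (fun y => y b * pv (W b) y) x
      = 1 / Real.pi * (1 * pd b (pv (W b)) x) := by
    intro b
    rw [box_coord_mul (contDiffOn_pv (hW b)) hx, box_pv (hW b) hx]
    have := eta_mul_self b
    have hpi := Real.pi_ne_zero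
    field_simp
    linear_combination (2 * pd b (pv (W b)) x) * this
  rw [h1]
  simp_rw [h2]
  rw [← Finset.mul_sum, sum_pd_pv _ hW hx]
  have hs : SphSmooth fun n => ∑ a, 1 * (hgt (basisVec a) n * W a n) :=
    sphSmooth_sum _ _ fun a _ => sphSmooth_hgt_mul _ (hW a)
  have h3 : ∀ n : Sph, ∑ a, 1 * (hgt (basisVec a) n * W a n)
      = (-e / 2) * (fun _ : Space => (1 : ℝ)) n := by
    intro n
    simp_rw [one_mul, hl, mul_one]
  have h4 : EqOn (pv fun n => ∑ a, 1 * (hgt (basisVec a) n * W a n))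
      (fun y => ∑ _i : Fin 1, (-e / 2) * pv (fun _ => 1) y) spacelike := fun y hy => by
    rw [pv_congr hs ((sphSmooth_const (-e / 2)).mul (sphSmooth_const 1)) h3 hy,
      pv_const_mul _ (sphSmooth_const 1) hy]
    simp
  rw [pd_congr h4 hx, pd_sum _ (fun _ => -e / 2) (fun _ => pv fun _ => 1)
    (fun _ _ => contDiffOn_pv (sphSmooth_const 1)) hx, pd_pv_one hx]
  have hpi := Real.pi_ne_zero
  have : dot x x ≠ 0 := ne_of_lt hx
  simp
  field_simp
  ring

theorem coneChart_sph (n : Sph) : coneChart n = mkVec 1 n := by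
  rw [coneChart, norm_sph]

theorem contDiffOn_coneChart : ContDiffOn ℝ ∞ coneChart {0}ᶜ := by
  rw [contDiffOn_pi]
  intro a
  refine Fin.cases ?_ (fun i => ?_) a
  · exact contDiffOn_id.norm ℝ fun y hy => hy
  · exact (by fun_prop : ContDiff ℝ ∞ fun y : Space => y i).contDiffOn

theorem norm_spatial_lt {v : Mink} (hv : v ∈ hypPlus) : ‖spatial v‖ < v 0 := by
  obtain ⟨h1, h2⟩ := hv
  rw [dot_self_eq] at h1
  exact lt_of_pow_lt_pow_left₀ 2 h2.le (by linarith)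

theorem dot_mkVec (x : Mink) (t : ℝ) (y : Space) :
    dot x (mkVec t y) = x 0 * t - ⟪spatial x, y⟫ := by
  simp [dot, PiLp.inner_apply, mul_comm]

theorem dot_coneChart_pos {v : Mink} (hv : v ∈ hypPlus) {y : Space} (hy : y ≠ 0) :
    0 < dot v (coneChart y) := by
  rw [coneChart, dot_mkVec]
  have h1 := real_inner_le_norm (spatial v) y
  have h2 := mul_lt_mul_of_pos_right (norm_spatial_lt hv) (norm_pos_iff.2 hy)
  linarith

theorem coneChart_mem {y : Space} (hy : y ≠ 0) : coneChart y ∈ lightCone := by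
  refine ⟨?_, norm_pos_iff.2 hy⟩
  rw [coneChart, dot_mkVec]
  have : spatial (mkVec ‖y‖ y) = y := by ext i; simp
  rw [this, real_inner_self_eq_norm_sq]
  simp
  ring

/-- The components of `V_v(0, l) - e v / (2 v·l)` in the chart of the cone. -/
def cloudW (e : ℝ) (Vs : Mink → ℝ → Mink → Mink) (v : Mink) (a : Fin 4) (y : Space) : ℝ :=
  Vs v 0 (coneChart y) a - e / (2 * dot v (coneChart y)) * v a

theorem contDiff_dot_right (v : Mink) : ContDiff ℝ ∞ fun x => dot v x := by unfold dot; fun_prop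

theorem sphSmooth_profile {Vs : Mink → ℝ → Mink → Mink} (hVs : IsProfileFamily Vs) {v : Mink}
    (hv : v ∈ hypPlus) (a : Fin 4) : SphSmooth fun y => Vs v 0 (coneChart y) a := by
  obtain ⟨ε, -, h⟩ := hVs.memV v hv
  have h1 : ContDiffOn ℝ ∞ (fun y : Space => Vs v 0 (coneChart y)) {0}ᶜ :=
    h.smooth.comp (f := fun y : Space => ((0 : ℝ), y)) (by fun_prop) fun y hy => hy
  exact contDiffOn_pi.1 h1 a

theorem sphSmooth_cloudW (e : ℝ) {Vs : Mink → ℝ → Mink → Mink} (hVs : IsProfileFamily Vs) {v : Mink}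
    (hv : v ∈ hypPlus) (a : Fin 4) : SphSmooth (cloudW e Vs v a) := by
  refine (sphSmooth_profile hVs hv a).sub ((ContDiffOn.div contDiffOn_const
    (contDiffOn_const.mul ((contDiff_dot_right v).comp_contDiffOn contDiffOn_coneChart))
    fun y hy => ?_).mul contDiffOn_const)
  have := dot_coneChart_pos hv hy
  positivity

theorem dot_eq_sum_hgt (n : Sph) (w : Mink) :
    dot (coneChart n) w = ∑ a, hgt (basisVec a) n * w a := by
  rw [← hgt_eq_sum_basisVec, ← dot_mkVec_one, coneChart_sph]
  simp [dot, mul_comm]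

/-- The profile drops out because it is orthogonal to l, and v·l cancels in the Coulomb term. This
is why no choice of profiles can help. -/
theorem sum_hgt_cloudW (e : ℝ) {Vs : Mink → ℝ → Mink → Mink} (hVs : IsProfileFamily Vs) {v : Mink}
    (hv : v ∈ hypPlus) (n : Sph) : ∑ a, hgt (basisVec a) n * cloudW e Vs v a n = -e / 2 := by
  obtain ⟨ε, -, h⟩ := hVs.memV v hv
  have h1 := h.orthogonal 0 _ (coneChart_mem (sph_ne_zero n))
  have h2 := dot_coneChart_pos hv (sph_ne_zero n)
  have h3 : dot (coneChart n) v = dot v (coneChart n) := by simp [dot, mul_comm]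
  unfold cloudW
  simp_rw [mul_sub, Finset.sum_sub_distrib, mul_left_comm _ (e / _), ← Finset.mul_sum]
  rw [← dot_eq_sum_hgt, h1, ← dot_eq_sum_hgt, h3]
  field_simp
  ring

theorem measurableEmbedding_mkVec_one :
    MeasurableEmbedding fun n : Sph => mkVec 1 (n : Space) := by
  refine Topology.IsClosedEmbedding.measurableEmbedding (Continuous.isClosedEmbedding ?_ ?_)
  · refine continuous_pi fun a => ?_
    refine Fin.cases ?_ (fun i => ?_) a
    · exact continuous_const
    · exact (by fun_prop : Continuous fun n : Sph => (n : Space) i)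
  · intro n m h
    ext i
    exact congrFun h i.succ

theorem integral_lightMeasure (f : Mink → ℝ) :
    ∫ l, f l ∂lightMeasure = ∫ n : Sph, f (coneChart n) ∂sphMeasure := by
  rw [lightMeasure, measurableEmbedding_mkVec_one.integral_map]
  simp_rw [coneChart_sph]

theorem truncF_eq (e : ℝ) {Vs : Mink → ℝ → Mink → Mink} (hVs : IsProfileFamily Vs) {v : Mink}
    (hv : v ∈ hypPlus) (x : Mink) {η : ℝ} (hη : 0 < η) :
    truncF e Vs v x η
      = ∑ b, (1 / (2 * Real.pi) * eta b) * (x b * pvInt η (cloudW e Vs v b) x) := by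
  have hS : MeasurableSet {l : Mink | η ≤ |dot x l|} :=
    measurableSet_le measurable_const (contDiff_dot_right x).continuous.abs.measurable
  rw [truncF, ← integral_indicator hS, integral_lightMeasure]
  have h : ∀ n : Sph, {l : Mink | η ≤ |dot x l|}.indicator (fun l =>
      (dot x l)⁻¹ * dot x (Vs v 0 l - (e / (2 * dot v l)) • v)) (coneChart n)
      = ∑ b, (eta b * x b) * (pvK η (hgt x n) * cloudW e Vs v b n) := by
    intro n
    simp only [indicator_apply, Set.mem_ofPred_eq, coneChart_sph, dot_mkVec_one, pvK]
    split_ifs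
    · rw [dot_eq_sum, Finset.mul_sum]
      refine Finset.sum_congr rfl fun b _ => ?_
      simp only [cloudW, coneChart_sph, dot_mkVec_one, Pi.sub_apply, Pi.smul_apply, smul_eq_mul]
      ring
    · simp
  simp_rw [h]
  rw [integral_finsetSum _ fun b _ =>
    (integrable_pvK_mul hη x (sphSmooth_cloudW e hVs hv b).continuous).const_mul _, Finset.mul_sum]
  refine Finset.sum_congr rfl fun b _ => ?_
  rw [integral_const_mul, pvInt]
  ring

theorem tendsto_truncF (e : ℝ) {Vs : Mink → ℝ → Mink → Mink} (hVs : IsProfileFamily Vs) {v : Mink}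
    (hv : v ∈ hypPlus) {x : Mink} (hx : x ∈ spacelike) :
    Tendsto (truncF e Vs v x) (𝓝[>] 0) (𝓝 (cloudF (cloudW e Vs v) x)) := by
  have h : Tendsto (fun η => ∑ b, (1 / (2 * Real.pi) * eta b) *
      (x b * pvInt η (cloudW e Vs v b) x)) (𝓝[>] 0) (𝓝 (cloudF (cloudW e Vs v) x)) :=
    tendsto_finsetSum _ fun b _ =>
      ((tendsto_pvInt (sphSmooth_cloudW e hVs hv b) hx).const_mul _).const_mul _
  refine h.congr' ?_
  filter_upwards [self_mem_nhdsWithin] with η hη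
  exact (truncF_eq e hVs hv x hη).symm

theorem neg_dot (x y : Mink) : dot (-x) y = -dot x y := by
  simp [dot]; ring

theorem smul_dot (c : ℝ) (x y : Mink) : dot (c • x) y = c * dot x y := by
  simp [dot, Finset.mul_sum, mul_sub, mul_assoc]

theorem dot_comm (x y : Mink) : dot x y = dot y x := by
  simp [dot, mul_comm]

theorem neg_mem_spacelike {x : Mink} (hx : x ∈ spacelike) : -x ∈ spacelike := by
  change dot (-x) (-x) < 0
  rw [neg_dot, dot_comm, neg_dot, neg_neg]
  exact hx

theorem smul_mem_spacelike {x : Mink} (hx : x ∈ spacelike) {c : ℝ} (hc : c ≠ 0) :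
    c • x ∈ spacelike := by
  change dot (c • x) (c • x) < 0
  rw [smul_dot, dot_comm, smul_dot, ← mul_assoc]
  exact mul_neg_of_pos_of_neg (mul_self_pos.2 hc) hx

theorem truncF_neg (e : ℝ) (Vs : Mink → ℝ → Mink → Mink) (v x : Mink) (η : ℝ) :
    truncF e Vs v (-x) η = truncF e Vs v x η := by
  simp only [truncF, neg_dot, abs_neg, inv_neg, neg_mul_neg]

theorem truncF_smul (e : ℝ) (Vs : Mink → ℝ → Mink → Mink) (v x : Mink) (η : ℝ) {μ : ℝ}
    (hμ : 0 < μ) : truncF e Vs v (μ • x) η = truncF e Vs v x (η / μ) := by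
  have h1 : ∀ l, (η ≤ |μ * dot x l|) ↔ η / μ ≤ |dot x l| := fun l => by
    rw [abs_mul, abs_of_pos hμ, div_le_iff₀' hμ]
  have h2 : ∀ a b : ℝ, (μ * a)⁻¹ * (μ * b) = a⁻¹ * b := fun a b => by
    rw [mul_inv]; field_simp
  simp only [truncF, smul_dot, h1, h2]

theorem cloudF_neg (e : ℝ) {Vs : Mink → ℝ → Mink → Mink} (hVs : IsProfileFamily Vs) {v : Mink}
    (hv : v ∈ hypPlus) {x : Mink} (hx : x ∈ spacelike) :
    cloudF (cloudW e Vs v) (-x) = cloudF (cloudW e Vs v) x := by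
  have h := tendsto_truncF e hVs hv (neg_mem_spacelike hx)
  rw [show truncF e Vs v (-x) = truncF e Vs v x from funext fun η => truncF_neg e Vs v x η] at h
  exact tendsto_nhds_unique h (tendsto_truncF e hVs hv hx)

/-- The integrand has degree 0 in x, and scaling x by μ only replaces the cutoff η by η/μ, which
tends to 0 as well. -/
theorem cloudF_smul (e : ℝ) {Vs : Mink → ℝ → Mink → Mink} (hVs : IsProfileFamily Vs) {v : Mink}
    (hv : v ∈ hypPlus) {x : Mink} (hx : x ∈ spacelike) {μ : ℝ} (hμ : 0 < μ) :
    cloudF (cloudW e Vs v) (μ • x) = cloudF (cloudW e Vs v) x := by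
  have h := tendsto_truncF e hVs hv (smul_mem_spacelike hx hμ.ne')
  rw [show truncF e Vs v (μ • x) = fun η => truncF e Vs v x (η / μ) from
    funext fun η => truncF_smul e Vs v x η hμ] at h
  refine tendsto_nhds_unique h ((tendsto_truncF e hVs hv hx).comp ?_)
  refine tendsto_nhdsWithin_iff.2 ⟨?_, ?_⟩
  · have : Tendsto (fun η : ℝ => η / μ) (𝓝 0) (𝓝 (0 / μ)) := tendsto_id.div_const μ
    rw [zero_div] at this
    exact this.mono_left nhdsWithin_le_nhds
  · filter_upwards [self_mem_nhdsWithin] with η hη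
    exact div_pos hη hμ

/-- A function with `□F = 2e/x²` is not constant on any open set. -/
theorem not_const_of_box {F : Mink → ℝ} {e : ℝ} (he : e ≠ 0)
    (hbox : ∀ x ∈ spacelike, box F x = 2 * e / dot x x) {U : Set Mink} (hU : IsOpen U)
    (hne : U.Nonempty) (hUs : U ⊆ spacelike) (c : ℝ) : ∃ x ∈ U, F x ≠ c := by
  by_contra! h
  obtain ⟨p, hp⟩ := hne
  have hnz : box F p ≠ 0 := by
    rw [hbox p (hUs hp)]
    exact div_ne_zero (by simpa using he) (ne_of_lt (hUs hp))
  apply hnz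
  have h1 : ∀ a, ∀ y ∈ U, pd a F y = 0 := by
    intro a y hy
    have h2 : F =ᶠ[𝓝 y] fun _ => c := by
      filter_upwards [hU.mem_nhds hy] with z hz using h z hz
    rw [pd, h2.fderiv_eq]
    simp
  rw [box_eq]
  refine Finset.sum_eq_zero fun a _ => ?_
  have h2 : pd a F =ᶠ[𝓝 p] fun _ => 0 := by
    filter_upwards [hU.mem_nhds hp] with z hz using h1 a z hz
  rw [pd, h2.fderiv_eq]
  simp

theorem interior_diff_zero_nonempty {C : Set Mink} (hC : IsSpacelikeCone C) :
    IsOpen (interior C \ {0}) ∧ (interior C \ {0}).Nonempty ∧ interior C \ {0} ⊆ spacelike := by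
  refine ⟨isOpen_interior.sdiff isClosed_singleton, ?_, fun x hx =>
    hC.spacelike x (interior_subset hx.1) hx.2⟩
  exact (dense_compl_singleton (0 : Mink)).inter_open_nonempty _ isOpen_interior hC.solid

theorem exists_potential (e : ℝ) (he : e ≠ 0) (Vs : Mink → ℝ → Mink → Mink)
    (hVs : IsProfileFamily Vs) (v : Mink) (hv : v ∈ hypPlus) : ∃ F : Mink → ℝ,
      (∀ x ∈ spacelike, Tendsto (truncF e Vs v x) (𝓝[>] 0) (𝓝 (F x))) ∧
      (∀ x ∈ spacelike, F (-x) = F x) ∧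
      (∀ x ∈ spacelike, ∀ μ : ℝ, 0 < μ → F (μ • x) = F x) ∧
      ContDiffOn ℝ 2 F spacelike ∧
      (∀ x ∈ spacelike, box F x = 2 * e / dot x x) ∧
      (∀ D : Set Mink, IsSymmetricalSpacelikeCone D →
        ¬ ∃ c : ℝ, ∀ x ∈ D, x ≠ 0 → F x = c) := by
  have hW := sphSmooth_cloudW e hVs hv
  have hbox : ∀ x ∈ spacelike, box (cloudF (cloudW e Vs v)) x = 2 * e / dot x x :=
    fun x hx => box_cloudF hW (sum_hgt_cloudW e hVs hv) hx
  refine ⟨cloudF (cloudW e Vs v), fun x hx => tendsto_truncF e hVs hv hx,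
    fun x hx => cloudF_neg e hVs hv hx, fun x hx μ hμ => cloudF_smul e hVs hv hx hμ,
    (contDiffOn_cloudF hW).of_le (WithTop.coe_le_coe.2 le_top), hbox, ?_⟩
  rintro D ⟨C, hC, rfl⟩ ⟨c, hc⟩
  obtain ⟨hU, hne, hUs⟩ := interior_diff_zero_nonempty hC
  obtain ⟨x, hx, hxc⟩ := not_const_of_box he hbox hU hne hUs c
  exact hxc (hc x (Or.inl (interior_subset hx.1)) hx.2)

/-! ### Test functions with a prescribed tail -/

/-- The properties of the long-range tail of an element of `𝒱`. -/
structure IsTail (U : Mink → Mink) : Prop where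
  smooth : ContDiffOn ℝ ∞ (fun y => U (coneChart y)) {0}ᶜ
  homogeneous : ∀ μ : ℝ, 0 < μ → ∀ l ∈ lightCone, U (μ • l) = μ⁻¹ • U l
  orthogonal : ∀ l ∈ lightCone, dot l (U l) = 0
  closed : ∀ a b c : Fin 4, ∀ l ∈ lightCone,
    coneL a b (fun l' => dot (basisVec c) (U l')) l
      + coneL b c (fun l' => dot (basisVec a) (U l')) l
      + coneL c a (fun l' => dot (basisVec b) (U l')) l = 0

/-- A smooth step from `-1` to `1`. -/
def stepFun (u : ℝ) : ℝ := 2 * Real.smoothTransition ((u + 1) / 2) - 1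

theorem contDiff_stepFun : ContDiff ℝ ∞ stepFun := by
  have h : ContDiff ℝ ∞ fun u : ℝ => Real.smoothTransition ((u + 1) / 2) :=
    Real.smoothTransition.contDiff.comp (by fun_prop)
  exact (contDiff_const.mul h).sub contDiff_const

theorem stepFun_of_one_le {u : ℝ} (h : 1 ≤ u) : stepFun u = 1 := by
  rw [stepFun, Real.smoothTransition.one_of_one_le (by linarith)]
  norm_num

theorem stepFun_of_le_neg_one {u : ℝ} (h : u ≤ -1) : stepFun u = -1 := by
  rw [stepFun, Real.smoothTransition.zero_of_nonpos (by linarith)]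
  norm_num

theorem deriv_stepFun_eq_zero {u : ℝ} (h : 1 < |u|) : deriv stepFun u = 0 := by
  rcases lt_abs.1 h with h | h
  · have : stepFun =ᶠ[𝓝 u] fun _ => 1 := by
      filter_upwards [lt_mem_nhds h] with w hw using stepFun_of_one_le hw.le
    rw [this.deriv_eq, deriv_const]
  · have h' : u < -1 := by linarith
    have : stepFun =ᶠ[𝓝 u] fun _ => -1 := by
      filter_upwards [gt_mem_nhds h'] with w hw using stepFun_of_le_neg_one hw.le
    rw [this.deriv_eq, deriv_const]

/-- An element of `𝒱` with tail `U`. -/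
def tailV (U : Mink → Mink) (s : ℝ) (l : Mink) : Mink := (stepFun (s / l 0) / 2) • U l

@[simp] theorem coneChart_zero (y : Space) : coneChart y 0 = ‖y‖ := rfl

@[simp] theorem spatial_coneChart (y : Space) : spatial (coneChart y) = y := by
  ext i; simp [coneChart]

theorem spatial_ne_zero {l : Mink} (hl : l ∈ lightCone) : spatial l ≠ 0 := by
  intro h
  obtain ⟨h1, h2⟩ := hl
  rw [dot_self_eq, h] at h1
  simp at h1
  linarith

theorem coneChart_spatial {l : Mink} (hl : l ∈ lightCone) : coneChart (spatial l) = l := by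
  obtain ⟨h1, h2⟩ := hl
  rw [dot_self_eq] at h1
  have h3 : ‖spatial l‖ = l 0 := by
    have : ‖spatial l‖ ^ 2 = l 0 ^ 2 := by linarith
    exact (pow_left_inj₀ (norm_nonneg _) h2.le two_ne_zero).1 this
  ext a
  refine Fin.cases ?_ (fun i => ?_) a
  · simpa using h3
  · simp [coneChart]

theorem coneChart_smul {μ : ℝ} (hμ : 0 < μ) (y : Space) : coneChart (μ • y) = μ • coneChart y := by
  ext a
  refine Fin.cases ?_ (fun i => ?_) a
  · simp [norm_smul, abs_of_pos hμ]
  · simp [coneChart]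

theorem coneL_congr {E : Type*} [NormedAddCommGroup E] [NormedSpace ℝ E] {f g : Mink → E}
    (h : ∀ l ∈ lightCone, f l = g l) (a b : Fin 4) {l : Mink} (hl : l ∈ lightCone) :
    coneL a b f l = coneL a b g l := by
  have : (fun y => f (coneChart y)) =ᶠ[𝓝 (spatial l)] fun y => g (coneChart y) := by
    filter_upwards [isOpen_compl_singleton.mem_nhds (spatial_ne_zero hl)] with y hy
    exact h _ (coneChart_mem hy)
  rw [coneL, coneL, this.fderiv_eq]

theorem isOpen_snd_ne_zero : IsOpen {p : ℝ × Space | p.2 ≠ 0} :=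
  isOpen_ne_fun continuous_snd continuous_const

/-- Smooth functions of `(s, y)` of homogeneity `-2` which vanish for `|s| > |y|`. -/
structure IsFalloff (q : ℝ → Space → ℝ) : Prop where
  smooth : ContDiffOn ℝ ∞ (fun p : ℝ × Space => q p.1 p.2) {p | p.2 ≠ 0}
  homogeneous : ∀ μ : ℝ, 0 < μ → ∀ s y, y ≠ 0 → q (μ * s) (μ • y) = (μ ^ 2)⁻¹ * q s y
  vanish : ∀ s y, y ≠ 0 → ‖y‖ < |s| → q s y = 0

/-- The tangent vector of the cone defining `L_ab`, in the chart. -/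
def chartVec (a b : Fin 4) (y : Space) : Space :=
  spatial (dot (basisVec a) (coneChart y) • basisVec b - dot (basisVec b) (coneChart y) • basisVec a)

theorem contDiff_spatial : ContDiff ℝ ∞ spatial := by
  unfold spatial
  fun_prop

theorem contDiffOn_chartVec (a b : Fin 4) : ContDiffOn ℝ ∞ (chartVec a b) {0}ᶜ := by
  refine contDiff_spatial.comp_contDiffOn ?_
  exact (((contDiff_dot_right _).comp_contDiffOn contDiffOn_coneChart).smul contDiffOn_const).sub
    (((contDiff_dot_right _).comp_contDiffOn contDiffOn_coneChart).smul contDiffOn_const)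

theorem dot_smul (c : ℝ) (x y : Mink) : dot x (c • y) = c * dot x y := by
  rw [dot_comm, smul_dot, dot_comm]

theorem chartVec_smul (a b : Fin 4) {μ : ℝ} (hμ : 0 < μ) (y : Space) :
    chartVec a b (μ • y) = μ • chartVec a b y := by
  ext i
  simp only [chartVec, coneChart_smul hμ, dot_smul, spatial_apply, PiLp.smul_apply, Pi.sub_apply,
    Pi.smul_apply, smul_eq_mul]
  ring

theorem IsFalloff.differentiableAt {q : ℝ → Space → ℝ} (hq : IsFalloff q) (s : ℝ) {y : Space}
    (hy : y ≠ 0) : DifferentiableAt ℝ (fun p : ℝ × Space => q p.1 p.2) (s, y) :=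
  (hq.smooth.contDiffAt (isOpen_snd_ne_zero.mem_nhds hy)).differentiableAt (by simp)

theorem IsFalloff.hasFDerivAt {q : ℝ → Space → ℝ} (hq : IsFalloff q) (s : ℝ) {y : Space}
    (hy : y ≠ 0) : HasFDerivAt (q s) ((fderiv ℝ (fun p : ℝ × Space => q p.1 p.2) (s, y)).comp
      (ContinuousLinearMap.inr ℝ ℝ Space)) y :=
  (hq.differentiableAt s hy).hasFDerivAt.comp y (hasFDerivAt_prodMk_right s y)

/-- Differentiation in y lowers the degree by one, and the tangent field of L_ab, homogeneous of
degree 1, restores it. The class is thus stable under all iterates of L_ab. -/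
theorem IsFalloff.deriv {q : ℝ → Space → ℝ} (hq : IsFalloff q) (a b : Fin 4) :
    IsFalloff fun s y => fderiv ℝ (q s) y (chartVec a b y) := by
  refine ⟨?_, ?_, ?_⟩
  · have h1 : ContDiffOn ℝ ∞ (fun p : ℝ × Space => fderiv ℝ (fun p : ℝ × Space => q p.1 p.2) p
        (0, chartVec a b p.2)) {p | p.2 ≠ 0} := by
      refine (hq.smooth.fderiv_of_isOpen isOpen_snd_ne_zero (by simp)).clm_apply ?_
      exact contDiffOn_const.prodMk
        ((contDiffOn_chartVec a b).comp contDiffOn_snd fun p hp => hp)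
    refine h1.congr fun p hp => ?_
    rw [(hq.hasFDerivAt p.1 hp).fderiv]
    rfl
  · intro μ hμ s y hy
    have hy' : μ • y ≠ 0 := smul_ne_zero hμ.ne' hy
    have h1 : HasFDerivAt (fun y => q (μ * s) (μ • y))
        ((fderiv ℝ (q (μ * s)) (μ • y)).comp (μ • ContinuousLinearMap.id ℝ Space)) y :=
      (hq.hasFDerivAt (μ * s) hy').differentiableAt.hasFDerivAt.comp y
        ((hasFDerivAt_id y).const_smul μ)
    have h2 : HasFDerivAt (fun y => q (μ * s) (μ • y)) ((μ ^ 2)⁻¹ • fderiv ℝ (q s) y) y := by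
      refine ((hq.hasFDerivAt s hy).differentiableAt.hasFDerivAt.const_mul _).congr_of_eventuallyEq ?_
      filter_upwards [isOpen_compl_singleton.mem_nhds hy] with z hz
      exact hq.homogeneous μ hμ s z hz
    have h3 := congrArg (fun L : Space →L[ℝ] ℝ => L (chartVec a b y)) (h1.unique h2)
    simpa [chartVec_smul a b hμ] using h3
  · intro s y hy hs
    have h1 : q s =ᶠ[𝓝 y] fun _ => 0 := by
      filter_upwards [isOpen_compl_singleton.mem_nhds hy,
        continuous_norm.continuousAt.eventually_lt continuousAt_const hs] with z hz hz'
      exact hq.vanish s z hz hz'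
    rw [h1.fderiv_eq]
    simp

/-- Homogeneity reduces the estimate to |s| ≤ 1, ‖y‖ = 1, a compact set; beyond |s| = ‖y‖ the
function vanishes. -/
theorem IsFalloff.bound {q : ℝ → Space → ℝ} (hq : IsFalloff q) :
    ∃ C, 0 ≤ C ∧ ∀ s y, y ≠ 0 → |q s y| ≤ C / ‖y‖ ^ 2 := by
  have hK : IsCompact (Icc (-1 : ℝ) 1 ×ˢ sphere (0 : Space) 1) :=
    isCompact_Icc.prod (isCompact_sphere _ _)
  have hc : ContinuousOn (fun p : ℝ × Space => q p.1 p.2) (Icc (-1 : ℝ) 1 ×ˢ sphere (0 : Space) 1) :=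
    hq.smooth.continuousOn.mono fun p hp h => by
      have := hp.2
      rw [h] at this
      simp at this
  obtain ⟨C, hC⟩ := hK.exists_bound_of_continuousOn hc
  refine ⟨|C|, abs_nonneg _, fun s y hy => ?_⟩
  have hpos := norm_pos_iff.2 hy
  rcases le_or_gt |s| ‖y‖ with h | h
  · have h1 := hq.homogeneous ‖y‖ hpos (s / ‖y‖) (‖y‖⁻¹ • y) (smul_ne_zero (by positivity) hy)
    rw [mul_div_cancel₀ _ hpos.ne', smul_inv_smul₀ hpos.ne'] at h1
    have h2 := hC (s / ‖y‖, ‖y‖⁻¹ • y) ⟨?_, ?_⟩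
    · rw [h1, abs_mul, abs_of_pos (by positivity), inv_mul_eq_div]
      exact div_le_div_of_nonneg_right (h2.trans (le_abs_self C)) (by positivity)
    · rw [mem_Icc, ← abs_le, abs_div, abs_norm]
      exact (div_le_one hpos).2 h
    · simp [norm_smul, hpos.ne']
  · rw [hq.vanish s y hy h]
    simp
    positivity

theorem hasDerivAt_tailV (U : Mink → Mink) (s : ℝ) (l : Mink) (a : Fin 4) :
    HasDerivAt (fun s' => tailV U s' l a) (deriv stepFun (s / l 0) / l 0 / 2 * U l a) s := by
  have h1 : HasDerivAt stepFun (deriv stepFun (s / l 0)) (s / l 0) :=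
    (contDiff_stepFun.differentiable (by simp) _).hasDerivAt
  have h2 := ((h1.comp s ((hasDerivAt_id s).div_const (l 0))).div_const 2).mul_const (U l a)
  refine h2.congr_deriv ?_
  ring

/-- The step is constant outside [-1, 1], which gives the vanishing; degree -1 of the tail and the
factor 1/‖y‖ of the chain rule give degree -2. -/
theorem isFalloff_deriv_tailV {U : Mink → Mink} (hU : IsTail U) (a : Fin 4) :
    IsFalloff fun s y => deriv stepFun (s / ‖y‖) / ‖y‖ / 2 * U (coneChart y) a := by
  have hn : ContDiffOn ℝ ∞ (fun p : ℝ × Space => ‖p.2‖) {p | p.2 ≠ 0} :=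
    contDiffOn_snd.norm ℝ fun p hp => hp
  have hd : ContDiff ℝ ∞ (deriv stepFun) := (contDiff_infty_iff_deriv.1 contDiff_stepFun).2
  refine ⟨?_, ?_, ?_⟩
  · refine ContDiffOn.mul ?_ ((contDiffOn_pi.1 hU.smooth a).comp contDiffOn_snd fun p hp => hp)
    have h1 : ContDiffOn ℝ ∞ (fun p : ℝ × Space => deriv stepFun (p.1 / ‖p.2‖)) {p | p.2 ≠ 0} :=
      hd.comp_contDiffOn (contDiffOn_fst.div hn fun p hp => norm_ne_zero_iff.2 hp)
    exact (h1.div hn fun p hp => norm_ne_zero_iff.2 hp).div_const 2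
  · intro μ hμ s y hy
    rw [coneChart_smul hμ, hU.homogeneous μ hμ _ (coneChart_mem hy), norm_smul,
      Real.norm_of_nonneg hμ.le, mul_div_mul_left _ _ hμ.ne']
    simp only [Pi.smul_apply, smul_eq_mul]
    have := norm_pos_iff.2 hy
    field_simp
  · intro s y hy hs
    rw [deriv_stepFun_eq_zero]
    · simp
    · rw [abs_div, abs_norm]
      exact (one_lt_div (norm_pos_iff.2 hy)).2 hs

theorem exists_isFalloff_coneLIter {f : ℝ → Mink → ℝ} {q : ℝ → Space → ℝ} (hq : IsFalloff q)
    (h : ∀ s y, y ≠ 0 → f s (coneChart y) = q s y) (I : List (Fin 4 × Fin 4)) :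
    ∃ q' : ℝ → Space → ℝ, IsFalloff q' ∧
      ∀ s y, y ≠ 0 → coneLIter I (f s) (coneChart y) = q' s y := by
  induction I with
  | nil => exact ⟨q, hq, h⟩
  | cons bc I ih =>
    obtain ⟨q', hq', h'⟩ := ih
    refine ⟨_, hq'.deriv bc.1 bc.2, fun s y hy => ?_⟩
    change coneL bc.1 bc.2 (coneLIter I (f s)) (coneChart y) = _
    have h1 : (fun y => coneLIter I (f s) (coneChart y)) =ᶠ[𝓝 y] q' s := by
      filter_upwards [isOpen_compl_singleton.mem_nhds hy] with z hz using h' s z hz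
    rw [coneL, spatial_coneChart, h1.fderiv_eq]
    rfl

theorem tendsto_tailV_atTop (U : Mink → Mink) {l : Mink} (hl : l ∈ lightCone) :
    Tendsto (fun s => tailV U s l) atTop (𝓝 ((1 / 2 : ℝ) • U l)) := by
  refine tendsto_const_nhds.congr' ?_
  filter_upwards [eventually_ge_atTop (l 0)] with s hs
  rw [tailV, stepFun_of_one_le ((one_le_div hl.2).2 hs)]

theorem tendsto_tailV_atBot (U : Mink → Mink) {l : Mink} (hl : l ∈ lightCone) :
    Tendsto (fun s => tailV U s l) atBot (𝓝 (-((1 / 2 : ℝ) • U l))) := by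
  refine tendsto_const_nhds.congr' ?_
  filter_upwards [eventually_le_atBot (-(l 0))] with s hs
  rw [tailV, stepFun_of_le_neg_one ((div_le_iff₀ hl.2).2 (by linarith)), ← neg_smul]
  norm_num

theorem tail_tailV (U : Mink → Mink) {l : Mink} (hl : l ∈ lightCone) : tail (tailV U) l = U l := by
  rw [tail, (tendsto_tailV_atTop U hl).limUnder_eq, smul_smul]
  norm_num

theorem memV_tailV {U : Mink → Mink} (hU : IsTail U) : MemV (tailV U) := by
  -- The fall-off exponent 1 is a convenience: the s-derivative vanishes for |s| > l⁰, so the decay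
  -- is arbitrarily fast.
  refine ⟨1, one_pos, ?_, ?_, ?_, ?_, ?_, ?_, ?_⟩
  · have hn : ContDiffOn ℝ ∞ (fun p : ℝ × Space => ‖p.2‖) {p | p.2 ≠ 0} :=
      contDiffOn_snd.norm ℝ fun p hp => hp
    have h1 : ContDiffOn ℝ ∞ (fun p : ℝ × Space => stepFun (p.1 / ‖p.2‖)) {p | p.2 ≠ 0} :=
      contDiff_stepFun.comp_contDiffOn (contDiffOn_fst.div hn fun p hp => norm_ne_zero_iff.2 hp)
    exact (h1.div_const 2).smul (hU.smooth.comp contDiffOn_snd fun p hp => hp)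
  · intro μ hμ s l hl
    rw [tailV, tailV, hU.homogeneous μ hμ l hl, Pi.smul_apply, smul_eq_mul,
      mul_div_mul_left _ _ hμ.ne', smul_comm]
  · intro s l hl
    rw [tailV, dot_smul, hU.orthogonal l hl, mul_zero]
  · intro I a
    obtain ⟨q, hq, h⟩ := exists_isFalloff_coneLIter
      (f := fun s l' => deriv (fun s' => tailV U s' l' a) s) (isFalloff_deriv_tailV hU a)
      (fun s y _ => (hasDerivAt_tailV U s (coneChart y) a).deriv) I
    obtain ⟨C, hC0, hC⟩ := hq.bound
    -- For |s| ≤ l⁰ the weight (1 + |s|/l⁰)² is at most 4.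
    refine ⟨C * 4, fun s l hl => ?_⟩
    have hl0 := hl.2
    have hy := spatial_ne_zero hl
    have hnorm : ‖spatial l‖ = l 0 := by
      have := congrFun (coneChart_spatial hl) 0
      simpa using this
    have h1 := h s _ hy
    rw [coneChart_spatial hl] at h1
    rw [h1]
    have hb : 0 < 1 + |s| / l 0 := by positivity
    rcases le_or_gt |s| (l 0) with hs | hs
    · refine (hC s _ hy).trans ?_
      rw [hnorm, div_le_div_iff₀ (by positivity) (by positivity)]
      have h2 : (1 + |s| / l 0) ^ ((1 : ℝ) + 1) ≤ 4 := by
        have h3 : |s| / l 0 ≤ 1 := (div_le_one hl0).2 hs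
        have h4 : (1 + |s| / l 0) ^ ((1 : ℝ) + 1) = (1 + |s| / l 0) ^ 2 := by
          rw [show (1 : ℝ) + 1 = ((2 : ℕ) : ℝ) by norm_num, Real.rpow_natCast]
        rw [h4]
        nlinarith [abs_nonneg s, div_nonneg (abs_nonneg s) hl0.le]
      calc C * (l 0 ^ 2 * (1 + |s| / l 0) ^ ((1 : ℝ) + 1)) ≤ C * (l 0 ^ 2 * 4) := by gcongr
        _ = _ := by ring
    · rw [hq.vanish s _ hy (by rwa [hnorm])]
      simp only [abs_zero]
      positivity
  · intro l hl
    rw [tail_tailV U hl]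
    exact tendsto_tailV_atTop U hl
  · intro l hl
    rw [tail_tailV U hl]
    exact tendsto_tailV_atBot U hl
  · intro a b c l hl
    have h : ∀ d : Fin 4, ∀ l ∈ lightCone,
        dot (basisVec d) (tail (tailV U) l) = dot (basisVec d) (U l) := fun d l hl => by
      rw [tail_tailV U hl]
    rw [coneL_congr (h c) a b hl, coneL_congr (h a) b c hl, coneL_congr (h b) c a hl]
    exact hU.closed a b c l hl

/-! ### Weighted integrals over the hyperbolic angle θ -/

/-- The integral is the value at 0 of the convolution of the constant 1 with the reflected
integrand, so smoothness of convolutions with a parameter applies. -/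
theorem contDiffOn_param_integral {g : Mink → ℝ → ℝ} {s : Set Mink} {k : Set ℝ} (hs : IsOpen s)
    (hk : IsCompact k) (hgs : ∀ p, ∀ θ, p ∈ s → θ ∉ k → g p θ = 0)
    (hg : ContDiffOn ℝ ∞ (fun q : Mink × ℝ => g q.1 q.2) (s ×ˢ univ)) :
    ContDiffOn ℝ ∞ (fun p => ∫ θ, g p θ) s := by
  have h := contDiffOn_convolution_right_with_param_comp (n := ⊤) (μ := (volume : Measure ℝ))
    (ContinuousLinearMap.mul ℝ ℝ) (v := fun _ : Mink => (0 : ℝ)) (f := fun _ => (1 : ℝ))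
    (g := fun p θ => g p (-θ)) (k := -k) contDiffOn_const hs hk.neg
    (fun p θ hp hθ => hgs p (-θ) hp (by simpa using hθ)) (locallyIntegrable_const 1) ?_
  · refine h.congr fun p hp => ?_
    simp [convolution_def]
  · exact hg.comp (f := fun q : Mink × ℝ => (q.1, -q.2)) (by fun_prop) fun q hq => ⟨hq.1, mem_univ _⟩

theorem hasFDerivAt_param_integral {g : Mink → ℝ → ℝ} {s : Set Mink} {k : Set ℝ} (hs : IsOpen s)
    (hk : IsCompact k) (hgs : ∀ p, ∀ θ, p ∈ s → θ ∉ k → g p θ = 0)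
    (hg : ContDiffOn ℝ ∞ (fun q : Mink × ℝ => g q.1 q.2) (s ×ˢ univ)) {p : Mink} (hp : p ∈ s) :
    Integrable (fun θ => fderiv ℝ (fun p => g p θ) p) ∧
    HasFDerivAt (fun p => ∫ θ, g p θ) (∫ θ, fderiv ℝ (fun p => g p θ) p) p := by
  have hopen : IsOpen (s ×ˢ (univ : Set ℝ)) := hs.prod isOpen_univ
  have hder : ∀ x ∈ s, ∀ θ, HasFDerivAt (fun p => g p θ)
      ((fderiv ℝ (fun q : Mink × ℝ => g q.1 q.2) (x, θ)).comp
        (ContinuousLinearMap.inl ℝ Mink ℝ)) x := by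
    intro x hx θ
    have h1 : DifferentiableAt ℝ (fun q : Mink × ℝ => g q.1 q.2) (x, θ) :=
      (hg.contDiffAt (hopen.mem_nhds ⟨hx, mem_univ _⟩)).differentiableAt (by simp)
    exact HasFDerivAt.comp (g := fun q : Mink × ℝ => g q.1 q.2) x h1.hasFDerivAt
      (hasFDerivAt_prodMk_left (𝕜 := ℝ) x θ)
  have hcont : ContinuousOn (fun q : Mink × ℝ => fderiv ℝ (fun p => g p q.2) q.1) (s ×ˢ univ) := by
    have h1 : ContinuousOn (fun q : Mink × ℝ => (fderiv ℝ (fun q : Mink × ℝ => g q.1 q.2) q).comp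
        (ContinuousLinearMap.inl ℝ Mink ℝ)) (s ×ˢ univ) :=
      (hg.continuousOn_fderiv_of_isOpen hopen (by simp)).clm_comp continuousOn_const
    exact h1.congr fun q hq => (hder q.1 hq.1 q.2).fderiv
  have hzero : ∀ x ∈ s, ∀ θ ∉ k, fderiv ℝ (fun p => g p θ) x = 0 := by
    intro x hx θ hθ
    have : (fun p => g p θ) =ᶠ[𝓝 x] fun _ => 0 := by
      filter_upwards [hs.mem_nhds hx] with y hy using hgs y θ hy hθ
    rw [this.fderiv_eq]
    simp
  have hcont1 : ∀ x ∈ s, Continuous (g x) := fun x hx =>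
    continuousOn_univ.1 (hg.continuousOn.comp (f := fun θ : ℝ => (x, θ)) (by fun_prop)
      fun θ _ => ⟨hx, mem_univ _⟩)
  have hcont2 : ∀ x ∈ s, Continuous fun θ => fderiv ℝ (fun p => g p θ) x := fun x hx =>
    continuousOn_univ.1 (hcont.comp (f := fun θ : ℝ => (x, θ)) (by fun_prop)
      fun θ _ => ⟨hx, mem_univ _⟩)
  obtain ⟨δ, hδ, hball⟩ := Metric.nhds_basis_closedBall.mem_iff.1 (hs.mem_nhds hp)
  obtain ⟨C, hC⟩ := ((isCompact_closedBall p δ).prod hk).exists_bound_of_continuousOn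
    (hcont.mono fun q hq => ⟨hball hq.1, mem_univ _⟩)
  have hcs1 : HasCompactSupport fun θ => fderiv ℝ (fun p => g p θ) p :=
    HasCompactSupport.intro hk fun θ hθ => hzero p hp θ hθ
  refine ⟨(hcont2 p hp).integrable_of_hasCompactSupport hcs1, ?_⟩
  refine hasFDerivAt_integral_of_dominated_of_fderiv_le (s := ball p δ) (F := g)
    (F' := fun x θ => fderiv ℝ (fun p => g p θ) x) (bound := k.indicator fun _ => C) (ball_mem_nhds p hδ) ?_ ?_ ?_ ?_ ?_ ?_
  · filter_upwards [hs.mem_nhds hp] with x hx using (hcont1 x hx).aestronglyMeasurable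
  · exact (hcont1 p hp).integrable_of_hasCompactSupport
      (HasCompactSupport.intro hk fun θ hθ => hgs p θ hp hθ)
  · exact (hcont2 p hp).aestronglyMeasurable
  · refine Eventually.of_forall fun θ x hx => ?_
    by_cases hθ : θ ∈ k
    · rw [indicator_of_mem hθ]
      exact hC (x, θ) ⟨ball_subset_closedBall hx, hθ⟩
    · rw [indicator_of_notMem hθ, hzero x (hball (ball_subset_closedBall hx)) θ hθ, norm_zero]
  · exact (integrable_indicator_iff hk.measurableSet).2
      (integrableOn_const hk.measure_lt_top.ne)
  · refine Eventually.of_forall fun θ x hx => ?_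
    exact (hder x (hball (ball_subset_closedBall hx)) θ).differentiableAt.hasFDerivAt

/-- The weights in `z = (sinh θ, cosh θ n)`. -/
def wt (θ : ℝ) (a : Fin 4) : ℝ := Fin.cases (Real.sinh θ) (fun _ => Real.cosh θ) a

@[simp] theorem wt_zero (θ : ℝ) : wt θ 0 = Real.sinh θ := rfl

@[simp] theorem wt_succ (θ : ℝ) (i : Fin 3) : wt θ i.succ = Real.cosh θ := rfl

theorem contDiff_wt (a : Fin 4) : ContDiff ℝ ∞ fun θ => wt θ a := by
  refine Fin.cases ?_ (fun i => ?_) a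
  · exact Real.contDiff_sinh
  · exact Real.contDiff_cosh

/-- The vector with `hgt (wtVec θ l) n = z · l` for `z = (sinh θ, cosh θ n)`. -/
def wtVec (θ : ℝ) (l : Mink) : Mink := fun a => wt θ a * l a

theorem contDiff_wtVec : ContDiff ℝ ∞ fun q : Mink × ℝ => wtVec q.2 q.1 := by
  refine contDiff_pi.2 fun a => ?_
  exact ((contDiff_wt a).comp contDiff_snd).mul (by fun_prop)

/-- The vectors `l` with `wtVec θ l` spacelike for all `|θ| ≤ R`. -/
def wtDom (R : ℝ) : Set Mink :=
  {l | Real.sinh R ^ 2 * l 0 ^ 2 < Real.cosh R ^ 2 * ‖spatial l‖ ^ 2}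

theorem isOpen_wtDom (R : ℝ) : IsOpen (wtDom R) := by
  have := continuous_spatial
  exact isOpen_lt (by fun_prop) (by fun_prop)

theorem norm_spatial_of_mem {l : Mink} (hl : l ∈ lightCone) : ‖spatial l‖ = l 0 := by
  have := congrFun (coneChart_spatial hl) 0
  simpa using this

/-- On the cone l⁰ equals the spatial norm, and cosh² - sinh² = 1 gives a strict inequality. The
tail is therefore defined on an open neighbourhood of the cone and can be differentiated in ambient
coordinates. -/
theorem lightCone_subset_wtDom (R : ℝ) : lightCone ⊆ wtDom R := by
  intro l hl
  change Real.sinh R ^ 2 * l 0 ^ 2 < Real.cosh R ^ 2 * ‖spatial l‖ ^ 2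
  rw [norm_spatial_of_mem hl, Real.cosh_sq]
  have := pow_pos hl.2 2
  nlinarith

theorem dot_self_wtVec (θ : ℝ) (l : Mink) : dot (wtVec θ l) (wtVec θ l)
    = Real.sinh θ ^ 2 * l 0 ^ 2 - Real.cosh θ ^ 2 * ‖spatial l‖ ^ 2 := by
  rw [EuclideanSpace.real_norm_sq_eq, Finset.mul_sum]
  simp only [dot, wtVec, wt_zero, wt_succ, spatial_apply]
  congr 1
  · ring
  · exact Finset.sum_congr rfl fun i _ => by ring

theorem wtVec_mem_of_mem {R θ : ℝ} (hθ : |θ| ≤ R) {l : Mink} (hl : l ∈ wtDom R) :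
    wtVec θ l ∈ spacelike := by
  change dot _ _ < 0
  have h : Real.sinh R ^ 2 * l 0 ^ 2 < Real.cosh R ^ 2 * ‖spatial l‖ ^ 2 := hl
  have h1 : Real.sinh θ ^ 2 ≤ Real.sinh R ^ 2 := by
    rw [← sq_abs, Real.abs_sinh]
    exact pow_le_pow_left₀ (Real.sinh_nonneg_iff.2 (abs_nonneg _)) (Real.sinh_le_sinh.2 hθ) 2
  rw [dot_self_wtVec]
  rw [Real.cosh_sq] at h ⊢
  set S := Real.sinh R ^ 2
  set t := Real.sinh θ ^ 2 with ht
  have ht0 : 0 ≤ t := sq_nonneg _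
  have hS0 : 0 ≤ S := sq_nonneg _
  have hn := sq_nonneg ‖spatial l‖
  have h2 := sq_nonneg (l 0)
  rcases hS0.eq_or_lt with hS | hS
  · have : t = 0 := by linarith
    rw [← hS] at h
    rw [this]
    linarith
  -- Monotonicity of tanh² in polynomial form: the condition at R, multiplied by t, controls the
  -- condition at θ, multiplied by S, because t ≤ S.
  · have h3 : S * (t * l 0 ^ 2 - (t + 1) * ‖spatial l‖ ^ 2)
        = t * (S * l 0 ^ 2 - (S + 1) * ‖spatial l‖ ^ 2) - (S - t) * ‖spatial l‖ ^ 2 := by ring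
    by_contra! h4
    rcases ht0.eq_or_lt with ht' | ht'
    · rw [← ht'] at h4
      nlinarith
    · have : t * (S * l 0 ^ 2 - (S + 1) * ‖spatial l‖ ^ 2) < 0 :=
        mul_neg_of_pos_of_neg ht' (by linarith)
      have h6 : 0 ≤ S * (t * l 0 ^ 2 - (t + 1) * ‖spatial l‖ ^ 2) := mul_nonneg hS.le h4
      have h5 : 0 ≤ (S - t) * ‖spatial l‖ ^ 2 := mul_nonneg (by linarith) hn
      linarith

theorem wtVec_mem (θ : ℝ) {l : Mink} (hl : l ∈ lightCone) : wtVec θ l ∈ spacelike :=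
  wtVec_mem_of_mem (R := |θ|) le_rfl (lightCone_subset_wtDom _ hl)

/-- Smooth weights supported in `[-R, R]`, vanishing near the end points. -/
structure IsWeight (R : ℝ) (c : ℝ → ℝ) : Prop where
  smooth : ContDiff ℝ ∞ c
  support : tsupport c ⊆ Ioo (-R) R

theorem IsWeight.mul_wt {R : ℝ} {c : ℝ → ℝ} (hc : IsWeight R c) (a : Fin 4) :
    IsWeight R fun θ => c θ * wt θ a :=
  ⟨hc.smooth.mul (contDiff_wt a), tsupport_mul_subset_left.trans hc.support⟩

theorem IsWeight.eq_zero {R : ℝ} {c : ℝ → ℝ} (hc : IsWeight R c) {θ : ℝ} (hθ : θ ∉ Icc (-R) R) :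
    c θ = 0 :=
  image_eq_zero_of_notMem_tsupport fun h => hθ (Ioo_subset_Icc_self (hc.support h))

theorem IsWeight.hasCompactSupport {R : ℝ} {c : ℝ → ℝ} (hc : IsWeight R c) : HasCompactSupport c :=
  HasCompactSupport.intro isCompact_Icc fun _ h => hc.eq_zero h

/-- `l ↦ ∫ c(θ) G(wtVec θ l) dθ`. -/
def wtInt (c : ℝ → ℝ) (G : Mink → ℝ) (l : Mink) : ℝ := ∫ θ, c θ * G (wtVec θ l)

/-- G is controlled only on spacelike vectors, which θ may leave. Away from the closed support of c
the product is locally zero, and on that support |θ| < R keeps the argument spacelike. -/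
theorem contDiffOn_wtInt_aux {R : ℝ} {c : ℝ → ℝ} (hc : IsWeight R c) {G : Mink → ℝ}
    (hG : ContDiffOn ℝ ∞ G spacelike) :
    ContDiffOn ℝ ∞ (fun q : Mink × ℝ => c q.2 * G (wtVec q.2 q.1)) (wtDom R ×ˢ univ) := by
  intro q hq
  by_cases h : q.2 ∈ tsupport c
  · have h1 : wtVec q.2 q.1 ∈ spacelike :=
      wtVec_mem_of_mem (abs_le.2 (Ioo_subset_Icc_self (hc.support h))) hq.1
    exact ((hc.smooth.comp contDiff_snd).contDiffAt.mul
      ((hG.contDiffAt (spacelike_mem_nhds h1)).comp q contDiff_wtVec.contDiffAt)).contDiffWithinAt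
  · refine ContDiffAt.contDiffWithinAt ?_
    refine contDiffAt_const (c := (0 : ℝ)) |>.congr_of_eventuallyEq ?_
    have h1 : ∀ᶠ q' : Mink × ℝ in 𝓝 q, q'.2 ∉ tsupport c :=
      continuous_snd.continuousAt.eventually
        ((isClosed_tsupport c).isOpen_compl.mem_nhds h)
    filter_upwards [h1] with q' hq'
    rw [image_eq_zero_of_notMem_tsupport hq', zero_mul]

theorem contDiffOn_wtInt {R : ℝ} {c : ℝ → ℝ} (hc : IsWeight R c) {G : Mink → ℝ}
    (hG : ContDiffOn ℝ ∞ G spacelike) : ContDiffOn ℝ ∞ (wtInt c G) (wtDom R) :=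
  contDiffOn_param_integral (g := fun l θ => c θ * G (wtVec θ l)) (isOpen_wtDom R) isCompact_Icc
    (fun l θ _ hθ => by rw [hc.eq_zero hθ, zero_mul]) (contDiffOn_wtInt_aux hc hG)

theorem wtVec_basisVec (θ : ℝ) (b : Fin 4) : wtVec θ (basisVec b) = wt θ b • basisVec b := by
  ext a
  by_cases h : a = b
  · subst h; simp [wtVec, basisVec]
  · simp [wtVec, basisVec, h]

theorem hasFDerivAt_wtVec (θ : ℝ) (l : Mink) :
    HasFDerivAt (wtVec θ) (ContinuousLinearMap.pi fun a => wt θ a • coord a) l := by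
  refine hasFDerivAt_pi.2 fun a => ?_
  exact (coord a).hasFDerivAt.const_mul (wt θ a)

theorem pd_wtInt {R : ℝ} {c : ℝ → ℝ} (hc : IsWeight R c) {G : Mink → ℝ}
    (hG : ContDiffOn ℝ ∞ G spacelike) (b : Fin 4) {l : Mink} (hl : l ∈ wtDom R) :
    pd b (wtInt c G) l = wtInt (fun θ => c θ * wt θ b) (pd b G) l := by
  obtain ⟨h1, h2⟩ := hasFDerivAt_param_integral (g := fun l θ => c θ * G (wtVec θ l))
    (isOpen_wtDom R) isCompact_Icc (fun l θ _ hθ => by rw [hc.eq_zero hθ, zero_mul])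
    (contDiffOn_wtInt_aux hc hG) hl
  rw [pd, show wtInt c G = fun l => ∫ θ, c θ * G (wtVec θ l) from rfl, h2.fderiv,
    ContinuousLinearMap.integral_apply h1, wtInt]
  refine integral_congr_ae (Eventually.of_forall fun θ => ?_)
  simp only
  by_cases hθ : θ ∈ Icc (-R) R
  · have hsp := wtVec_mem_of_mem (abs_le.2 hθ) hl
    have h3 := ((differentiableAt_of_contDiffOn hG hsp).hasFDerivAt.comp l
      (hasFDerivAt_wtVec θ l)).const_mul (c θ)
    have h3' : fderiv ℝ (fun p => c θ * G (wtVec θ p)) l = _ := h3.fderiv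
    have h4 : (ContinuousLinearMap.pi fun a => wt θ a • coord a : Mink →L[ℝ] Mink) (basisVec b)
        = wt θ b • basisVec b := wtVec_basisVec θ b
    rw [h3', smul_apply, ContinuousLinearMap.comp_apply, h4, map_smul, pd]
    simp only [smul_eq_mul]
    ring
  · have h3 : (fun p => c θ * G (wtVec θ p)) = fun _ => 0 := by
      funext p; rw [hc.eq_zero hθ, zero_mul]
    rw [h3, hc.eq_zero hθ]
    simp

theorem continuous_wtInt_integrand {R : ℝ} {c : ℝ → ℝ} (hc : IsWeight R c) {G : Mink → ℝ}
    (hG : ContDiffOn ℝ ∞ G spacelike) {l : Mink} (hl : l ∈ wtDom R) :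
    Continuous fun θ => c θ * G (wtVec θ l) :=
  continuousOn_univ.1 ((contDiffOn_wtInt_aux hc hG).continuousOn.comp (f := fun θ : ℝ => (l, θ))
    (by fun_prop) fun θ _ => ⟨hl, mem_univ _⟩)

theorem integrable_wtInt_integrand {R : ℝ} {c : ℝ → ℝ} (hc : IsWeight R c) {G : Mink → ℝ}
    (hG : ContDiffOn ℝ ∞ G spacelike) {l : Mink} (hl : l ∈ wtDom R) :
    Integrable fun θ => c θ * G (wtVec θ l) :=
  (continuous_wtInt_integrand hc hG hl).integrable_of_hasCompactSupport
    (HasCompactSupport.intro isCompact_Icc fun θ hθ => by rw [hc.eq_zero hθ, zero_mul])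

/-! ### Homogeneity and contraction of principal values; L_ab in ambient coordinates -/

theorem pvInt_smul (H : Space → ℝ) (x : Mink) (η : ℝ) {μ : ℝ} (hμ : 0 < μ) :
    pvInt η H (μ • x) = μ⁻¹ * pvInt (η / μ) H x := by
  unfold pvInt
  rw [← integral_const_mul]
  refine integral_congr_ae (Eventually.of_forall fun n => ?_)
  have h1 : hgt (μ • x) n = μ * hgt x n := by simp [hgt]
  have h2 : η ≤ |μ * hgt x n| ↔ η / μ ≤ |hgt x n| := by
    rw [abs_mul, abs_of_pos hμ, div_le_iff₀' hμ]
  simp only [pvK, h1, h2]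
  split_ifs
  · rw [mul_inv]; ring
  · simp

theorem tendsto_div_nhdsGT {μ : ℝ} (hμ : 0 < μ) : Tendsto (fun η : ℝ => η / μ) (𝓝[>] 0) (𝓝[>] 0) := by
  refine tendsto_nhdsWithin_iff.2 ⟨?_, ?_⟩
  · have : Tendsto (fun η : ℝ => η / μ) (𝓝 0) (𝓝 (0 / μ)) := tendsto_id.div_const μ
    rw [zero_div] at this
    exact this.mono_left nhdsWithin_le_nhds
  · filter_upwards [self_mem_nhdsWithin] with η hη
    exact div_pos hη hμ

theorem pv_smul {H : Space → ℝ} (hH : SphSmooth H) {x : Mink} (hx : x ∈ spacelike) {μ : ℝ}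
    (hμ : 0 < μ) : pv H (μ • x) = μ⁻¹ * pv H x := by
  have h := tendsto_pvInt hH (smul_mem_spacelike hx hμ.ne')
  simp_rw [pvInt_smul H x _ hμ] at h
  exact tendsto_nhds_unique h (((tendsto_pvInt hH hx).comp (tendsto_div_nhdsGT hμ)).const_mul _)

/-- The kernel `x·l / x·l` integrates to the mass. -/
theorem sum_mul_pv {H : Space → ℝ} (hH : SphSmooth H) {x : Mink} (hx : x ∈ spacelike) :
    ∑ a, x a * pv (fun n => hgt (basisVec a) n * H n) x = ∫ n : Sph, H n ∂sphMeasure := by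
  rw [← pv_sum Finset.univ x (fun a _ => sphSmooth_hgt_mul (basisVec a) hH) hx]
  have hs := sphSmooth_sum Finset.univ x (fun a _ => sphSmooth_hgt_mul (basisVec a) hH)
  refine tendsto_nhds_unique (tendsto_pvInt hs hx) ?_
  have h1 : ∀ η > 0, pvInt η (fun n => ∑ a, x a * (hgt (basisVec a) n * H n)) x
      = ∫ n : Sph, (if η ≤ |hgt x n| then H n else 0) ∂sphMeasure := by
    intro η hη
    unfold pvInt
    refine integral_congr_ae (Eventually.of_forall fun n => ?_)
    have h2 : ∑ a, x a * (hgt (basisVec a) n * H n) = hgt x n * H n := by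
      rw [hgt_eq_sum_basisVec x, Finset.sum_mul]
      exact Finset.sum_congr rfl fun a _ => by ring
    simp only [h2, pvK]
    split_ifs with h
    · have : hgt x n ≠ 0 := fun e => by rw [e] at h; simp at h; linarith
      field_simp
    · simp
  have h3 : Tendsto (fun η : ℝ => ∫ n : Sph, (if η ≤ |hgt x n| then H n else 0) ∂sphMeasure)
      (𝓝[>] 0) (𝓝 (∫ n : Sph, H n ∂sphMeasure)) := by
    refine tendsto_integral_filter_of_dominated_convergence (fun n => |H n|) ?_ ?_
      (integrable_sph hH.continuous).abs ?_
    · refine Eventually.of_forall fun η => Measurable.aestronglyMeasurable ?_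
      exact Measurable.ite (measurableSet_le measurable_const (continuous_hgt_sph x).abs.measurable)
        hH.continuous.measurable measurable_const
    · refine Eventually.of_forall fun η => Eventually.of_forall fun n => ?_
      split_ifs <;> simp
    · filter_upwards [ae_hgt_ne x (norm_spatial_pos hx) 0] with n hn
      refine tendsto_const_nhds.congr' ?_
      filter_upwards [Ioo_mem_nhdsGT (abs_pos.2 hn)] with η hη
      rw [if_pos hη.2.le]
  refine h3.congr' ?_
  filter_upwards [self_mem_nhdsWithin] with η hη
  exact (h1 η hη).symm

/-- Both sides are mixed second derivatives of one logarithmic potential. This is the source of the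
closedness condition on tails. -/
theorem pd_pv_symm {H : Space → ℝ} (hH : SphSmooth H) {x : Mink} (hx : x ∈ spacelike)
    (a b : Fin 4) : pd b (pv fun n => hgt (basisVec a) n * H n) x
      = pd a (pv fun n => hgt (basisVec b) n * H n) x := by
  rw [← pd_congr (fun y hy => pd_logInt hH hy a) hx, ← pd_congr (fun y hy => pd_logInt hH hy b) hx,
    pd_comm (contDiffOn_logInt hH) hx]

/-- A vector tangent to the cone is determined by its spatial part. The time component follows from
differentiating ‖y‖² in two ways and comparing with the tangency condition. -/
theorem hasFDerivAt_coneChart {y : Space} (hy : y ≠ 0) : ∃ D : Space →L[ℝ] Mink,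
    HasFDerivAt coneChart D y ∧ ∀ T : Mink, dot (coneChart y) T = 0 → D (spatial T) = T := by
  have h1 : DifferentiableAt ℝ coneChart y :=
    (contDiffOn_coneChart.contDiffAt (isOpen_compl_singleton.mem_nhds hy)).differentiableAt (by simp)
  refine ⟨fderiv ℝ coneChart y, h1.hasFDerivAt, fun T hT => ?_⟩
  have hcomp : ∀ a v, fderiv ℝ (fun y => coneChart y a) y v = fderiv ℝ coneChart y v a := by
    intro a v
    have := (hasFDerivAt_pi'.1 h1.hasFDerivAt a).fderiv
    rw [this]
    rfl
  have hsucc : ∀ i : Fin 3, fderiv ℝ (fun y => coneChart y i.succ) y (spatial T) = T i.succ := by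
    intro i
    have : HasFDerivAt (fun y : Space => coneChart y i.succ)
        (EuclideanSpace.proj i : Space →L[ℝ] ℝ) y :=
      (EuclideanSpace.proj i : Space →L[ℝ] ℝ).hasFDerivAt
    rw [this.fderiv]
    rfl
  have hzero : fderiv ℝ (fun y => coneChart y 0) y (spatial T) = T 0 := by
    have hd : DifferentiableAt ℝ (fun y : Space => ‖y‖) y := differentiableAt_id.norm ℝ hy
    have h2 := hd.hasFDerivAt.mul hd.hasFDerivAt
    have h3 : HasFDerivAt (fun y : Space => ‖y‖ * ‖y‖) ((2 : ℝ) • (innerSL ℝ y : Space →L[ℝ] ℝ)) y := by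
      have := (hasStrictFDerivAt_norm_sq y).hasFDerivAt
      simp_rw [← pow_two]
      exact this.congr_fderiv (by ext; simp)
    have h4 := congrArg (fun L : Space →L[ℝ] ℝ => L (spatial T)) (h2.unique h3)
    simp only [add_apply, smul_apply, smul_eq_mul, innerSL_apply_apply] at h4
    rw [coneChart, dot_comm, dot_mkVec] at hT
    rw [real_inner_comm] at hT
    have hpos := norm_pos_iff.2 hy
    have h5 : fderiv ℝ (fun y : Space => ‖y‖) y (spatial T) = T 0 := by
      apply mul_left_cancel₀ hpos.ne'
      linarith
    exact h5
  ext a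
  rw [← hcomp]
  refine Fin.cases hzero hsucc a

theorem dot_basisVec_self (a : Fin 4) (x : Mink) : dot (basisVec a) x = eta a * x a := by
  rw [dot_eq_sum, Finset.sum_eq_single a]
  · simp [basisVec]
  · intro b _ hb
    simp [basisVec, hb]
  · simp

/-- The vector l_a e_b - l_b e_a is orthogonal to l, hence tangent to the cone, so for an ambient
differentiable f the chart derivative is the ordinary directional derivative. -/
theorem coneL_eq {f : Mink → ℝ} (a b : Fin 4) {l : Mink} (hl : l ∈ lightCone)
    (hf : DifferentiableAt ℝ f l) :
    coneL a b f l = dot (basisVec a) l * pd b f l - dot (basisVec b) l * pd a f l := by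
  obtain ⟨D, hD, hT⟩ := hasFDerivAt_coneChart (spatial_ne_zero hl)
  rw [coneChart_spatial hl] at hT
  have h1 : HasFDerivAt f (fderiv ℝ f l) (coneChart (spatial l)) := by
    rw [coneChart_spatial hl]; exact hf.hasFDerivAt
  rw [coneL, show fderiv ℝ (fun y => f (coneChart y)) (spatial l) = _ from
    (h1.comp (spatial l) hD).fderiv, ContinuousLinearMap.comp_apply, hT]
  · simp [pd]
  · have h2 : ∀ u w : Mink, dot l (u - w) = dot l u - dot l w := fun u w => by
      simp [dot_eq_sum, mul_sub]
    rw [h2, dot_smul, dot_smul, dot_comm l, dot_comm l]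
    ring

/-! ### Tails of finite sums of product densities -/

section Tail

variable {ι : Type*} [Fintype ι] {R : ℝ} {c : ι → ℝ → ℝ} {b : ι → Space → ℝ}

/-- The covariant components of the tail produced by the density `∑ c_i(θ) b_i(n)`. -/
def lowTail (c : ι → ℝ → ℝ) (b : ι → Space → ℝ) (a : Fin 4) (l : Mink) : ℝ :=
  ∑ i, wtInt (fun θ => c i θ * wt θ a) (pv fun n => hgt (basisVec a) n * b i n) l

/-- The tail produced by the density `∑ c_i(θ) b_i(n)`. -/
def coneTail (c : ι → ℝ → ℝ) (b : ι → Space → ℝ) (l : Mink) : Mink :=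
  fun a => eta a * lowTail c b a l

theorem dot_basisVec_coneTail (a : Fin 4) (l : Mink) :
    dot (basisVec a) (coneTail c b l) = lowTail c b a l := by
  rw [dot_basisVec_self, coneTail, ← mul_assoc, eta_mul_self, one_mul]

theorem contDiffOn_lowTail (hc : ∀ i, IsWeight R (c i)) (hb : ∀ i, SphSmooth (b i)) (a : Fin 4) :
    ContDiffOn ℝ ∞ (lowTail c b a) (wtDom R) :=
  ContDiffOn.sum fun i _ => contDiffOn_wtInt ((hc i).mul_wt a)
    (contDiffOn_pv (sphSmooth_hgt_mul _ (hb i)))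

theorem pd_lowTail (hc : ∀ i, IsWeight R (c i)) (hb : ∀ i, SphSmooth (b i)) (a d : Fin 4)
    {l : Mink} (hl : l ∈ wtDom R) : pd d (lowTail c b a) l = ∑ i,
      wtInt (fun θ => c i θ * wt θ a * wt θ d)
        (pd d (pv fun n => hgt (basisVec a) n * b i n)) l := by
  have hd : ∀ i, DifferentiableAt ℝ (wtInt (fun θ => c i θ * wt θ a)
      (pv fun n => hgt (basisVec a) n * b i n)) l := fun i =>
    ((contDiffOn_wtInt ((hc i).mul_wt a) (contDiffOn_pv (sphSmooth_hgt_mul _ (hb i)))).contDiffAt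
      ((isOpen_wtDom R).mem_nhds hl)).differentiableAt (by simp)
  have h := HasFDerivAt.fun_sum (u := Finset.univ) fun i _ => (hd i).hasFDerivAt
  rw [pd, show fderiv ℝ (lowTail c b a) l = _ from h.fderiv]
  simp only [sum_apply]
  refine Finset.sum_congr rfl fun i _ => ?_
  exact pd_wtInt ((hc i).mul_wt a) (contDiffOn_pv (sphSmooth_hgt_mul _ (hb i))) d hl

/-- The covariant tail is curl-free off the cone: each θ-slice is by `pd_pv_symm`, and the chain
rule weights wt_a wt_d are symmetric. -/
theorem pd_lowTail_symm (hc : ∀ i, IsWeight R (c i)) (hb : ∀ i, SphSmooth (b i)) (a d : Fin 4)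
    {l : Mink} (hl : l ∈ wtDom R) : pd d (lowTail c b a) l = pd a (lowTail c b d) l := by
  rw [pd_lowTail hc hb a d hl, pd_lowTail hc hb d a hl]
  refine Finset.sum_congr rfl fun i _ => integral_congr_ae (Eventually.of_forall fun θ => ?_)
  simp only
  by_cases hθ : θ ∈ Icc (-R) R
  · rw [pd_pv_symm (hb i) (wtVec_mem_of_mem (abs_le.2 hθ) hl)]
    ring
  · rw [(hc i).eq_zero hθ]
    simp

/-- Contracting with l cancels the kernel (z·l)/(z·l) on each θ-slice, leaving the total mass of the
density. Orthogonality of the tail is thus exactly vanishing mass. -/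
theorem dot_coneTail (hc : ∀ i, IsWeight R (c i)) (hb : ∀ i, SphSmooth (b i)) {l : Mink}
    (hl : l ∈ lightCone) :
    dot l (coneTail c b l) = ∑ i, (∫ θ, c i θ) * ∫ n : Sph, b i n ∂sphMeasure := by
  have h1 : dot l (coneTail c b l) = ∑ a, l a * lowTail c b a l := by
    rw [dot_eq_sum]
    refine Finset.sum_congr rfl fun a _ => ?_
    rw [coneTail]
    linear_combination (l a * lowTail c b a l) * eta_mul_self a
  rw [h1]
  simp_rw [lowTail, Finset.mul_sum]
  rw [Finset.sum_comm]
  refine Finset.sum_congr rfl fun i _ => ?_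
  simp_rw [wtInt, ← integral_const_mul]
  rw [← integral_finsetSum _ fun a _ => (integrable_wtInt_integrand ((hc i).mul_wt a)
    (contDiffOn_pv (sphSmooth_hgt_mul _ (hb i))) (lightCone_subset_wtDom R hl)).const_mul _,
    integral_const_mul, ← integral_mul_const]
  refine integral_congr_ae (Eventually.of_forall fun θ => ?_)
  simp only
  rw [← sum_mul_pv (hb i) (wtVec_mem θ hl), Finset.mul_sum]
  refine Finset.sum_congr rfl fun a _ => ?_
  rw [wtVec]
  ring

/-- Degree -1 is inherited from `pv_smul` and orthogonality from zero mass. In the cyclic sum of the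
L_ab the terms cancel pairwise once the curl of the covariant tail vanishes. -/
theorem isTail_coneTail (hc : ∀ i, IsWeight R (c i)) (hb : ∀ i, SphSmooth (b i))
    (h0 : ∑ i, (∫ θ, c i θ) * ∫ n : Sph, b i n ∂sphMeasure = 0) : IsTail (coneTail c b) := by
  refine ⟨?_, ?_, ?_, ?_⟩
  · refine contDiffOn_pi.2 fun a => contDiffOn_const.mul ?_
    exact (contDiffOn_lowTail hc hb a).comp contDiffOn_coneChart
      fun y hy => lightCone_subset_wtDom R (coneChart_mem hy)
  · intro μ hμ l hl
    ext a
    simp only [coneTail, Pi.smul_apply, smul_eq_mul, lowTail, Finset.mul_sum, wtInt,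
      ← integral_const_mul]
    refine Finset.sum_congr rfl fun i _ => integral_congr_ae (Eventually.of_forall fun θ => ?_)
    have h1 : wtVec θ (μ • l) = μ • wtVec θ l := by
      ext d; simp [wtVec]; ring
    simp only
    rw [h1, pv_smul (sphSmooth_hgt_mul _ (hb i)) (wtVec_mem θ hl) hμ]
    ring
  · intro l hl
    rw [dot_coneTail hc hb hl, h0]
  · intro a d e l hl
    have hl' := lightCone_subset_wtDom R hl
    have hd : ∀ a, DifferentiableAt ℝ (lowTail c b a) l := fun a =>
      ((contDiffOn_lowTail hc hb a).contDiffAt ((isOpen_wtDom R).mem_nhds hl')).differentiableAt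
        (by simp)
    simp_rw [dot_basisVec_coneTail]
    rw [coneL_eq a d hl (hd e), coneL_eq d e hl (hd a), coneL_eq e a hl (hd d),
      pd_lowTail_symm hc hb e d hl', pd_lowTail_symm hc hb e a hl', pd_lowTail_symm hc hb a d hl']
    ring

end Tail

/-! ### The hyperboloid and principal values over it -/

/-- The point `(sinh θ, cosh θ n)` of the hyperboloid `z² = -1`. -/
def hyp (θ : ℝ) (n : Space) : Mink := mkVec (Real.sinh θ) (Real.cosh θ • n)

theorem continuous_mkVec : Continuous fun p : ℝ × Space => mkVec p.1 p.2 := by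
  refine continuous_pi fun a => ?_
  refine Fin.cases ?_ (fun i => ?_) a
  · exact continuous_fst
  · exact (by fun_prop : Continuous fun p : ℝ × Space => p.2 i)

theorem continuous_hyp : Continuous fun p : ℝ × Sph => hyp p.1 p.2 :=
  continuous_mkVec.comp (by fun_prop : Continuous fun p : ℝ × Sph =>
    (Real.sinh p.1, Real.cosh p.1 • (p.2 : Space)))

theorem wtVec_coneChart (θ : ℝ) (n : Sph) : wtVec θ (coneChart n) = hyp θ n := by
  ext a
  refine Fin.cases ?_ (fun i => ?_) a <;> simp [wtVec, hyp, coneChart_sph]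

theorem hyp_mem (θ : ℝ) (n : Sph) : hyp θ n ∈ spacelike :=
  wtVec_coneChart θ n ▸ wtVec_mem θ (coneChart_mem (sph_ne_zero n))

theorem hyp_apply (θ : ℝ) (n : Space) (a : Fin 4) :
    hyp θ n a = eta a * (wt θ a * hgt (basisVec a) n) := by
  refine Fin.cases ?_ (fun i => ?_) a
  · simp [hyp, hgt_basisVec_zero, eta_zero]
  · simp [hyp, hgt_basisVec_succ, eta_succ]

/-- At fixed θ the kernel z·l is again a height function of n, so a principal value over the
hyperboloid is sliced into spherical ones with the same cutoff η. -/
theorem dot_hyp (θ : ℝ) (n : Space) (l : Mink) : dot (hyp θ n) l = hgt (wtVec θ l) n := by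
  simp only [dot, hgt_eq_sum, hyp, mkVec_zero, mkVec_succ, wtVec, wt_zero, wt_succ,
    PiLp.smul_apply, smul_eq_mul]
  congr 1
  exact Finset.sum_congr rfl fun i _ => by ring

theorem hgt_hyp_comm (θ : ℝ) (m n : Space) : hgt (hyp θ m) n = hgt (hyp θ n) m := by
  simp only [hgt_eq_sum, hyp, mkVec_zero, mkVec_succ, PiLp.smul_apply, smul_eq_mul]
  congr 1
  exact Finset.sum_congr rfl fun i _ => by ring

theorem measurableEmbedding_hyp : MeasurableEmbedding fun p : ℝ × Sph => hyp p.1 p.2 := by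
  refine continuous_hyp.measurableEmbedding ?_
  rintro ⟨θ, n⟩ ⟨τ, m⟩ h
  have h0 : θ = τ := Real.sinh_injective (congrFun h 0)
  subst h0
  congr 1
  ext i
  have := congrFun h i.succ
  simpa [hyp, (Real.cosh_pos θ).ne'] using this

theorem integral_nuMeasure {E : Type*} [NormedAddCommGroup E] [NormedSpace ℝ E] (f : Mink → E) :
    ∫ z, f z ∂nuMeasure = ∫ p : ℝ × Sph, Real.cosh p.1 ^ 2 • f (hyp p.1 p.2)
      ∂(volume.prod sphMeasure) := by
  have h1 : nuMeasure = (((volume : Measure ℝ).withDensity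
      (fun θ => ENNReal.ofReal (Real.cosh θ ^ 2))).prod sphMeasure).map
      (fun p : ℝ × Sph => hyp p.1 p.2) := rfl
  have hm : Measurable fun θ : ℝ => ENNReal.ofReal (Real.cosh θ ^ 2) := by
    have := Real.continuous_cosh
    exact (by fun_prop : Continuous fun θ : ℝ => Real.cosh θ ^ 2).measurable.ennreal_ofReal
  rw [h1, measurableEmbedding_hyp.integral_map, prod_withDensity_left hm,
    integral_withDensity_eq_integral_toReal_smul (f := fun p : ℝ × Sph => ENNReal.ofReal (Real.cosh p.1 ^ 2)) (hm.comp measurable_fst)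
      (Eventually.of_forall fun _ => ENNReal.ofReal_lt_top)]
  refine integral_congr_ae (Eventually.of_forall fun p => ?_)
  simp only
  rw [ENNReal.toReal_ofReal (sq_nonneg _)]

section Convergence

variable {X : Type*} [TopologicalSpace X] [MeasurableSpace X]
  [OpensMeasurableSpace X] {μ : Measure X} [IsFiniteMeasureOnCompacts μ] {w : X → ℝ}
  {γ : X → Mink} {H : Space → ℝ}

theorem integrable_mul_pvK (hw : Continuous w) (hwc : HasCompactSupport w) (hγ : Continuous γ)
    (hH : Continuous fun n : Sph => H n) {η : ℝ} (hη : 0 < η) :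
    Integrable (fun p : X × Sph => w p.1 * (pvK η (hgt (γ p.1) p.2) * H p.2))
      (μ.prod sphMeasure) := by
  have h1 : Integrable (fun p : X × Sph => w p.1 * H p.2) (μ.prod sphMeasure) :=
    (hw.integrable_of_hasCompactSupport hwc).mul_prod (integrable_sph hH)
  have hk : Measurable fun p : X × Sph => pvK η (hgt (γ p.1) p.2) :=
    (measurable_pvK η).comp (continuous_hgt.comp ((hγ.comp continuous_fst).prodMk
      (continuous_subtype_val.comp continuous_snd))).measurable
  refine (h1.bdd_mul (c := η⁻¹) hk.aestronglyMeasurable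
    (Eventually.of_forall fun p => abs_pvK_le hη _)).congr (Eventually.of_forall fun p => ?_)
  simp only
  ring

/-- The limit of the cutoff commutes with an outer integral because the O(η) error coefficient is
continuous, hence bounded on the compact support of the weight. -/
theorem tendsto_integral_mul_pvInt (hw : Continuous w) (hwc : HasCompactSupport w)
    (hγ : Continuous γ) (hγs : ∀ x, γ x ∈ spacelike) (hH : SphSmooth H) :
    Tendsto (fun η => ∫ x, w x * pvInt η H (γ x) ∂μ) (𝓝[>] 0) (𝓝 (∫ x, w x * pv H (γ x) ∂μ)) := by
  obtain ⟨M, hMc, hM⟩ := exists_abs_pvInt_sub_pv_le hH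
  have hMγ : Continuous fun x => M (γ x) := hMc.comp_continuous hγ hγs
  have hpv : Continuous fun x => pv H (γ x) := (contDiffOn_pv hH).continuousOn.comp_continuous hγ hγs
  refine tendsto_integral_filter_of_dominated_convergence
    (fun x => ‖w x * (|pv H (γ x)| + M (γ x))‖) ?_ ?_ ?_ ?_
  · filter_upwards [self_mem_nhdsWithin] with η hη
    have := (integrable_mul_pvK (μ := μ) hw hwc hγ hH.continuous hη).1.integral_prod_right'
    refine this.congr (Eventually.of_forall fun x => ?_)
    simp only [pvInt, integral_const_mul]
  · filter_upwards [Ioc_mem_nhdsGT (zero_lt_one' ℝ)] with η hη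
    refine Eventually.of_forall fun x => ?_
    have h1 := hM _ (hγs x) η hη.1 hη.2
    have h2 : 0 ≤ M (γ x) := nonneg_of_mul_nonneg_left ((abs_nonneg _).trans h1) hη.1
    have h3 : M (γ x) * η ≤ M (γ x) := mul_le_of_le_one_right h2 hη.2
    rw [norm_mul, norm_mul]
    refine mul_le_mul_of_nonneg_left ?_ (norm_nonneg _)
    rw [Real.norm_eq_abs, Real.norm_eq_abs, abs_of_nonneg (by positivity : 0 ≤ |pv H (γ x)| + M (γ x))]
    have h4 := abs_add_le (pvInt η H (γ x) - pv H (γ x)) (pv H (γ x))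
    rw [sub_add_cancel] at h4
    linarith
  · refine ((hw.mul (hpv.abs.add hMγ)).integrable_of_hasCompactSupport hwc.mul_right).norm
  · exact Eventually.of_forall fun x => (tendsto_pvInt hH (hγs x)).const_mul _

end Convergence

/-- The principal value kernel on a hyperboloid section is symmetric. -/
theorem integral_mul_pv_comm {G H : Space → ℝ} (hG : SphSmooth G) (hH : SphSmooth H) (θ : ℝ) :
    ∫ m : Sph, G m * pv H (hyp θ m) ∂sphMeasure = ∫ m : Sph, H m * pv G (hyp θ m) ∂sphMeasure := by
  have hγ : Continuous fun m : Sph => hyp θ m := continuous_hyp.comp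
    (f := fun m : Sph => (θ, m)) (by fun_prop)
  have key : ∀ {G H : Space → ℝ}, SphSmooth G → SphSmooth H → Tendsto
      (fun η => ∫ m : Sph, G m * pvInt η H (hyp θ m) ∂sphMeasure) (𝓝[>] 0)
      (𝓝 (∫ m : Sph, G m * pv H (hyp θ m) ∂sphMeasure)) := fun hG hH =>
    tendsto_integral_mul_pvInt hG.continuous (HasCompactSupport.of_compactSpace _) hγ
      (fun m => hyp_mem θ m) hH
  -- At each η > 0 the kernel is bounded and its truncation also respects the symmetry sinh θ - cosh
  -- θ ⟪m, n⟫, so Fubini suffices before passing to the limit.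
  refine tendsto_nhds_unique (key hG hH) ((key hH hG).congr' ?_)
  filter_upwards [self_mem_nhdsWithin] with η hη
  unfold pvInt
  simp_rw [← integral_const_mul]
  rw [integral_integral_swap (integrable_mul_pvK (γ := fun m : Sph => hyp θ m) hH.continuous
    (HasCompactSupport.of_compactSpace _) hγ hG.continuous hη)]
  refine integral_congr_ae (Eventually.of_forall fun n => integral_congr_ae
    (Eventually.of_forall fun m => ?_))
  simp only
  rw [hgt_hyp_comm]
  ring

/-! ### The phase as a pairing of the density with F_v -/

section Density

variable {ι : Type*} [Fintype ι] {R : ℝ} {c : ι → ℝ → ℝ} {b : ι → Space → ℝ} {ρ : Mink → ℝ}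

theorem integral_density (hc : ∀ i, IsWeight R (c i)) (hb : ∀ i, SphSmooth (b i))
    (hρ : ∀ θ (n : Sph), Real.cosh θ ^ 2 * ρ (hyp θ n) = ∑ i, c i θ * b i n) :
    ∫ z, ρ z ∂nuMeasure = ∑ i, (∫ θ, c i θ) * ∫ n : Sph, b i n ∂sphMeasure := by
  rw [integral_nuMeasure]
  simp_rw [smul_eq_mul, hρ]
  rw [integral_finsetSum]
  · exact Finset.sum_congr rfl fun i _ => integral_prod_mul (c i) fun n : Sph => b i n
  · exact fun i _ => ((hc i).smooth.continuous.integrable_of_hasCompactSupport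
      (hc i).hasCompactSupport).mul_prod (integrable_sph (hb i).continuous)

theorem hasAsymptote_of_tail_eq (hc : ∀ i, IsWeight R (c i)) (hb : ∀ i, SphSmooth (b i))
    (hρ : ∀ θ (n : Sph), Real.cosh θ ^ 2 * ρ (hyp θ n) = ∑ i, c i θ * b i n)
    {V : ℝ → Mink → Mink} (hV : ∀ l ∈ lightCone, tail V l = coneTail c b l) :
    HasAsymptote V fun z => ρ z • z := by
  intro l hl
  rw [hV l hl]
  have hγ : Continuous fun θ => wtVec θ l :=
    contDiff_wtVec.continuous.comp (f := fun θ : ℝ => (l, θ)) (by fun_prop)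
  have hγs : ∀ θ, wtVec θ l ∈ spacelike := fun θ => wtVec_mem θ hl
  have hw : ∀ i a, IsWeight R fun θ => c i θ * wt θ a := fun i a => (hc i).mul_wt a
  have hH : ∀ i a, SphSmooth fun n => hgt (basisVec a) n * b i n := fun i a =>
    sphSmooth_hgt_mul _ (hb i)
  have hlim : Tendsto (fun (η : ℝ) (a : Fin 4) => ∑ i, eta a * ∫ θ, (c i θ * wt θ a) *
      pvInt η (fun n => hgt (basisVec a) n * b i n) (wtVec θ l)) (𝓝[>] 0)
      (𝓝 (coneTail c b l)) := by
    refine tendsto_pi_nhds.2 fun a => ?_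
    rw [coneTail, lowTail, Finset.mul_sum]
    exact tendsto_finsetSum _ fun i _ => (tendsto_integral_mul_pvInt (hw i a).smooth.continuous
      (hw i a).hasCompactSupport hγ hγs (hH i a)).const_mul _
  refine hlim.congr' ?_
  filter_upwards [self_mem_nhdsWithin] with η hη
  have hS : MeasurableSet {z : Mink | η ≤ |dot z l|} := by
    have : Continuous fun z : Mink => dot z l := by unfold dot; fun_prop
    exact measurableSet_le measurable_const this.abs.measurable
  have hint : ∀ i a, Integrable (fun p : ℝ × Sph => (c i p.1 * wt p.1 a) *
      (pvK η (hgt (wtVec p.1 l) p.2) * (hgt (basisVec a) p.2 * b i p.2)))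
      (volume.prod sphMeasure) := fun i a =>
    integrable_mul_pvK (H := fun n => hgt (basisVec a) n * b i n) (hw i a).smooth.continuous
      (hw i a).hasCompactSupport hγ
      (hH i a).continuous hη
  rw [← integral_indicator hS, integral_nuMeasure]
  have hcomp : ∀ (p : ℝ × Sph) (a : Fin 4), (Real.cosh p.1 ^ 2 • {z | η ≤ |dot z l|}.indicator
      (fun z => (dot z l)⁻¹ • ρ z • z) (hyp p.1 p.2)) a = ∑ i, eta a * ((c i p.1 * wt p.1 a) *
      (pvK η (hgt (wtVec p.1 l) p.2) * (hgt (basisVec a) p.2 * b i p.2))) := by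
    intro p a
    have h1 : ∑ i, eta a * ((c i p.1 * wt p.1 a) *
        (pvK η (hgt (wtVec p.1 l) p.2) * (hgt (basisVec a) p.2 * b i p.2)))
        = pvK η (hgt (wtVec p.1 l) p.2) * (hyp p.1 p.2 a * ∑ i, c i p.1 * b i p.2) := by
      rw [hyp_apply, Finset.mul_sum, Finset.mul_sum]
      exact Finset.sum_congr rfl fun i _ => by ring
    rw [h1, ← hρ]
    simp only [indicator_apply, Set.mem_ofPred_eq, dot_hyp, pvK]
    split_ifs
    · simp only [Pi.smul_apply, smul_eq_mul]
      ring
    · simp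
  have hI : ∀ a, Integrable (fun p : ℝ × Sph => (Real.cosh p.1 ^ 2 • {z | η ≤ |dot z l|}.indicator
      (fun z => (dot z l)⁻¹ • ρ z • z) (hyp p.1 p.2)) a) (volume.prod sphMeasure) := by
    intro a
    simp_rw [hcomp]
    exact integrable_finsetSum _ fun i _ => (hint i a).const_mul _
  funext a
  rw [eval_integral hI]
  simp_rw [hcomp]
  rw [integral_finsetSum _ fun i _ => (hint i a).const_mul _]
  refine Finset.sum_congr rfl fun i _ => ?_
  rw [integral_const_mul, integral_prod _ (hint i a)]
  simp only [pvInt, integral_const_mul]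

/-- The Coulomb term and the profile term of the phase combine under the common factor 1/(2π) into
the very integrand that defines F_v. -/
theorem phase_eq_integral_cloudW (e : ℝ) {Vs : Mink → ℝ → Mink → Mink} (hVs : IsProfileFamily Vs)
    {v : Mink} (hv : v ∈ hypPlus) (hc : ∀ i, IsWeight R (c i)) (hb : ∀ i, SphSmooth (b i))
    {V : ℝ → Mink → Mink} (hV : ∀ l ∈ lightCone, tail V l = coneTail c b l) :
    phase e V Vs v = ∑ a, 1 / (2 * Real.pi) *
      ∫ m : Sph, cloudW e Vs v a m * lowTail c b a (coneChart m) ∂sphMeasure := by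
  have hcone : Continuous fun m : Sph => coneChart m :=
    contDiffOn_coneChart.continuousOn.comp_continuous continuous_subtype_val sph_ne_zero
  have hlow : ∀ a, Continuous fun m : Sph => lowTail c b a (coneChart m) := fun a =>
    (contDiffOn_lowTail hc hb a).continuousOn.comp_continuous hcone
      fun m => lightCone_subset_wtDom R (coneChart_mem (sph_ne_zero m))
  have hdot : Continuous fun m : Sph => dot v (coneChart m) :=
    (contDiff_dot_right v).continuous.comp hcone
  have hne : ∀ m : Sph, dot v (coneChart m) ≠ 0 := fun m =>
    (dot_coneChart_pos hv (sph_ne_zero m)).ne'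
  have hV' : ∀ m : Sph, tail V (coneChart m) = coneTail c b (coneChart m) := fun m =>
    hV _ (coneChart_mem (sph_ne_zero m))
  have hd : ∀ (x : Mink) (m : Sph), dot x (coneTail c b (coneChart m))
      = ∑ a, x a * lowTail c b a (coneChart m) := by
    intro x m
    rw [dot_eq_sum]
    refine Finset.sum_congr rfl fun a _ => ?_
    rw [coneTail]
    linear_combination (x a * lowTail c b a (coneChart m)) * eta_mul_self a
  have hp : ∀ a, Continuous fun m : Sph => Vs v 0 (coneChart m) a := fun a =>
    (sphSmooth_profile hVs hv a).continuous
  rw [phase, integral_lightMeasure, integral_lightMeasure]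
  simp_rw [hV', hd]
  rw [← integral_const_mul, ← integral_const_mul, ← integral_add]
  · simp_rw [← integral_const_mul]
    rw [← integral_finsetSum]
    · refine integral_congr_ae (Eventually.of_forall fun m => ?_)
      simp only
      rw [Finset.sum_div, Finset.mul_sum, Finset.mul_sum, ← Finset.sum_add_distrib]
      refine Finset.sum_congr rfl fun a _ => ?_
      have := hne m
      have hpi := Real.pi_ne_zero
      rw [cloudW]
      field_simp
      ring
    · exact fun a _ => (integrable_sph
        ((sphSmooth_cloudW e hVs hv a).continuous.mul (hlow a))).const_mul _
  · exact (integrable_sph ((continuous_finsetSum _ fun a _ =>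
      continuous_const.mul (hlow a)).div hdot hne)).const_mul _
  · exact (integrable_sph (continuous_finsetSum _ fun a _ => (hp a).mul (hlow a))).const_mul _

/-- Fubini brings θ outside, and the symmetry of the kernel moves the principal value from the
density to G. The weights wt_a l_a reassemble into the components of z. -/
theorem integral_mul_lowTail (hc : ∀ i, IsWeight R (c i)) (hb : ∀ i, SphSmooth (b i))
    {G : Space → ℝ} (hG : SphSmooth G) (a : Fin 4) :
    ∫ m : Sph, G m * lowTail c b a (coneChart m) ∂sphMeasure = ∑ i, ∫ θ, c i θ *
      ∫ n : Sph, b i n * (eta a * (hyp θ n a * pv G (hyp θ n))) ∂sphMeasure := by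
  have hcont : ∀ i, Continuous fun p : Sph × ℝ => G p.1 * ((c i p.2 * wt p.2 a) *
      pv (fun n => hgt (basisVec a) n * b i n) (hyp p.2 p.1)) := fun i =>
    (hG.continuous.comp continuous_fst).mul
      ((((hc i).mul_wt a).smooth.continuous.comp continuous_snd).mul
      ((contDiffOn_pv (sphSmooth_hgt_mul _ (hb i))).continuousOn.comp_continuous
        (continuous_hyp.comp continuous_swap) fun p => hyp_mem p.2 p.1))
  have hint : ∀ i, Integrable (fun p : Sph × ℝ => G p.1 * ((c i p.2 * wt p.2 a) *
      pv (fun n => hgt (basisVec a) n * b i n) (hyp p.2 p.1))) (sphMeasure.prod volume) := fun i =>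
    (hcont i).integrable_of_hasCompactSupport
      (HasCompactSupport.intro (isCompact_univ.prod (isCompact_Icc (a := -R) (b := R)))
        fun p hp => by
          rw [(hc i).eq_zero fun h => hp ⟨mem_univ _, h⟩]
          simp)
  have h1 : ∀ m : Sph, G m * lowTail c b a (coneChart m) = ∑ i, ∫ θ, G m * ((c i θ * wt θ a) *
      pv (fun n => hgt (basisVec a) n * b i n) (hyp θ m)) := by
    intro m
    rw [lowTail, Finset.mul_sum]
    refine Finset.sum_congr rfl fun i _ => ?_
    rw [wtInt, ← integral_const_mul]
    simp_rw [wtVec_coneChart]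
  simp_rw [h1]
  rw [integral_finsetSum _ fun i _ => (hint i).integral_prod_left]
  refine Finset.sum_congr rfl fun i _ => ?_
  rw [integral_integral_swap (hint i)]
  refine integral_congr_ae (Eventually.of_forall fun θ => ?_)
  simp only
  simp_rw [mul_left_comm (G _) (c i θ * wt θ a), integral_const_mul]
  rw [integral_mul_pv_comm hG (sphSmooth_hgt_mul _ (hb i)), mul_assoc, ← integral_const_mul]
  congr 1
  refine integral_congr_ae (Eventually.of_forall fun n => ?_)
  simp only
  rw [hyp_apply]
  linear_combination (-(wt θ a * hgt (basisVec a) n * b i n * pv G (hyp θ n))) * eta_mul_self a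

/-- The phase is the integral of the density against the potential. -/
theorem phase_eq_integral_cloudF (e : ℝ) {Vs : Mink → ℝ → Mink → Mink} (hVs : IsProfileFamily Vs)
    {v : Mink} (hv : v ∈ hypPlus) (hc : ∀ i, IsWeight R (c i)) (hb : ∀ i, SphSmooth (b i))
    {V : ℝ → Mink → Mink} (hV : ∀ l ∈ lightCone, tail V l = coneTail c b l) :
    phase e V Vs v = ∑ i, ∫ p : ℝ × Sph, c i p.1 * b i p.2 *
      cloudF (cloudW e Vs v) (hyp p.1 p.2) ∂(volume.prod sphMeasure) := by
  have hW := sphSmooth_cloudW e hVs hv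
  rw [phase_eq_integral_cloudW e hVs hv hc hb hV]
  simp_rw [integral_mul_lowTail hc hb (hW _), Finset.mul_sum]
  rw [Finset.sum_comm]
  refine Finset.sum_congr rfl fun i _ => ?_
  have hpart : ∀ a, Continuous fun p : ℝ × Sph => c i p.1 * (b i p.2 *
      (eta a * (hyp p.1 p.2 a * pv (cloudW e Vs v a) (hyp p.1 p.2)))) := fun a =>
    ((hc i).smooth.continuous.comp continuous_fst).mul
      (((hb i).continuous.comp continuous_snd).mul (continuous_const.mul
        (((continuous_apply a).comp continuous_hyp).mul
        ((contDiffOn_pv (hW a)).continuousOn.comp_continuous continuous_hyp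
          fun p => hyp_mem p.1 p.2))))
  have hint : ∀ a, Integrable (fun p : ℝ × Sph => c i p.1 * (b i p.2 *
      (eta a * (hyp p.1 p.2 a * pv (cloudW e Vs v a) (hyp p.1 p.2)))))
      (volume.prod sphMeasure) := fun a =>
    (hpart a).integrable_of_hasCompactSupport
      (HasCompactSupport.intro ((isCompact_Icc (a := -R) (b := R)).prod isCompact_univ)
        fun p hp => by
          rw [(hc i).eq_zero fun h => hp ⟨h, mem_univ _⟩]
          simp)
  have h1 : ∀ a, (∫ θ, c i θ * ∫ n : Sph, b i n * (eta a * (hyp θ n a *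
      pv (cloudW e Vs v a) (hyp θ n))) ∂sphMeasure) = ∫ p : ℝ × Sph, c i p.1 * (b i p.2 *
      (eta a * (hyp p.1 p.2 a * pv (cloudW e Vs v a) (hyp p.1 p.2)))) ∂(volume.prod sphMeasure) := by
    intro a
    rw [integral_prod _ (hint a)]
    simp only [integral_const_mul]
  simp_rw [h1, ← integral_const_mul]
  rw [← integral_finsetSum _ fun a _ => (hint a).const_mul _]
  refine integral_congr_ae (Eventually.of_forall fun p => ?_)
  simp only
  rw [cloudF, Finset.mul_sum]
  exact Finset.sum_congr rfl fun a _ => by ring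

end Density

/-! ### Localized even densities -/

theorem IsWeight.mono {R R' : ℝ} (h : R ≤ R') {c : ℝ → ℝ} (hc : IsWeight R c) : IsWeight R' c :=
  ⟨hc.smooth, hc.support.trans (Ioo_subset_Ioo (neg_le_neg h) h)⟩

theorem IsWeight.const_mul {R : ℝ} (k : ℝ) {c : ℝ → ℝ} (hc : IsWeight R c) :
    IsWeight R fun θ => k * c θ :=
  ⟨contDiff_const.mul hc.smooth, (tsupport_mul_subset_right (f := fun _ => k)).trans hc.support⟩

/-- The sign attached to a boolean. -/
def sgn (s : Bool) : ℝ := if s then 1 else -1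

theorem abs_sgn (s : Bool) : |sgn s| = 1 := by cases s <;> simp [sgn]

theorem sgn_smul_cases (s : Bool) (x : Mink) : sgn s • x = x ∨ sgn s • x = -x := by
  cases s <;> simp [sgn]

theorem spatial_smul (μ : ℝ) (x : Mink) : spatial (μ • x) = μ • spatial x := by
  ext i; simp

theorem mkVec_smul (μ t : ℝ) (y : Space) : mkVec (μ * t) (μ • y) = μ • mkVec t y := by
  ext a
  refine Fin.cases ?_ (fun i => ?_) a <;> simp

theorem mkVec_spatial (x : Mink) : mkVec (x 0) (spatial x) = x := by
  ext a
  refine Fin.cases ?_ (fun i => ?_) a <;> simp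

/-- Profiles in the variables `x⁰ / |x|` and `x / |x|` whose product lives over `U`. -/
structure IsPacket (U : Set Mink) (α : ℝ → ℝ) (β : Space → ℝ) : Prop where
  smooth_left : ContDiff ℝ ∞ α
  smooth_right : ContDiff ℝ ∞ β
  nonneg_left : ∀ t, 0 ≤ α t
  nonneg_right : ∀ n, 0 ≤ β n
  bound : ∃ T < 1, ∀ t, T < |t| → α t = 0
  support : ∀ t n, α t * β n ≠ 0 → ∃ μ : ℝ, 0 < μ ∧ μ • mkVec t n ∈ U
  pos_left : ∃ t, α t ≠ 0
  pos_right : ∃ n : Sph, β n ≠ 0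

theorem exists_isPacket {U : Set Mink} (hU : IsOpen U) (hUs : U ⊆ spacelike) {p : Mink}
    (hp : p ∈ U) : ∃ α β, IsPacket U α β := by
  set r := ‖spatial p‖ with hr
  have hr0 : 0 < r := norm_spatial_pos (hUs hp)
  set τ := p 0 / r with hτ
  set n₀ := r⁻¹ • spatial p with hn₀
  have hn1 : ‖n₀‖ = 1 := by
    rw [hn₀, norm_smul, norm_inv, Real.norm_of_nonneg hr0.le, inv_mul_cancel₀ hr0.ne']
  have hτ1 : |τ| < 1 := by
    have h : dot p p < 0 := hUs hp
    rw [dot_self_eq] at h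
    rw [hτ, abs_div, abs_of_pos hr0, div_lt_one hr0]
    exact abs_lt_of_sq_lt_sq (by linarith) hr0.le
  have hpeq : r • mkVec τ n₀ = p := by
    rw [← mkVec_smul, hτ, hn₀, mul_div_cancel₀ _ hr0.ne', smul_inv_smul₀ hr0.ne', mkVec_spatial]
  have hcont : Continuous fun q : ℝ × Space => r • mkVec q.1 q.2 :=
    continuous_mkVec.const_smul r
  have hnhds : {q : ℝ × Space | r • mkVec q.1 q.2 ∈ U} ∈ 𝓝 (τ, n₀) :=
    hcont.continuousAt.preimage_mem_nhds (by simpa only [hpeq] using hU.mem_nhds hp)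
  obtain ⟨δ, hδ, hball⟩ := Metric.mem_nhds_iff.1 hnhds
  -- The first bound keeps the bumps over U; the second keeps the slope x⁰/|x| below (1 + |τ|)/2 <
  -- 1, away from the light cone.
  set ε := min δ ((1 - |τ|) / 2) with hε
  have hε0 : 0 < ε := lt_min hδ (by linarith)
  let α : ContDiffBump τ := ⟨ε / 2, ε, by linarith, by linarith⟩
  let β : ContDiffBump n₀ := ⟨ε / 2, ε, by linarith, by linarith⟩
  have hα : ∀ t, α t ≠ 0 → |t - τ| < ε := fun t ht => by
    have : t ∈ Function.support α := ht
    rw [α.support_eq] at this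
    exact this
  have hβ : ∀ n, β n ≠ 0 → dist n n₀ < ε := fun t ht => by
    have : t ∈ Function.support β := ht
    rw [β.support_eq] at this
    exact this
  refine ⟨α, β, α.contDiff, β.contDiff, fun t => α.nonneg, fun n => β.nonneg,
    ⟨(1 + |τ|) / 2, by linarith, ?_⟩, ?_, ⟨τ, ?_⟩, ⟨⟨n₀, by simpa using hn1⟩, ?_⟩⟩
  · intro t ht
    by_contra h
    have h1 := hα t h
    have h2 : ε ≤ (1 - |τ|) / 2 := min_le_right _ _
    have h3 := abs_sub_abs_le_abs_sub t τ
    linarith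
  · intro t n h
    refine ⟨r, hr0, ?_⟩
    have h1 := hα t (left_ne_zero_of_mul h)
    have h2 := hβ n (right_ne_zero_of_mul h)
    exact hball (show dist (t, n) (τ, n₀) < δ from
      (max_lt (by rwa [Real.dist_eq]) h2).trans_le (min_le_left _ _))
  · rw [α.one_of_mem_closedBall (mem_closedBall_self (by linarith [α.rIn_pos]))]
    exact one_ne_zero
  · rw [β.one_of_mem_closedBall (mem_closedBall_self (by linarith [β.rIn_pos]))]
    exact one_ne_zero

/-- The function of degree `-4` with the given profiles. -/
def packetFun (α : ℝ → ℝ) (β : Space → ℝ) (x : Mink) : ℝ :=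
  (‖spatial x‖ ^ 4)⁻¹ * (α (x 0 / ‖spatial x‖) * β (‖spatial x‖⁻¹ • spatial x))

/-- The weight in `θ` of the reflected packet. -/
def packetWt (α : ℝ → ℝ) (s : Bool) (θ : ℝ) : ℝ := α (sgn s * Real.tanh θ) / Real.cosh θ ^ 2

/-- The angular profile of the reflected packet. -/
def packetAng (β : Space → ℝ) (s : Bool) (n : Space) : ℝ := β (sgn s • n)

/-- On the hyperboloid |z| = cosh θ and z⁰/|z| = tanh θ, so a packet factorizes into a function of θ
and one of n, as the tail construction demands. -/
theorem packetFun_hyp (α : ℝ → ℝ) (β : Space → ℝ) (s : Bool) (θ : ℝ) (n : Sph) :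
    Real.cosh θ ^ 2 * packetFun α β (sgn s • hyp θ n) = packetWt α s θ * packetAng β s n := by
  have hc := Real.cosh_pos θ
  have h1 : spatial (hyp θ n) = Real.cosh θ • (n : Space) := by ext i; simp [hyp]
  have h2 : ‖spatial (sgn s • hyp θ n)‖ = Real.cosh θ := by
    rw [spatial_smul, h1, norm_smul, norm_smul, norm_sph, Real.norm_eq_abs, abs_sgn,
      Real.norm_of_nonneg hc.le]
    ring
  have h3 : (sgn s • hyp θ n) 0 = sgn s * Real.sinh θ := by simp [hyp]
  have h4 : (Real.cosh θ)⁻¹ • spatial (sgn s • hyp θ n) = sgn s • (n : Space) := by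
    rw [spatial_smul, h1, smul_comm, inv_smul_smul₀ hc.ne']
  rw [packetFun, h2, h3, h4, packetWt, packetAng, Real.tanh_eq_sinh_div_cosh, mul_div_assoc]
  field_simp

theorem packetFun_smul (α : ℝ → ℝ) (β : Space → ℝ) {μ : ℝ} (hμ : 0 < μ) (x : Mink) :
    packetFun α β (μ • x) = (μ ^ 4)⁻¹ * packetFun α β x := by
  have h1 : ‖spatial (μ • x)‖ = μ * ‖spatial x‖ := by
    rw [spatial_smul, norm_smul, Real.norm_of_nonneg hμ.le]
  have h2 : (μ • x) 0 / (μ * ‖spatial x‖) = x 0 / ‖spatial x‖ :=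
    mul_div_mul_left _ _ hμ.ne'
  have h3 : (μ * ‖spatial x‖)⁻¹ • spatial (μ • x) = ‖spatial x‖⁻¹ • spatial x := by
    rw [spatial_smul, smul_smul, mul_inv, mul_comm μ⁻¹, mul_assoc, inv_mul_cancel₀ hμ.ne', mul_one]
  rw [packetFun, h1, h2, h3, packetFun, mul_pow, mul_inv, mul_assoc]

section Packet

variable {U : Set Mink} {α : ℝ → ℝ} {β : Space → ℝ}

theorem IsPacket.packetFun_eq_zero (h : IsPacket U α β) {x : Mink} (hx : ‖spatial x‖ < |x 0|) :
    packetFun α β x = 0 := by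
  obtain ⟨T, hT, hα⟩ := h.bound
  rcases (norm_nonneg (spatial x)).eq_or_lt with h0 | h0
  -- On the time axis the prefactor is the inverse of 0, which is 0 by convention.
  · simp [packetFun, ← h0]
  · rw [packetFun, hα, zero_mul, mul_zero]
    rw [abs_div, abs_of_pos h0]
    exact hT.trans ((one_lt_div h0).2 hx)

/-- The only danger is the time axis, where x/|x| is singular; the packet vanishes in a
neighbourhood of it because α is supported in slopes bounded by T < 1. -/
theorem IsPacket.contDiffOn_packetFun (h : IsPacket U α β) :
    ContDiffOn ℝ ∞ (packetFun α β) {x | x ≠ 0} := by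
  intro x hx
  refine ContDiffAt.contDiffWithinAt ?_
  have hs := contDiff_spatial.contDiffAt (x := x)
  by_cases h0 : spatial x = 0
  · have h1 : x 0 ≠ 0 := fun h' => hx (by rw [← mkVec_spatial x, h0, h']; ext a
                                          refine Fin.cases ?_ (fun i => ?_) a <;> simp)
    have h2 : ∀ᶠ y in 𝓝 x, ‖spatial y‖ < |y 0| := by
      have hs' := continuous_spatial
      refine (isOpen_lt (by fun_prop) (by fun_prop)).mem_nhds ?_
      change ‖spatial x‖ < |x 0|
      rw [h0, norm_zero]
      exact abs_pos.2 h1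
    refine (contDiffAt_const (c := (0 : ℝ))).congr_of_eventuallyEq ?_
    filter_upwards [h2] with y hy using h.packetFun_eq_zero hy
  · have hn : ContDiffAt ℝ ∞ (fun y => ‖spatial y‖) x := hs.norm ℝ h0
    have hn0 : ‖spatial x‖ ≠ 0 := norm_ne_zero_iff.2 h0
    exact ((hn.pow 4).inv (pow_ne_zero _ hn0)).mul
      ((h.smooth_left.contDiffAt.comp x ((contDiff_apply ℝ ℝ (0 : Fin 4)).contDiffAt.div hn hn0)).mul
      (h.smooth_right.contDiffAt.comp x ((hn.inv hn0).smul hs)))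

theorem IsPacket.exists_smul_mem (h : IsPacket U α β) {x : Mink} (hx : packetFun α β x ≠ 0) :
    ∃ μ : ℝ, 0 < μ ∧ μ • x ∈ U := by
  have h1 := left_ne_zero_of_mul hx
  have h0 : ‖spatial x‖ ≠ 0 := fun h' => by simp [h'] at h1
  have hpos : 0 < ‖spatial x‖ := lt_of_le_of_ne (norm_nonneg _) h0.symm
  obtain ⟨μ, hμ, hm⟩ := h.support _ _ (right_ne_zero_of_mul hx)
  refine ⟨μ * ‖spatial x‖⁻¹, by positivity, ?_⟩
  rw [div_eq_inv_mul, mkVec_smul, mkVec_spatial, smul_smul] at hm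
  exact hm

theorem IsPacket.exists_isWeight (h : IsPacket U α β) : ∃ R, ∀ s, IsWeight R (packetWt α s) := by
  obtain ⟨T, hT, hα⟩ := h.bound
  -- If |tanh θ| ≤ T then cosh² θ ≤ 1/(1 - T²), and |θ| ≤ |sinh θ| ≤ cosh θ ≤ cosh² θ. Adding 1 puts
  -- the closed support inside the open interval.
  refine ⟨1 / (1 - T ^ 2) + 1, fun s => ⟨?_, ?_⟩⟩
  · have h1 : ContDiff ℝ ∞ Real.tanh := by
      have : Real.tanh = fun θ => Real.sinh θ / Real.cosh θ := funext Real.tanh_eq_sinh_div_cosh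
      rw [this]
      exact Real.contDiff_sinh.div Real.contDiff_cosh fun θ => (Real.cosh_pos θ).ne'
    exact (h.smooth_left.comp (contDiff_const.mul h1)).div (Real.contDiff_cosh.pow 2)
      fun θ => pow_ne_zero _ (Real.cosh_pos θ).ne'
  · have htanh : Continuous Real.tanh := by
      have : Real.tanh = fun θ => Real.sinh θ / Real.cosh θ := funext Real.tanh_eq_sinh_div_cosh
      rw [this]
      exact Real.continuous_sinh.div Real.continuous_cosh fun θ => (Real.cosh_pos θ).ne'
    have h1 : tsupport (packetWt α s) ⊆ {θ | |Real.tanh θ| ≤ T} := by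
      refine closure_minimal (fun θ hθ => ?_) (isClosed_le htanh.abs continuous_const)
      by_contra h2
      refine hθ ?_
      rw [packetWt, hα, zero_div]
      rw [abs_mul, abs_sgn, one_mul]
      exact not_le.1 h2
    refine h1.trans fun θ hθ => abs_lt.1 ?_
    have hθ' : |Real.tanh θ| ≤ T := hθ
    have hT0 : 0 ≤ T := (abs_nonneg _).trans hθ'
    have hT2 : 0 < 1 - T ^ 2 := by nlinarith
    have hc := Real.cosh_pos θ
    have h2 : Real.tanh θ ^ 2 ≤ T ^ 2 := sq_le_sq' (by linarith [neg_abs_le (Real.tanh θ)])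
      ((le_abs_self _).trans hθ')
    have h3 : Real.cosh θ ^ 2 ≤ 1 / (1 - T ^ 2) := by
      rw [Real.tanh_eq_sinh_div_cosh, div_pow, div_le_iff₀ (by positivity), Real.sinh_sq] at h2
      rw [le_div_iff₀ hT2]
      linarith
    have h4 : |θ| ≤ |Real.sinh θ| := by
      rw [Real.abs_sinh]
      exact Real.self_le_sinh_iff.2 (abs_nonneg _)
    have h5 : |Real.sinh θ| ≤ Real.cosh θ := abs_le_of_sq_le_sq (by rw [Real.sinh_sq]; linarith) hc.le
    nlinarith [Real.one_le_cosh θ]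

theorem IsPacket.packetWt_nonneg (h : IsPacket U α β) (s : Bool) (θ : ℝ) : 0 ≤ packetWt α s θ :=
  div_nonneg (h.nonneg_left _) (sq_nonneg _)

theorem IsPacket.packetAng_nonneg (h : IsPacket U α β) (s : Bool) (n : Space) :
    0 ≤ packetAng β s n := h.nonneg_right _

theorem IsPacket.sphSmooth_packetAng (h : IsPacket U α β) (s : Bool) : SphSmooth (packetAng β s) :=
  ContDiff.sphSmooth (h.smooth_right.comp (contDiff_const_smul _))

/-- The total mass of a packet and its reflection. -/
def packetMass (α : ℝ → ℝ) (β : Space → ℝ) : ℝ :=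
  ∑ s, (∫ θ, packetWt α s θ) * ∫ n : Sph, packetAng β s n ∂sphMeasure

/-- The integral of a packet and its reflection against a function. -/
def packetInt (α : ℝ → ℝ) (β : Space → ℝ) (F : Mink → ℝ) : ℝ :=
  ∑ s, ∫ p : ℝ × Sph, packetWt α s p.1 * packetAng β s p.2 * F (hyp p.1 p.2)
    ∂(volume.prod sphMeasure)

theorem IsPacket.packetMass_pos (h : IsPacket U α β) : 0 < packetMass α β := by
  obtain ⟨R, hR⟩ := h.exists_isWeight
  have h0 : ∀ s, 0 ≤ (∫ θ, packetWt α s θ) * ∫ n : Sph, packetAng β s n ∂sphMeasure := fun s =>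
    mul_nonneg (integral_nonneg (h.packetWt_nonneg s))
      (integral_nonneg fun n => h.packetAng_nonneg s n)
  refine Finset.sum_pos' (fun s _ => h0 s) ⟨true, Finset.mem_univ _, mul_pos ?_ ?_⟩
  · obtain ⟨T, hT, hα⟩ := h.bound
    obtain ⟨t, ht⟩ := h.pos_left
    have ht1 : |t| < 1 := (le_of_not_gt fun h' => ht (hα t h')).trans_lt hT
    refine (hR true).smooth.continuous.integral_pos_of_hasCompactSupport_nonneg_nonzero
      (hR true).hasCompactSupport (h.packetWt_nonneg true) (x := Real.artanh t) ?_
    rw [packetWt, Real.tanh_artanh (abs_lt.1 ht1)]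
    refine div_ne_zero (by simpa [sgn] using ht) (pow_ne_zero _ (Real.cosh_pos _).ne')
  · obtain ⟨n, hn⟩ := h.pos_right
    refine (h.sphSmooth_packetAng true).continuous.integral_pos_of_hasCompactSupport_nonneg_nonzero
      (HasCompactSupport.of_compactSpace _) (fun n => h.packetAng_nonneg true n) (x := n) ?_
    simpa [packetAng, sgn] using hn

/-- A packet integrates a function to at least its lower bound times the mass. -/
theorem IsPacket.mul_packetMass_le (h : IsPacket U α β) {F : Mink → ℝ}
    (hF : Continuous fun p : ℝ × Sph => F (hyp p.1 p.2)) {m : ℝ}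
    (hm : ∀ θ (n : Sph) s, sgn s • hyp θ n ∈ {x | ∃ μ : ℝ, 0 < μ ∧ μ • x ∈ U} → m ≤ F (hyp θ n)) :
    m * packetMass α β ≤ packetInt α β F := by
  obtain ⟨R, hR⟩ := h.exists_isWeight
  rw [packetMass, packetInt, Finset.mul_sum]
  refine Finset.sum_le_sum fun s _ => ?_
  have hcont : Continuous fun p : ℝ × Sph => packetWt α s p.1 * packetAng β s p.2 :=
    ((hR s).smooth.continuous.comp continuous_fst).mul
      ((h.sphSmooth_packetAng s).continuous.comp continuous_snd)
  have hsupp : HasCompactSupport fun p : ℝ × Sph => packetWt α s p.1 * packetAng β s p.2 :=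
    HasCompactSupport.intro ((isCompact_Icc (a := -R) (b := R)).prod isCompact_univ) fun p hp => by
      rw [(hR s).eq_zero fun h => hp ⟨h, mem_univ _⟩, zero_mul]
  rw [← integral_prod_mul (packetWt α s) (fun n : Sph => packetAng β s n), ← integral_const_mul]
  refine integral_mono ((hcont.integrable_of_hasCompactSupport hsupp).const_mul m)
    ((hcont.mul hF).integrable_of_hasCompactSupport hsupp.mul_right) fun p => ?_
  simp only
  rcases eq_or_ne (packetWt α s p.1 * packetAng β s p.2) 0 with h0 | h0
  · rw [h0]; simp
  · rw [mul_comm]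
    refine mul_le_mul_of_nonneg_left (hm p.1 p.2 s (h.exists_smul_mem fun h' => h0 ?_))
      (mul_nonneg (h.packetWt_nonneg s p.1) (h.packetAng_nonneg s p.2))
    rw [← packetFun_hyp, h', mul_zero]

end Packet

theorem packetInt_neg (α : ℝ → ℝ) (β : Space → ℝ) (F : Mink → ℝ) :
    packetInt α β (fun x => -F x) = -packetInt α β F := by
  simp only [packetInt, mul_neg, integral_neg, Finset.sum_neg_distrib]

/-- A combination of reflection symmetric packets. -/
def packetDensity (k : Bool → ℝ) (α : Bool → ℝ → ℝ) (β : Bool → Space → ℝ) (x : Mink) : ℝ :=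
  ∑ i : Bool × Bool, k i.1 * packetFun (α i.1) (β i.1) (sgn i.2 • x)

section Density

variable {k : Bool → ℝ} {α : Bool → ℝ → ℝ} {β : Bool → Space → ℝ} {U : Bool → Set Mink}

theorem packetDensity_hyp (θ : ℝ) (n : Sph) :
    Real.cosh θ ^ 2 * packetDensity k α β (hyp θ n)
      = ∑ i : Bool × Bool, (k i.1 * packetWt (α i.1) i.2 θ) * packetAng (β i.1) i.2 n := by
  rw [packetDensity, Finset.mul_sum]
  refine Finset.sum_congr rfl fun i _ => ?_
  rw [mul_left_comm, packetFun_hyp, mul_assoc]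

theorem exists_isWeight_packets (h : ∀ j, IsPacket (U j) (α j) (β j)) :
    ∃ R, ∀ i : Bool × Bool, IsWeight R fun θ => k i.1 * packetWt (α i.1) i.2 θ := by
  choose R hR using fun j => (h j).exists_isWeight
  refine ⟨max (R true) (R false), fun i => ((hR i.1 i.2).mono ?_).const_mul _⟩
  cases i.1
  · exact le_max_right _ _
  · exact le_max_left _ _

theorem sum_mass_packets :
    ∑ i : Bool × Bool, (∫ θ, k i.1 * packetWt (α i.1) i.2 θ) *
      ∫ n : Sph, packetAng (β i.1) i.2 n ∂sphMeasure = ∑ j, k j * packetMass (α j) (β j) := by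
  rw [Fintype.sum_prod_type]
  refine Finset.sum_congr rfl fun j _ => ?_
  rw [packetMass, Finset.mul_sum]
  refine Finset.sum_congr rfl fun s _ => ?_
  rw [integral_const_mul, mul_assoc]

/-- Summing each packet with its reflection gives evenness and support in the double cone; the
weights k are there to balance the masses so that the integral vanishes. -/
theorem isAsymptoteDensity_packetDensity (h : ∀ j, IsPacket (U j) (α j) (β j)) {C : Set Mink}
    (hC : IsSpacelikeCone C) (hU : ∀ j, U j ⊆ C) (hk : ∑ j, k j * packetMass (α j) (β j) = 0) :
    IsAsymptoteDensity (C ∪ {x | -x ∈ C}) (packetDensity k α β) := by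
  refine ⟨?_, ?_, ?_, ?_, ?_⟩
  · refine ContDiffOn.sum fun i _ => contDiffOn_const.mul
      ((h i.1).contDiffOn_packetFun.comp (contDiff_const_smul _).contDiffOn fun x hx => ?_)
    refine smul_ne_zero (fun h0 => ?_) hx
    simpa [h0] using abs_sgn i.2
  · intro μ hμ x _
    rw [packetDensity, packetDensity, Finset.mul_sum]
    refine Finset.sum_congr rfl fun i _ => ?_
    rw [smul_comm, packetFun_smul _ _ hμ, mul_left_comm]
  · intro x
    simp only [packetDensity, Fintype.sum_prod_type, Fintype.sum_bool, sgn, if_true, smul_neg,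
      Bool.false_eq_true, if_false, neg_smul, one_smul, neg_neg]
    ring
  · obtain ⟨R, hR⟩ := exists_isWeight_packets (k := k) h
    rw [integral_density hR (fun i => (h i.1).sphSmooth_packetAng i.2) packetDensity_hyp,
      sum_mass_packets, hk]
  · intro x _ hx
    refine Finset.sum_eq_zero fun i _ => ?_
    by_contra h0
    obtain ⟨μ, hμ, hm⟩ := (h i.1).exists_smul_mem (right_ne_zero_of_mul h0)
    have h1 := hC.smul_mem _ (hU _ hm) μ⁻¹ (by positivity)
    rw [inv_smul_smul₀ hμ.ne'] at h1
    rcases sgn_smul_cases i.2 x with h2 | h2 <;> rw [h2] at h1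
    · exact hx (Or.inl h1)
    · exact hx (Or.inr h1)

theorem exists_memV_hasAsymptote (e : ℝ) {Vs : Mink → ℝ → Mink → Mink} (hVs : IsProfileFamily Vs)
    {v : Mink} (hv : v ∈ hypPlus) (h : ∀ j, IsPacket (U j) (α j) (β j))
    (hk : ∑ j, k j * packetMass (α j) (β j) = 0) : ∃ V, MemV V ∧
      HasAsymptote V (fun z => packetDensity k α β z • z) ∧
      phase e V Vs v = ∑ j, k j * packetInt (α j) (β j) (cloudF (cloudW e Vs v)) := by
  obtain ⟨R, hR⟩ := exists_isWeight_packets (k := k) h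
  have hb := fun i : Bool × Bool => (h i.1).sphSmooth_packetAng i.2
  have hU := isTail_coneTail hR hb (by rw [sum_mass_packets, hk])
  refine ⟨tailV _, memV_tailV hU,
    hasAsymptote_of_tail_eq hR hb packetDensity_hyp fun l hl => tail_tailV _ hl, ?_⟩
  rw [phase_eq_integral_cloudF e hVs hv hR hb fun l hl => tail_tailV _ hl, Fintype.sum_prod_type]
  refine Finset.sum_congr rfl fun j _ => ?_
  rw [packetInt, Finset.mul_sum]
  refine Finset.sum_congr rfl fun s _ => ?_
  rw [← integral_const_mul]
  refine integral_congr_ae (Eventually.of_forall fun p => ?_)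
  simp only
  ring

end Density

/-- Packets near `p` and `q` see different averages of an even function of degree `0`. -/
theorem exists_packets {O : Set Mink} (hO : IsOpen O) (hOs : O ⊆ spacelike) {F : Mink → ℝ}
    (hF : ContinuousOn F spacelike) (hneg : ∀ x ∈ spacelike, F (-x) = F x)
    (hsmul : ∀ x ∈ spacelike, ∀ μ : ℝ, 0 < μ → F (μ • x) = F x) {p q : Mink} (hp : p ∈ O)
    (hq : q ∈ O) (hpq : F q < F p) : ∃ (U : Bool → Set Mink) (α : Bool → ℝ → ℝ)
      (β : Bool → Space → ℝ), (∀ j, U j ⊆ O) ∧ (∀ j, IsPacket (U j) (α j) (β j)) ∧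
      packetInt (α false) (β false) F / packetMass (α false) (β false)
        < packetInt (α true) (β true) F / packetMass (α true) (β true) := by
  -- Two thresholds F q < m₂ < m₁ < F p separate the averages strictly, although each packet yields
  -- only a non-strict bound.
  obtain ⟨m₁, h1, h1p⟩ := exists_between hpq
  obtain ⟨m₂, hq2, h21⟩ := exists_between h1
  have hFO := hF.mono hOs
  have hFh : Continuous fun p : ℝ × Sph => F (hyp p.1 p.2) :=
    hF.comp_continuous continuous_hyp fun p => hyp_mem p.1 p.2
  -- Packets live over U only up to scaling and reflection; evenness and degree 0 carry the bounds
  -- on F from U back to the hyperboloid.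
  have hinv : ∀ θ (n : Sph) s (μ : ℝ), 0 < μ → F (μ • sgn s • hyp θ n) = F (hyp θ n) := by
    intro θ n s μ hμ
    have hm := hyp_mem θ n
    rcases sgn_smul_cases s (hyp θ n) with h | h <;> rw [h]
    · exact hsmul _ hm μ hμ
    · rw [hsmul _ (neg_mem_spacelike hm) μ hμ, hneg _ hm]
  obtain ⟨α₁, β₁, hP⟩ := exists_isPacket (hFO.isOpen_inter_preimage hO isOpen_Ioi)
    (inter_subset_left.trans hOs) (show p ∈ O ∩ F ⁻¹' Ioi m₁ from ⟨hp, h1p⟩)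
  obtain ⟨α₂, β₂, hQ⟩ := exists_isPacket (hFO.isOpen_inter_preimage hO isOpen_Iio)
    (inter_subset_left.trans hOs) (show q ∈ O ∩ F ⁻¹' Iio m₂ from ⟨hq, hq2⟩)
  refine ⟨fun j => cond j (O ∩ F ⁻¹' Ioi m₁) (O ∩ F ⁻¹' Iio m₂), fun j => cond j α₁ α₂,
    fun j => cond j β₁ β₂, fun j => ?_, fun j => ?_, ?_⟩
  · cases j <;> exact inter_subset_left
  · cases j
    · exact hQ
    · exact hP
  · have hP' := hP.mul_packetMass_le hFh (m := m₁) fun θ n s ⟨μ, hμ, hm⟩ =>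
      hinv θ n s μ hμ ▸ (le_of_lt hm.2)
    have hQ' := hQ.mul_packetMass_le (F := fun x => -F x) hFh.neg (m := -m₂)
      fun θ n s ⟨μ, hμ, hm⟩ => neg_le_neg (hinv θ n s μ hμ ▸ (le_of_lt hm.2))
    rw [packetInt_neg] at hQ'
    have h3 : packetInt α₂ β₂ F / packetMass α₂ β₂ ≤ m₂ :=
      (div_le_iff₀ hQ.packetMass_pos).2 (by linarith)
    have h4 : m₁ ≤ packetInt α₁ β₁ F / packetMass α₁ β₁ := (le_div_iff₀ hP.packetMass_pos).2 hP'
    exact h3.trans_lt (h21.trans_le h4)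

/-! ### Test spinors and an asymptote with phase π -/

theorem spatial_hypChart (p : Space) : spatial (hypChart p) = p := by ext i; simp [hypChart]

theorem hypChart_spatial {v : Mink} (hv : v ∈ hypPlus) : hypChart (spatial v) = v := by
  have h1 := hv.1
  rw [dot_self_eq] at h1
  rw [hypChart, show 1 + ‖spatial v‖ ^ 2 = v 0 ^ 2 by linarith, Real.sqrt_sq hv.2.le, mkVec_spatial]

theorem contDiff_hypChart : ContDiff ℝ ∞ hypChart := by
  refine contDiff_pi.2 fun a => ?_
  refine Fin.cases ?_ (fun i => ?_) a
  · refine ContDiff.sqrt (contDiff_const.add (contDiff_norm_sq ℝ)) fun p => ?_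
    positivity
  · exact (by fun_prop : ContDiff ℝ ∞ fun p : Space => p i)

/-- In the chart δ_b is a first order operator with smooth coefficients, so it preserves smooth
compactly supported functions; these are therefore Schwartz. -/
theorem exists_hypDeltaIter_eq {f : Mink → ℂ} {G : Space → ℂ} (hG : ContDiff ℝ ∞ G)
    (hGc : HasCompactSupport G) (hf : ∀ p, f (hypChart p) = G p) (I : List (Fin 4)) :
    ∃ H : Space → ℂ, ContDiff ℝ ∞ H ∧ HasCompactSupport H ∧
      ∀ p, hypDeltaIter I f (hypChart p) = H p := by
  induction I with
  | nil => exact ⟨G, hG, hGc, hf⟩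
  | cons b I ih =>
    obtain ⟨H, hH, hHc, hfH⟩ := ih
    refine ⟨fun p => fderiv ℝ H p
      (spatial (basisVec b - dot (basisVec b) (hypChart p) • hypChart p)), ?_, ?_, fun p => ?_⟩
    · refine (hH.fderiv_right (by simp)).clm_apply (contDiff_spatial.comp (contDiff_const.sub
        (((contDiff_dot_right _).comp contDiff_hypChart).smul contDiff_hypChart)))
    · refine (hHc.fderiv (𝕜 := ℝ)).mono fun p hp h0 => hp ?_
      simp [h0]
    · change fderiv ℝ (fun p => hypDeltaIter I f (hypChart p)) (spatial (hypChart p)) _ = _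
      simp only [hfH, spatial_hypChart]

theorem isTestSpinor_of_contDiff {g : Space → ℂ} (hg : ContDiff ℝ ∞ g) (hgc : HasCompactSupport g) :
    IsTestSpinor fun w _ => g (spatial w) := by
  refine ⟨contDiff_pi.2 fun _ => by simpa only [spatial_hypChart] using hg, fun α I => ?_⟩
  obtain ⟨H, hH, hHc, hf⟩ := exists_hypDeltaIter_eq (f := fun w => g (spatial w)) hg hgc
    (fun p => by rw [spatial_hypChart]) I
  have hc : Continuous fun p : Space => (∏ a, |hypChart p a| ^ α a) * ‖H p‖ := by
    have := contDiff_hypChart.continuous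
    have := hH.continuous
    fun_prop
  obtain ⟨B, hB⟩ := hc.bounded_above_of_compact_support (hHc.norm.mul_left)
  refine ⟨B, fun v hv _ => ?_⟩
  have h1 := (le_abs_self _).trans (hB (spatial v))
  rw [hypChart_spatial hv] at h1
  rw [← hf, hypChart_spatial hv] at h1
  exact h1

theorem basisVec_zero_mem : basisVec 0 ∈ hypPlus := by
  constructor <;> simp [dot, basisVec]

/-- A phase operator that acts trivially at `e₀` has a trivial phase there. -/
theorem exp_phase_eq_one {e : ℝ} {V : ℝ → Mink → Mink} {Vs : Mink → ℝ → Mink → Mink}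
    (h : ∀ f : Mink → Fin 4 → ℂ, IsTestSpinor f → ∀ v ∈ hypPlus, phaseOp e V Vs f v = f v) :
    Complex.exp (Complex.I * (phase e V Vs (basisVec 0) : ℂ)) = 1 := by
  let β : ContDiffBump (0 : Space) := ⟨1, 2, one_pos, by norm_num⟩
  have hs : spatial (basisVec 0) = 0 := by ext i; simp [basisVec]
  have h1 := congrFun (h (fun w _ => (β (spatial w) : ℂ)) (isTestSpinor_of_contDiff
    (g := fun p => (β p : ℂ)) (Complex.ofRealCLM.contDiff.comp β.contDiff)
    (β.hasCompactSupport.comp_left Complex.ofReal_zero)) _ basisVec_zero_mem) 0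
  have h2 : β 0 = 1 := β.one_of_mem_closedBall (mem_closedBall_self β.rIn_pos.le)
  simpa [phaseOp, hs, h2] using h1

/-- A nonzero phase could still be a multiple of 2π; since it is linear in the density, it can be
tuned. A single velocity, e₀, is enough for the contradiction. -/
theorem not_forall_phaseOp_eq (e : ℝ) (he : e ≠ 0) (Vs : Mink → ℝ → Mink → Mink)
    (hVs : IsProfileFamily Vs) (D : Set Mink) (hD : IsSymmetricalSpacelikeCone D) :
    ¬ ∀ ρ₁ : Mink → ℝ, IsAsymptoteDensity D ρ₁ → ∀ V₁ : ℝ → Mink → Mink, MemV V₁ →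
      HasAsymptote V₁ (fun z => ρ₁ z • z) → ∀ f : Mink → Fin 4 → ℂ, IsTestSpinor f →
        ∀ v ∈ hypPlus, phaseOp e V₁ Vs f v = f v := by
  intro H
  obtain ⟨C, hC, rfl⟩ := hD
  obtain ⟨hO, hne, hOs⟩ := interior_diff_zero_nonempty hC
  have hv := basisVec_zero_mem
  have hW := sphSmooth_cloudW e hVs hv
  set F := cloudF (cloudW e Vs (basisVec 0)) with hFdef
  obtain ⟨x, hx⟩ := hne
  obtain ⟨y, hy, hyx⟩ := not_const_of_box he
    (fun x hx => box_cloudF hW (sum_hgt_cloudW e hVs hv) hx) hO ⟨x, hx⟩ hOs (F x)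
  obtain ⟨p, hp, q, hq, hpq⟩ : ∃ p ∈ interior C \ {0}, ∃ q ∈ interior C \ {0}, F q < F p := by
    rcases lt_or_gt_of_ne hyx with h | h
    · exact ⟨x, hx, y, hy, h⟩
    · exact ⟨y, hy, x, hx, h⟩
  obtain ⟨U, α, β, hU, hP, hlt⟩ := exists_packets hO hOs (contDiffOn_cloudF hW).continuousOn
    (fun x hx => cloudF_neg e hVs hv hx) (fun x hx μ hμ => cloudF_smul e hVs hv hx hμ) hp hq hpq
  have hM := fun j => (hP j).packetMass_pos
  set δ := packetInt (α true) (β true) F / packetMass (α true) (β true)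
    - packetInt (α false) (β false) F / packetMass (α false) (β false) with hδ
  have hδ0 : 0 < δ := sub_pos.2 hlt
  -- Dividing by the masses and taking opposite signs makes the total mass zero, while the phase
  -- becomes (π/δ) times the difference δ of the two averages of F, that is π.
  let k : Bool → ℝ := fun j => sgn j * (Real.pi / δ) / packetMass (α j) (β j)
  have hk : ∑ j, k j * packetMass (α j) (β j) = 0 := by
    simp only [k, div_mul_cancel₀ _ (hM _).ne', Fintype.sum_bool, sgn]
    simp
  obtain ⟨V, hV, hVa, hph⟩ := exists_memV_hasAsymptote e hVs hv hP hk
  have hφ : phase e V Vs (basisVec 0) = Real.pi := by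
    have h1 : ∑ j, k j * packetInt (α j) (β j) F = Real.pi / δ * δ := by
      rw [hδ, Fintype.sum_bool]
      simp only [k, sgn, if_true, Bool.false_eq_true, if_false]
      ring
    rw [hph, h1, div_mul_cancel₀ _ hδ0.ne']
  have h2 := exp_phase_eq_one (H _ (isAsymptoteDensity_packetDensity hP hC
    (fun j => (hU j).trans fun x hx => interior_subset hx.1) hk) V hV hVa)
  rw [hφ, mul_comm, Complex.exp_pi_mul_I] at h2
  norm_num at h2

end AsympQED

end

theorem mainTheorem3 (e : ℝ) (he : e ≠ 0)
    (Vs : AsympQED.Mink → ℝ → AsympQED.Mink → AsympQED.Mink)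
    (hVs : AsympQED.IsProfileFamily Vs) :
    (∀ D : Set AsympQED.Mink, AsympQED.IsSymmetricalSpacelikeCone D →
      ¬ ∀ ρ₁ : AsympQED.Mink → ℝ, AsympQED.IsAsymptoteDensity D ρ₁ →
        ∀ V₁ : ℝ → AsympQED.Mink → AsympQED.Mink, AsympQED.MemV V₁ →
          AsympQED.HasAsymptote V₁ (fun z => ρ₁ z • z) →
          ∀ f : AsympQED.Mink → Fin 4 → ℂ, AsympQED.IsTestSpinor f →
            ∀ v ∈ AsympQED.hypPlus, AsympQED.phaseOp e V₁ Vs f v = f v) ∧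
    (∀ v ∈ AsympQED.hypPlus, ∃ F : AsympQED.Mink → ℝ,
      (∀ x ∈ AsympQED.spacelike,
        Tendsto (AsympQED.truncF e Vs v x) (𝓝[>] 0) (𝓝 (F x))) ∧
      (∀ x ∈ AsympQED.spacelike, F (-x) = F x) ∧
      (∀ x ∈ AsympQED.spacelike, ∀ μ : ℝ, 0 < μ → F (μ • x) = F x) ∧
      ContDiffOn ℝ 2 F AsympQED.spacelike ∧
      (∀ x ∈ AsympQED.spacelike,
        AsympQED.box F x = 2 * e / AsympQED.dot x x) ∧
      (∀ D : Set AsympQED.Mink, AsympQED.IsSymmetricalSpacelikeCone D →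
        ¬ ∃ c : ℝ, ∀ x ∈ D, x ≠ 0 → F x = c)) :=
  ⟨AsympQED.not_forall_phaseOp_eq e he Vs hVs,
    fun v hv => AsympQED.exists_potential e he Vs hVs v hv⟩
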